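/- **Setting.** Let $M,N,P,L\ge 1$ be the numbers of antennas, subcarriers, subpaths and channel taps, $\tilde d\in(0,\tfrac12)$ the antenna spacing in wavelengths, $f_d,\xi\in\mathbb R$ the true normalized maximum Doppler frequency offset (DFO) and oscillator frequency offset (OFO), $\sigma_{\rm n}^2>0$ the noise power and $\sigma_1^2,\dots,\sigma_L^2\ge0$ the channel power profile, $\sum_l\sigma_l^2=1$. For a fully calibrated uniform linear array the steering vector is $\mathbf a(\theta)=(e^{{\rm j}2\pi\tilde d\,r\cos\theta})_{r=0}^{M-1}$. For a pilot $\mathbf x\in\mathbb C^N$ put $\mathbf B=\sqrt N\,\mathbf F^H{\rm diag}(\mathbf x)\mathbf F_L$, where $\mathbf F$ is the unitary $N\times N$ DFT matrix and $\mathbf F_L$ consists of its first $L$ columns. Let $\mathbf P_{\mathbf B}^\perp$ be the orthogonal projection onto the orthogonal complement of the column space of $\mathbf B$, $\mathbf E(\varphi)={\rm diag}(e^{{\rm j}2\pi\varphi n/N})_{n=0}^{N-1}$ and $\mathbf D={\rm j}\frac{2\pi}{N}{\rm diag}(0,1,\dots,N-1)$. The received pilot block is $\mathbf Y_0+\mathbf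 W$ with $$\mathbf Y_0=\sum_{p=1}^P\mathbf E(f_d\cos\theta_p+\xi)\,\mathbf B\mathbf h_p\,\mathbf a^T(\theta_p),\qquad \theta_p=2\pi p/P,$$ where the entries $g_{l,p}\sim\mathcal{CN}(0,\sigma_l^2/P)$ of the vectors $\mathbf h_p\in\mathbb C^L$ and the entries of $\mathbf W\in\mathbb C^{N\times M}$, distributed as $\mathcal{CN}(0,\sigma_{\rm n}^2)$, are all independent. The joint estimator minimizes over $(\tilde f,\tilde\xi)$ the cost $\sum_q\|\mathbf r_q(\mathbf Y_0+\mathbf W)\|^2$, where $$\mathbf r_q(\mathbf Y)=\mathbf P_{\mathbf B}^\perp\mathbf E^H(\tilde f\cos\vartheta_q+\tilde\xi)\,\mathbf Y\,\mathbf a^*(\vartheta_q)/M$$ and $\vartheta_q$ runs over the directions of the IFFT grid, $\cos\vartheta_q=\frac1{\tilde d}\left(\frac{q-1}{M}-\frac12\right)$, $1\le q\le M$, for which the right-hand side lies in $[-1,1]$. Write $g_0=\sum_q\|\mathbf r_q(\mathbf Y_0)\|^2$ for the interference part of the cost and $g_{\rm n}=2\Re\sum_q\langle\mathbf r_q(\mathbf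 Y_0),\mathbf r_q(\mathbf W)\rangle$ for its noise part. With all derivatives taken at $(\tilde f,\tilde\xi)=(f_d,\xi)$ and expectations taken over channel gains and noise for the given pilot, define the noise-induced MSE and the interference-induced MSE floor of the estimate of $u\in\{\tilde f,\tilde\xi\}$ by $$\mathrm{MSE}_{\rm n}\{u\}=\frac{E\{(\partial g_{\rm n}/\partial u)^2\}}{(E\{\partial^2g_0/\partial u^2\})^2},\qquad \mathrm{MSE}_0\{u\}=\frac{(E\{\partial g_0/\partial u\})^2}{(E\{\partial^2g_0/\partial u^2\})^2}.$$ **Proposition.** Let $L,\sigma_1^2,\dots,\sigma_L^2,\tilde d,f_d,\xi,\sigma_{\rm n}^2$ be fixed as above. 1. Fix $N\ge L$ and a pilot $\mathbf x$ such that $\mathbf D\mathbf b_l$ is not in the column space of $\mathbf B=[\mathbf b_1,\dots,\mathbf b_L]$ for some $l$ with $\sigma_l^2>0$. Then, as $M,P\to\infty$ (jointly, in any manner), $$\frac{\mathrm{MSE}_{\rm n}\{\tilde f\}}{\mathrm{MSE}_{\rm n}\{\tilde\xi\}}\to2,\qquad M\,\mathrm{MSE}_0\{\tilde f\}\to0,\qquad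 M\,\mathrm{MSE}_0\{\tilde\xi\}\to0.$$ 2. Let the $N$ pilot symbols be independent with a common law on $\mathbb C$ that has mean zero, unit mean power and finite fourth moment. Then, as $M,N,P\to\infty$ (jointly, in any manner), in probability with respect to the pilot, $$\frac{\mathrm{MSE}_{\rm n}\{\tilde f\}}{3\sigma_{\rm n}^2/(\pi^2MN)}\to1,\qquad \frac{2\,\mathrm{MSE}_{\rm n}\{\tilde\xi\}}{3\sigma_{\rm n}^2/(\pi^2MN)}\to1,\qquad M\,\mathrm{MSE}_0\{\tilde f\}\to0,\qquad M\,\mathrm{MSE}_0\{\tilde\xi\}\to0.$$ In particular both interference floors $\mathrm{MSE}_0$ tend to $0$ in both regimes. -/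

import Mathlib

open MeasureTheory ProbabilityTheory Filter Topology
open scoped NNReal ENNReal Matrix

noncomputable section

namespace JointCFO

/-! ### Signal model -/

/-- Steering vector `a(θ)` of a fully calibrated uniform linear array with `M` antennas; `dt` is the
antenna spacing divided by the carrier wavelength. The antennas are numbered `0, …, M - 1`. -/
def steering (M : ℕ) (dt θ : ℝ) : Fin M → ℂ := fun r =>
  Complex.exp (Complex.I * ((2 * Real.pi * dt * (r : ℝ) * Real.cos θ : ℝ) : ℂ))

/-- The first `L` columns of the unitary `N × N` discrete Fourier transform matrix. -/
def dftColumns (N L : ℕ) : Matrix (Fin N) (Fin L) ℂ := Matrix.of fun k n =>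
  Complex.exp (-(Complex.I * ((2 * Real.pi * (k : ℝ) * (n : ℝ) / (N : ℝ) : ℝ) : ℂ))) /
    ((Real.sqrt N : ℝ) : ℂ)

/-- `B = √N Fᴴ diag(x) F_L`, where `x` is the frequency domain pilot block and `L` the number of
channel taps. -/
def pilotMatrix (L : ℕ) {N : ℕ} (x : Fin N → ℂ) : Matrix (Fin N) (Fin L) ℂ :=
  ((Real.sqrt N : ℝ) : ℂ) • ((dftColumns N N)ᴴ * Matrix.diagonal x * dftColumns N L)

/-- `E(φ) = diag(1, e^{j2πφ/N}, …, e^{j2πφ(N-1)/N})`. -/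
def rotation (N : ℕ) (φ : ℝ) : Matrix (Fin N) (Fin N) ℂ := Matrix.diagonal fun n =>
  Complex.exp (Complex.I * ((2 * Real.pi * φ * (n : ℝ) / (N : ℝ) : ℝ) : ℂ))

/-- `D = j (2π/N) diag(0, 1, …, N - 1)`. -/
def rotationGenerator (N : ℕ) : Matrix (Fin N) (Fin N) ℂ := Matrix.diagonal fun n =>
  Complex.I * ((2 * Real.pi * (n : ℝ) / (N : ℝ) : ℝ) : ℂ)

/-- Angle of arrival of the `p`-th subpath (the subpaths are numbered `0, …, P - 1` here). -/
def aoa (P : ℕ) (p : Fin P) : ℝ := 2 * Real.pi * ((p : ℝ) + 1) / (P : ℝ)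

/-- Noiseless received pilot block `Y₀ = ∑ₚ E(f_d cos θₚ + ξ) B hₚ a(θₚ)ᵀ`; here `g l p` is the gain
of the `p`-th subpath of the `l`-th tap, so that `hₚ = (g l p)_l`. -/
def noiselessSignal {L N : ℕ} (x : Fin N → ℂ) (dt fd xi : ℝ) (M P : ℕ) (g : Fin L → Fin P → ℂ) :
    Matrix (Fin N) (Fin M) ℂ :=
  ∑ p : Fin P, Matrix.vecMulVec
    (rotation N (fd * Real.cos (aoa P p) + xi) *ᵥ (pilotMatrix L x *ᵥ fun l => g l p))
    (steering M dt (aoa P p))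

/-! ### Beamforming and the cost function of the estimator -/

/-- Cosine of the `r`-th direction of the IFFT grid: `(1/dt) (r/M - 1/2)`, `r = 0, …, M - 1`. -/
def gridCos (M : ℕ) (dt : ℝ) (r : Fin M) : ℝ := (1 / dt) * ((r : ℝ) / (M : ℝ) - 1 / 2)

/-- The grid points that correspond to physical directions. -/
def beams (M : ℕ) (dt : ℝ) : Finset (Fin M) := Finset.univ.filter fun r => |gridCos M dt r| ≤ 1

/-- Direction of the `r`-th beam. -/
def beamAngle (M : ℕ) (dt : ℝ) (r : Fin M) : ℝ := Real.arccos (gridCos M dt r)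

/-- Output `z(θ) = Y b(θ)^*` of the beamformer `b(θ) = a(θ)/M` applied to `Y`. -/
def beamOutput {N M : ℕ} (dt : ℝ) (Y : Matrix (Fin N) (Fin M) ℂ) (θ : ℝ) : Fin N → ℂ :=
  Y *ᵥ fun m => star ((1 / (M : ℂ)) * steering M dt θ m)

/-- The subspace of `ℂᴺ` that is spanned by the columns of `B`. -/
def pilotSpan (L : ℕ) {N : ℕ} (x : Fin N → ℂ) : Submodule ℂ (EuclideanSpace ℂ (Fin N)) :=
  Submodule.span ℂ (Set.range fun l : Fin L => WithLp.toLp 2 fun n => pilotMatrix L x n l)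

/-- `P_B^⊥ Eᴴ(f cos θ_r + ξ) z(θ_r)`: the part of the `r`-th branch, compensated with the trial values
`f` of the maximum DFO and `xi` of the OFO, that is orthogonal to the columns of `B`. -/
def branchResidual (L : ℕ) {N M : ℕ} (x : Fin N → ℂ) (dt : ℝ) (Y : Matrix (Fin N) (Fin M) ℂ)
    (f xi : ℝ) (r : Fin M) : EuclideanSpace ℂ (Fin N) :=
  (pilotSpan L x)ᗮ.starProjection
    (WithLp.toLp 2 ((rotation N (f * Real.cos (beamAngle M dt r) + xi))ᴴ *ᵥ
      beamOutput dt Y (beamAngle M dt r)))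

/-- The cost function that the joint estimator minimizes over the trial values `(f, xi)`, given the
received block `Y`. -/
def cost (L : ℕ) {N M : ℕ} (x : Fin N → ℂ) (dt : ℝ) (Y : Matrix (Fin N) (Fin M) ℂ)
    (f xi : ℝ) : ℝ :=
  ∑ r ∈ beams M dt, ‖branchResidual L x dt Y f xi r‖ ^ 2

/-- The part of the cost at `Y + W` that is bilinear in the noiseless block `Y` and the noise `W`. -/
def crossCost (L : ℕ) {N M : ℕ} (x : Fin N → ℂ) (dt : ℝ) (Y W : Matrix (Fin N) (Fin M) ℂ)
    (f xi : ℝ) : ℝ :=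
  2 * (∑ r ∈ beams M dt, inner ℂ (branchResidual L x dt Y f xi r) (branchResidual L x dt W f xi r)).re

/-! ### Randomness -/

/-- The circularly symmetric complex normal law `CN(0, v)`. -/
def complexNormal (v : ℝ≥0) : Measure ℂ :=
  ((gaussianReal 0 (v / 2)).prod (gaussianReal 0 (v / 2))).map fun u => (⟨u.1, u.2⟩ : ℂ)

/-- Joint law of the subpath gains (independent, `CN(0, pdp l / P)`) and of the entries of the noise
matrix (independent, `CN(0, s)`), the gains being independent of the noise. -/
def law {L : ℕ} (pdp : Fin L → ℝ≥0) (s : ℝ≥0) (N M P : ℕ) :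
    Measure ((Fin L → Fin P → ℂ) × (Fin N → Fin M → ℂ)) :=
  (Measure.pi fun l => Measure.pi fun _ : Fin P => complexNormal (pdp l / (P : ℝ≥0))).prod
    (Measure.pi fun _ : Fin N => Measure.pi fun _ : Fin M => complexNormal s)

section Quantities

variable {L N : ℕ} (pdp : Fin L → ℝ≥0) (x : Fin N → ℂ) (dt fd xi : ℝ) (s : ℝ≥0) (M P : ℕ)

/-- The interference part `g₀` of the cost, at the trial values `(f, e)`. -/
def g0 (g : Fin L → Fin P → ℂ) (f e : ℝ) : ℝ :=
  cost L x dt (noiselessSignal x dt fd xi M P g) f e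

/-- The noise part `gₙ` of the cost, at the trial values `(f, e)`. -/
def gn (g : Fin L → Fin P → ℂ) (w : Fin N → Fin M → ℂ) (f e : ℝ) : ℝ :=
  crossCost L x dt (noiselessSignal x dt fd xi M P g) (Matrix.of w) f e

/-- Mean of `∂g₀/∂f` at the true parameters. -/
def meanSlopeDFO : ℝ :=
  ∫ ω, deriv (fun f => g0 x dt fd xi M P ω.1 f xi) fd ∂(law pdp s N M P)

/-- Mean of `∂g₀/∂ξ` at the true parameters. -/
def meanSlopeOFO : ℝ :=
  ∫ ω, deriv (fun e => g0 x dt fd xi M P ω.1 fd e) xi ∂(law pdp s N M P)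

/-- Second moment of `∂gₙ/∂f` at the true parameters. -/
def noiseSlopeDFO : ℝ :=
  ∫ ω, (deriv (fun f => gn x dt fd xi M P ω.1 ω.2 f xi) fd) ^ 2 ∂(law pdp s N M P)

/-- Second moment of `∂gₙ/∂ξ` at the true parameters. -/
def noiseSlopeOFO : ℝ :=
  ∫ ω, (deriv (fun e => gn x dt fd xi M P ω.1 ω.2 fd e) xi) ^ 2 ∂(law pdp s N M P)

/-- Mean of `∂²g₀/∂f²` at the true parameters. -/
def meanCurvatureDFO : ℝ :=
  ∫ ω, iteratedDeriv 2 (fun f => g0 x dt fd xi M P ω.1 f xi) fd ∂(law pdp s N M P)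

/-- Mean of `∂²g₀/∂ξ²` at the true parameters. -/
def meanCurvatureOFO : ℝ :=
  ∫ ω, iteratedDeriv 2 (fun e => g0 x dt fd xi M P ω.1 fd e) xi ∂(law pdp s N M P)

/-- Noise-induced MSE of the maximum-DFO estimate. -/
def mseNoiseDFO : ℝ :=
  noiseSlopeDFO pdp x dt fd xi s M P / meanCurvatureDFO pdp x dt fd xi s M P ^ 2

/-- Noise-induced MSE of the OFO estimate. -/
def mseNoiseOFO : ℝ :=
  noiseSlopeOFO pdp x dt fd xi s M P / meanCurvatureOFO pdp x dt fd xi s M P ^ 2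

/-- Interference-induced MSE floor of the maximum-DFO estimate. -/
def mseFloorDFO : ℝ :=
  meanSlopeDFO pdp x dt fd xi s M P ^ 2 / meanCurvatureDFO pdp x dt fd xi s M P ^ 2

/-- Interference-induced MSE floor of the OFO estimate. -/
def mseFloorOFO : ℝ :=
  meanSlopeOFO pdp x dt fd xi s M P ^ 2 / meanCurvatureOFO pdp x dt fd xi s M P ^ 2

end Quantities

/-- The pilot `x` carries information on the frequency offsets: for some tap `l` of positive power the
first-order change `D b_l` of the `l`-th column of `B` under a frequency offset leaves the column span
of `B`. -/
def Informative {L N : ℕ} (pdp : Fin L → ℝ≥0) (x : Fin N → ℂ) : Prop :=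
  ∃ l : Fin L, 0 < pdp l ∧
    WithLp.toLp 2 (rotationGenerator N *ᵥ fun n => pilotMatrix L x n l) ∉ pilotSpan L x

end JointCFO

end

namespace JointCFO

/-! The gains are centred and uncorrelated, so the mean of `g₀` keeps only diagonal terms. It is an
average over taps and subpaths of sums over beams of `|κ|² ‖P E(t) b_l‖²`. Here `κ` is the response
of a beam with direction cosine `γ` to a plane wave with cosine `c`, `P` projects off the pilot
span, and the residual offset `t` equals `f_d (c - γ)` at the true parameters. A parameter moves the
trial offset of a beam at a rate `A γ`, with `A γ = γ` for the DFO and `A γ = 1` for the OFO; both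
cases are treated at once as lines of trial offsets.

Since `P b_l = 0`, half the slope of `t ↦ ‖P E(t) b_l‖²` is `O(t)` and half its curvature is `‖P D
b_l‖² + O(t)`. In the noise part the derivative produces the commutator of `D` and `P`, because `D`
is skew-adjoint. At `b_l` this commutator has norm `‖P D b_l‖`, and the beam weights are orthogonal,
so the same information governs noise and curvature (`integral_sq_deriv_gn`).

The beams focus. Their responses satisfy a Parseval identity (`sum_norm_kernel_sq`), and `|κ| |c -
γ| = O(1/M)` because spacing below half a wavelength excludes grating lobes (`norm_kernel_mul_le`).
Hence `∑ |κ|² |c - γ| = o(M^(-1/2))`, and the energy in invisible beams is negligible on average.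
The curvature is then asymptotically `2 κ₀ I` and the noise second moment `2 σ² κ₀ I / M`, with `I`
the pilot information and `κ₀` the mean of `A²` over the subpaths: `1/2` for the DFO and `1` for the
OFO. The noise MSE is asymptotically `σ² / (2 κ₀ M I)`, whence the ratio 2. The mean slope is
`o(M^(-1/2))` relative to the curvature, so `M` times the floor vanishes.

For random pilots, quadratic forms in the symbols concentrate at their traces. The columns `b_l`
become orthogonal with energy `N` and uncorrelated with `(D - jπ) b_l`, whose energy is
asymptotically `N π²/3`; since `P D b_l = P (D - jπ) b_l`, this gives `I / N → π²/3`. Convergence in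
probability is encoded as convergence along a filter, so one deterministic argument (`Regime`)
serves both halves of the theorem. -/

/-! ### Second-moment calculus for white circular families -/

lemma integral_pi_eval {κ : Type*} [Fintype κ] {Ω : κ → Type*} [∀ k, MeasurableSpace (Ω k)]
    {μ : ∀ k, Measure (Ω k)} [∀ k, IsProbabilityMeasure (μ k)] {k : κ} (f : Ω k → ℂ)
    (hf : AEStronglyMeasurable f (μ k)) : ∫ ω, f (ω k) ∂Measure.pi μ = ∫ z, f z ∂μ k := by
  have hp := measurePreserving_eval μ k
  have := integral_map (μ := Measure.pi μ) hp.measurable.aemeasurable (f := f)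
    (by rw [hp.map_eq]; exact hf)
  rw [hp.map_eq] at this
  exact this.symm

lemma integral_pi_eval_mul_eval {κ : Type*} [Fintype κ] {Ω : κ → Type*}
    [∀ k, MeasurableSpace (Ω k)] {μ : ∀ k, Measure (Ω k)} [∀ k, IsProbabilityMeasure (μ k)]
    {k l : κ} (f : Ω k → ℂ) (g : Ω l → ℂ) (hkl : k ≠ l) (hf : AEStronglyMeasurable f (μ k))
    (hg : AEStronglyMeasurable g (μ l)) :
    ∫ ω, f (ω k) * g (ω l) ∂Measure.pi μ = (∫ z, f z ∂μ k) * ∫ z, g z ∂μ l := by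
  have hi : iIndepFun (fun k (ω : ∀ k, Ω k) => ω k) (Measure.pi μ) :=
    iIndepFun_pi (X := fun k ω => ω) fun k => aemeasurable_id
  have hpk := measurePreserving_eval μ k
  have hpl := measurePreserving_eval μ l
  have hkl' : IndepFun (fun ω : ∀ k, Ω k => f (ω k)) (fun ω => g (ω l)) (Measure.pi μ) :=
    (hi.indepFun hkl).comp₀ (φ := f) (ψ := g) hpk.measurable.aemeasurable
      hpl.measurable.aemeasurable
      (by erw [hpk.map_eq]; exact hf.aemeasurable) (by erw [hpl.map_eq]; exact hg.aemeasurable)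
  rw [hkl'.integral_fun_mul_eq_mul_integral (hf.comp_measurePreserving hpk)
    (hg.comp_measurePreserving hpl), integral_pi_eval f hf, integral_pi_eval g hg]

/-- A finite family of centred square integrable complex random variables that are uncorrelated and
circular to second order; `v i` is the power of the `i`-th member. -/
structure IsWhite {Ω ι : Type*} [MeasurableSpace Ω] [DecidableEq ι] (μ : Measure Ω)
    (X : ι → Ω → ℂ) (v : ι → ℝ) : Prop where
  memLp : ∀ i, MemLp (X i) 2 μ
  mean : ∀ i, ∫ ω, X i ω ∂μ = 0
  cov : ∀ i j, ∫ ω, star (X i ω) * X j ω ∂μ = if i = j then (v i : ℂ) else 0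
  pcov : ∀ i j, ∫ ω, X i ω * X j ω ∂μ = 0

namespace IsWhite

variable {Ω Ω' ι ι' : Type*} [MeasurableSpace Ω] [MeasurableSpace Ω'] [DecidableEq ι]
  [DecidableEq ι'] {μ : Measure Ω} {ν : Measure Ω'} {X : ι → Ω → ℂ} {v : ι → ℝ}
  {Y : ι' → Ω' → ℂ} {w : ι' → ℝ}

lemma memLp_star (h : IsWhite μ X v) (i : ι) : MemLp (fun ω => star (X i ω)) 2 μ := (h.memLp i).star

lemma integrable_star_mul (h : IsWhite μ X v) (i j : ι) :
    Integrable (fun ω => star (X i ω) * X j ω) μ :=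
  (h.memLp_star i).integrable_mul (h.memLp j)

lemma integrable_mul (h : IsWhite μ X v) (i j : ι) :
    Integrable (fun ω => X i ω * X j ω) μ :=
  (h.memLp i).integrable_mul (h.memLp j)

lemma reindex (h : IsWhite μ X v) {e : ι' → ι} (he : Function.Injective e) :
    IsWhite μ (fun i => X (e i)) (fun i => v (e i)) where
  memLp i := h.memLp _
  mean i := h.mean _
  cov i j := by rw [h.cov]; simp [he.eq_iff]
  pcov i j := h.pcov _ _

/-- The cross term of signal and noise is linear in these products, so their whiteness reduces its
second moment to `integral_sq_re`. -/
lemma star_mul_prod [SFinite μ] [SFinite ν] (h : IsWhite μ X v) (h' : IsWhite ν Y w) :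
    IsWhite (μ.prod ν) (fun (k : ι × ι') ω => star (X k.1 ω.1) * Y k.2 ω.2)
      (fun k => v k.1 * w k.2) where
  memLp k := by
    have h1 := (memLp_two_iff_integrable_sq_norm (h.memLp_star k.1).1).1 (h.memLp_star k.1)
    have h2 := (memLp_two_iff_integrable_sq_norm (h'.memLp k.2).1).1 (h'.memLp k.2)
    refine (memLp_two_iff_integrable_sq_norm ?_).2 ?_
    · exact (h.memLp_star k.1).1.comp_fst.mul (h'.memLp k.2).1.comp_snd
    · simpa [mul_pow] using h1.mul_prod h2
  mean k := by
    rw [integral_prod_mul (fun a => star (X k.1 a)) (Y k.2), h'.mean, mul_zero]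
  cov k l := by
    have : ∀ ω : Ω × Ω', star (star (X k.1 ω.1) * Y k.2 ω.2) * (star (X l.1 ω.1) * Y l.2 ω.2) =
        star (X l.1 ω.1) * X k.1 ω.1 * (star (Y k.2 ω.2) * Y l.2 ω.2) := by
      intro ω; simp only [star_mul', star_star]; ring
    simp_rw [this]
    rw [integral_prod_mul (fun a => star (X l.1 a) * X k.1 a) (fun b => star (Y k.2 b) * Y l.2 b),
      h.cov, h'.cov]
    by_cases h1 : k.1 = l.1 <;> by_cases h2 : k.2 = l.2 <;>
      simp [h1, h2, Prod.ext_iff, eq_comm]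
  pcov k l := by
    have : ∀ ω : Ω × Ω', (star (X k.1 ω.1) * Y k.2 ω.2) * (star (X l.1 ω.1) * Y l.2 ω.2) =
        (star (X k.1 ω.1) * star (X l.1 ω.1)) * (Y k.2 ω.2 * Y l.2 ω.2) := by
      intro ω; ring
    simp_rw [this]
    rw [integral_prod_mul (fun a => star (X k.1 a) * star (X l.1 a))
      (fun b => Y k.2 b * Y l.2 b), h'.pcov, mul_zero]

lemma pi {κ : Type*} [Fintype κ] [DecidableEq κ] {Ω : κ → Type*} [∀ k, MeasurableSpace (Ω k)]
    {μ : ∀ k, Measure (Ω k)} [∀ k, IsProbabilityMeasure (μ k)] {X : ∀ k, ι → Ω k → ℂ}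
    {v : κ → ι → ℝ} (h : ∀ k, IsWhite (μ k) (X k) (v k)) :
    IsWhite (Measure.pi μ) (fun (a : κ × ι) ω => X a.1 a.2 (ω a.1)) (fun a => v a.1 a.2) := by
  have single := @integral_pi_eval κ _ Ω _ μ _
  have pair := @integral_pi_eval_mul_eval κ _ Ω _ μ _
  refine ⟨fun a => ?_, fun a => ?_, fun a b => ?_, fun a b => ?_⟩
  · exact ((h a.1).memLp a.2).comp_measurePreserving (measurePreserving_eval μ a.1)
  · rw [single (X a.1 a.2) ((h a.1).memLp a.2).1, (h a.1).mean]
  · obtain ⟨k, i⟩ := a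
    obtain ⟨l, j⟩ := b
    by_cases hkl : k = l
    · subst hkl
      rw [single (fun z => star (X k i z) * X k j z) ((h k).integrable_star_mul i j).1,
        (h k).cov]
      simp
    · rw [pair (fun z => star (X k i z)) (X l j) hkl ((h k).memLp_star i).1
        ((h l).memLp j).1, (h l).mean, mul_zero, if_neg (by simp [hkl])]
  · obtain ⟨k, i⟩ := a
    obtain ⟨l, j⟩ := b
    by_cases hkl : k = l
    · subst hkl
      rw [single (fun z => X k i z * X k j z) ((h k).integrable_mul i j).1, (h k).pcov]
    · rw [pair (X k i) (X l j) hkl ((h k).memLp i).1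
        ((h l).memLp j).1, (h l).mean, mul_zero]

variable [Fintype ι]

lemma integral_quadratic (h : IsWhite μ X v) (c : ι → ι → ℂ) :
    ∫ ω, (∑ i, ∑ j, star (X i ω) * X j ω * c i j).re ∂μ = ∑ i, v i * (c i i).re := by
  have hint : ∀ i j, Integrable (fun ω => star (X i ω) * X j ω * c i j) μ :=
    fun i j => (h.integrable_star_mul i j).mul_const _
  have h1 := integral_re (𝕜 := ℂ) (f := fun ω => ∑ i, ∑ j, star (X i ω) * X j ω * c i j) (μ := μ)
    (integrable_finsetSum _ fun i _ => integrable_finsetSum _ fun j _ => hint i j)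
  simp only [RCLike.re_eq_complex_re] at h1
  rw [h1, integral_finsetSum _ fun i _ => integrable_finsetSum _ fun j _ => hint i j]
  simp_rw [integral_finsetSum _ fun j _ => hint _ j, integral_mul_const, h.cov]
  simp

/-- From `(Re z)² = (|z|² + Re z²) / 2`: circularity makes the mean of `z²` vanish, which leaves the
factor 1/2. -/
lemma integral_sq_re (h : IsWhite μ X v) (c : ι → ℂ) :
    ∫ ω, ((∑ i, X i ω * c i).re) ^ 2 ∂μ = 1 / 2 * ∑ i, v i * ‖c i‖ ^ 2 := by
  have key : ∀ ω, ((∑ i, X i ω * c i).re) ^ 2 =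
      1 / 2 * ((∑ i, ∑ j, star (X i ω) * X j ω * (star (c i) * c j)).re +
        (∑ i, ∑ j, X i ω * X j ω * (c i * c j)).re) := by
    intro ω
    have e1 : ∑ i, ∑ j, star (X i ω) * X j ω * (star (c i) * c j) =
        star (∑ i, X i ω * c i) * ∑ i, X i ω * c i := by
      rw [star_sum, Finset.sum_mul_sum]
      refine Finset.sum_congr rfl fun i _ => Finset.sum_congr rfl fun j _ => ?_
      rw [star_mul']; ring
    have e2 : ∑ i, ∑ j, X i ω * X j ω * (c i * c j) =
        (∑ i, X i ω * c i) * ∑ i, X i ω * c i := by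
      rw [Finset.sum_mul_sum]
      refine Finset.sum_congr rfl fun i _ => Finset.sum_congr rfl fun j _ => ?_
      ring
    rw [e1, e2]
    simp only [Complex.mul_re, Complex.star_def, Complex.conj_re, Complex.conj_im]
    ring
  have hint1 : ∀ i j, Integrable (fun ω => star (X i ω) * X j ω * (star (c i) * c j)) μ :=
    fun i j => (h.integrable_star_mul i j).mul_const _
  have hint2 : ∀ i j, Integrable (fun ω => X i ω * X j ω * (c i * c j)) μ :=
    fun i j => (h.integrable_mul i j).mul_const _
  have hi1 := integrable_finsetSum Finset.univ fun i _ =>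
    integrable_finsetSum Finset.univ fun j _ => hint1 i j
  have hi2 := integrable_finsetSum Finset.univ fun i _ =>
    integrable_finsetSum Finset.univ fun j _ => hint2 i j
  simp_rw [key]
  have hr1 : Integrable (fun ω => (∑ i, ∑ j, star (X i ω) * X j ω * (star (c i) * c j)).re) μ :=
    hi1.re
  have hr2 : Integrable (fun ω => (∑ i, ∑ j, X i ω * X j ω * (c i * c j)).re) μ := hi2.re
  rw [integral_const_mul, integral_add hr1 hr2, h.integral_quadratic]
  have h2 := integral_re (𝕜 := ℂ) hi2
  simp only [RCLike.re_eq_complex_re] at h2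
  rw [h2, integral_finsetSum _ fun i _ => integrable_finsetSum _ fun j _ => hint2 i j]
  simp_rw [integral_finsetSum _ fun j _ => hint2 _ j, integral_mul_const, h.pcov]
  simp [← Complex.normSq_eq_norm_sq, Complex.normSq_apply]

end IsWhite

/-! ### Complex normal variables are white -/

instance (v : ℝ≥0) : IsProbabilityMeasure (complexNormal v) :=
  Measure.isProbabilityMeasure_map (by
    have : (fun u : ℝ × ℝ => (⟨u.1, u.2⟩ : ℂ)) = Complex.measurableEquivRealProd.symm := rfl
    rw [this]; exact (MeasurableEquiv.measurable _).aemeasurable)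

lemma isWhite_complexNormal (v : ℝ≥0) :
    IsWhite (complexNormal v) (fun (_ : Unit) z => z) (fun _ => (v : ℝ)) := by
  set γ := gaussianReal 0 (v / 2) with hγ
  have hmeas : Measurable fun u : ℝ × ℝ => (⟨u.1, u.2⟩ : ℂ) :=
    Complex.measurableEquivRealProd.symm.measurable
  have hmp : MeasurePreserving (fun u : ℝ × ℝ => (⟨u.1, u.2⟩ : ℂ)) (γ.prod γ) (complexNormal v) :=
    ⟨hmeas, rfl⟩
  have hme : MeasurableEmbedding fun u : ℝ × ℝ => (⟨u.1, u.2⟩ : ℂ) :=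
    Complex.measurableEquivRealProd.symm.measurableEmbedding
  have hL : MemLp (fun t : ℝ => t) 2 γ := memLp_id_gaussianReal 2
  have h1 : ∫ t, t ∂γ = 0 := integral_id_gaussianReal
  have h2 : ∫ t, t * t ∂γ = (v : ℝ) / 2 := by
    have := variance_eq_sub (μ := γ) (X := id) hL
    rw [hγ, variance_id_gaussianReal, ← hγ] at this
    simp only [id_eq, h1, Pi.pow_apply] at this
    simp only [← sq]
    rw [NNReal.coe_div] at this
    simpa using this.symm
  have hLc : MemLp (fun t : ℝ => (t : ℂ)) 2 γ := hL.ofReal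
  have c1 : ∫ t, (t : ℂ) ∂γ = 0 := by rw [integral_complex_ofReal, h1]; simp
  have c2 : ∫ t, (t : ℂ) * (t : ℂ) ∂γ = ((v : ℝ) : ℂ) / 2 := by
    simp_rw [← Complex.ofReal_mul]
    rw [integral_complex_ofReal, h2]; simp
  have i1 : Integrable (fun t : ℝ => (t : ℂ)) γ := hLc.integrable (by norm_num)
  have i2 : Integrable (fun t : ℝ => (t : ℂ) * (t : ℂ)) γ := hLc.integrable_mul hLc
  have iA : Integrable (fun u : ℝ × ℝ => (u.1 : ℂ) * u.1) (γ.prod γ) := i2.comp_fst γ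
  have iB : Integrable (fun u : ℝ × ℝ => (u.2 : ℂ) * u.2) (γ.prod γ) := i2.comp_snd γ
  have iC : Integrable (fun u : ℝ × ℝ => (u.1 : ℂ) * u.2) (γ.prod γ) := i1.mul_prod i1
  have eA : ∫ u : ℝ × ℝ, (u.1 : ℂ) * u.1 ∂γ.prod γ = ((v : ℝ) : ℂ) / 2 := by
    rw [integral_fun_fst (fun t : ℝ => (t : ℂ) * t), c2]; simp
  have eB : ∫ u : ℝ × ℝ, (u.2 : ℂ) * u.2 ∂γ.prod γ = ((v : ℝ) : ℂ) / 2 := by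
    rw [integral_fun_snd (fun t : ℝ => (t : ℂ) * t), c2]; simp
  have eC : ∫ u : ℝ × ℝ, (u.1 : ℂ) * u.2 ∂γ.prod γ = 0 := by
    rw [integral_prod_mul (fun t : ℝ => (t : ℂ)) (fun t : ℝ => (t : ℂ)), c1, zero_mul]
  have hz : ∀ u : ℝ × ℝ, (⟨u.1, u.2⟩ : ℂ) = (u.1 : ℂ) + u.2 * Complex.I := fun u =>
    (Complex.mk_eq_add_mul_I _ _)
  refine ⟨fun _ => ?_, fun _ => ?_, fun _ _ => ?_, fun _ _ => ?_⟩
  · refine (hme.memLp_map_measure_iff (μ := γ.prod γ) (g := fun z : ℂ => z)).2 ?_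
    have : (fun z : ℂ => z) ∘ (fun u : ℝ × ℝ => (⟨u.1, u.2⟩ : ℂ)) =
      fun u => (u.1 : ℂ) + u.2 * Complex.I := by ext1 u; exact hz u
    rw [this]
    have j1 : MemLp (fun u : ℝ × ℝ => (u.1 : ℂ)) 2 (γ.prod γ) := hLc.comp_fst γ
    have j2 : MemLp (fun u : ℝ × ℝ => (u.2 : ℂ)) 2 (γ.prod γ) := hLc.comp_snd γ
    exact j1.add (j2.mul_const Complex.I)
  · rw [← hmp.integral_comp hme]
    simp_rw [hz]
    rw [integral_add (i1.comp_fst γ) ((i1.comp_snd γ).mul_const _), integral_mul_const,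
      integral_fun_fst (fun t : ℝ => (t : ℂ)), integral_fun_snd (fun t : ℝ => (t : ℂ)), c1]
    simp
  · rw [← hmp.integral_comp hme (fun z : ℂ => star z * z)]
    have : ∀ u : ℝ × ℝ, star (⟨u.1, u.2⟩ : ℂ) * ⟨u.1, u.2⟩ = (u.1 : ℂ) * u.1 + (u.2 : ℂ) * u.2 := by
      intro u
      rw [Complex.star_def, ← Complex.normSq_eq_conj_mul_self, Complex.normSq_mk]
      push_cast; rfl
    simp_rw [this]
    rw [integral_add iA iB, eA, eB]
    simp
  · rw [← hmp.integral_comp hme (fun z : ℂ => z * z)]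
    have : ∀ u : ℝ × ℝ, (⟨u.1, u.2⟩ : ℂ) * ⟨u.1, u.2⟩ =
        (u.1 : ℂ) * u.1 - (u.2 : ℂ) * u.2 + 2 * Complex.I * ((u.1 : ℂ) * u.2) := by
      intro u
      rw [hz]; ring_nf; rw [Complex.I_sq]; ring
    simp_rw [this]
    have iAB : Integrable (fun u : ℝ × ℝ => (u.1 : ℂ) * u.1 - (u.2 : ℂ) * u.2) (γ.prod γ) :=
      iA.sub iB
    rw [integral_add iAB (iC.const_mul _), integral_sub iA iB, integral_const_mul, eA, eB,
      eC]
    simp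

lemma isWhite_pi_pi {κ κ' : Type*} [Fintype κ] [DecidableEq κ] [Fintype κ'] [DecidableEq κ']
    (v : κ → κ' → ℝ≥0) :
    IsWhite (Measure.pi fun k => Measure.pi fun k' : κ' => complexNormal (v k k'))
      (fun (a : κ × κ') ω => ω a.1 a.2) (fun a => (v a.1 a.2 : ℝ)) := by
  have h := IsWhite.pi fun k => IsWhite.pi fun k' : κ' => isWhite_complexNormal (v k k')
  exact h.reindex (e := fun a : κ × κ' => (a.1, (a.2, ()))) fun a b hab => by
    simp only [Prod.mk.injEq, and_true] at hab
    exact Prod.ext hab.1 hab.2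

/-! ### Moments of derivatives of random forms -/

lemma hasDerivAt_re_sum {ι : Type*} (s : Finset ι) (z : ι → ℂ) {c : ι → ℝ → ℂ}
    {c' : ι → ℂ} {u : ℝ} (hc : ∀ i, HasDerivAt (c i) (c' i) u) :
    HasDerivAt (fun u => (∑ i ∈ s, z i * c i u).re) (∑ i ∈ s, z i * c' i).re u :=
  Complex.reCLM.hasFDerivAt.comp_hasDerivAt u
    (HasDerivAt.fun_sum fun i _ => (hc i).const_mul (z i))

lemma sum_norm_sq_sum_smul {ι E Q : Type*} [Fintype ι] [NormedAddCommGroup E]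
    [InnerProductSpace ℂ E] (s : Finset Q) (z : ι → ℂ) (a : Q → ι → E) :
    ∑ q ∈ s, ‖∑ i, z i • a q i‖ ^ 2 =
      (∑ i, ∑ j, star (z i) * z j * ∑ q ∈ s, inner ℂ (a q i) (a q j)).re := by
  have : ∀ q, ‖∑ i, z i • a q i‖ ^ 2 =
      (∑ i, ∑ j, star (z i) * z j * inner ℂ (a q i) (a q j)).re := by
    intro q
    rw [@norm_sq_eq_re_inner ℂ, sum_inner]
    simp_rw [inner_sum, inner_smul_left, inner_smul_right]
    simp only [RCLike.re_eq_complex_re, Complex.star_def, mul_assoc]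
  simp_rw [this, ← Complex.re_sum, Finset.mul_sum]
  rw [Finset.sum_comm]
  congr 1
  refine Finset.sum_congr rfl fun i _ => ?_
  rw [Finset.sum_comm]

namespace IsWhite

variable {Ω Ω' ι ι' : Type*} [MeasurableSpace Ω] [MeasurableSpace Ω'] [DecidableEq ι]
  [DecidableEq ι'] [Fintype ι] [Fintype ι'] {μ : Measure Ω} {ν : Measure Ω'} {X : ι → Ω → ℂ}
  {v : ι → ℝ} {Y : ι' → Ω' → ℂ} {w : ι' → ℝ}

/-- The constant 2 is the square of the prefactor 2 times the 1/2 of `integral_sq_re`. -/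
lemma integral_sq_deriv_bilinear [SFinite μ] [SFinite ν] (h : IsWhite μ X v) (h' : IsWhite ν Y w)
    {c : ι → ι' → ℝ → ℂ} {c' : ι → ι' → ℂ} {u₀ : ℝ}
    (hc : ∀ i k, HasDerivAt (c i k) (c' i k) u₀) :
    ∫ ω, (deriv (fun u => 2 * (∑ i, ∑ k, star (X i ω.1) * Y k ω.2 * c i k u).re) u₀) ^ 2
      ∂(μ.prod ν) = 2 * ∑ i, ∑ k, v i * w k * ‖c' i k‖ ^ 2 := by
  have hd : ∀ ω : Ω × Ω', (deriv (fun u =>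
      2 * (∑ i, ∑ k, star (X i ω.1) * Y k ω.2 * c i k u).re) u₀) ^ 2 =
      4 * ((∑ a : ι × ι', star (X a.1 ω.1) * Y a.2 ω.2 * c' a.1 a.2).re) ^ 2 := by
    intro ω
    have := (hasDerivAt_re_sum Finset.univ (fun a : ι × ι' => star (X a.1 ω.1) * Y a.2 ω.2)
      (c := fun a => c a.1 a.2) fun a => hc a.1 a.2).const_mul 2
    simp_rw [Fintype.sum_prod_type] at this
    rw [this.deriv, Fintype.sum_prod_type]; ring
  simp_rw [hd]
  rw [integral_const_mul, (h.star_mul_prod h').integral_sq_re fun a => c' a.1 a.2,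
    Fintype.sum_prod_type]
  ring

/-- For each outcome the form is a finite sum in which only the coefficients depend on `u`. The
derivative is therefore computed pointwise, and no interchange of limit and integral is needed. -/
lemma integral_deriv_quadratic (h : IsWhite μ X v) {c : ι → ι → ℝ → ℂ} {c' : ι → ι → ℂ} {u₀ : ℝ}
    (hc : ∀ i j, HasDerivAt (c i j) (c' i j) u₀) :
    ∫ ω, deriv (fun u => (∑ i, ∑ j, star (X i ω) * X j ω * c i j u).re) u₀ ∂μ =
      ∑ i, v i * (c' i i).re := by
  rw [← h.integral_quadratic]
  congr 1 with ω
  have := hasDerivAt_re_sum Finset.univ (fun a : ι × ι => star (X a.1 ω) * X a.2 ω)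
      (c := fun a => c a.1 a.2) fun a => hc a.1 a.2
  simp_rw [Fintype.sum_prod_type] at this
  exact this.deriv

lemma integral_deriv_deriv_quadratic (h : IsWhite μ X v) {c c' : ι → ι → ℝ → ℂ} {c'' : ι → ι → ℂ}
    {u₀ : ℝ} (hc : ∀ i j u, HasDerivAt (c i j) (c' i j u) u)
    (hc' : ∀ i j, HasDerivAt (c' i j) (c'' i j) u₀) :
    ∫ ω, iteratedDeriv 2 (fun u => (∑ i, ∑ j, star (X i ω) * X j ω * c i j u).re) u₀ ∂μ =
      ∑ i, v i * (c'' i i).re := by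
  rw [← h.integral_deriv_quadratic hc']
  congr 1 with ω
  rw [iteratedDeriv_succ, iteratedDeriv_one]
  congr 1 with u
  have := hasDerivAt_re_sum Finset.univ (fun a : ι × ι => star (X a.1 ω) * X a.2 ω)
      (c := fun a => c a.1 a.2) fun a => hc a.1 a.2 u
  simp_rw [Fintype.sum_prod_type] at this
  exact this.deriv

variable {E Q : Type*} [NormedAddCommGroup E] [InnerProductSpace ℂ E]

variable (h : IsWhite μ X v) (s : Finset Q) {a : Q → ι → ℝ → E}
include h

/-- The mean of the slope of a random energy is the slope of the mean energy. -/
lemma integral_deriv_energy (ha : ∀ q i, ContDiff ℝ 2 (a q i)) {u₀ m : ℝ}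
    (hm : HasDerivAt (fun u => ∑ i, v i * ∑ q ∈ s, ‖a q i u‖ ^ 2) m u₀) :
    ∫ ω, deriv (fun u => ∑ q ∈ s, ‖∑ i, X i ω • a q i u‖ ^ 2) u₀ ∂μ = m := by
  simp_rw [sum_norm_sq_sum_smul s]
  have hA : ∀ i j, ContDiff ℝ 2 fun u => ∑ q ∈ s, inner ℂ (a q i u) (a q j u) := fun i j =>
    ContDiff.sum fun q _ => (ha q i).inner ℂ (ha q j)
  have hd : ∀ i j u, HasDerivAt (fun u => ∑ q ∈ s, inner ℂ (a q i u) (a q j u))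
      (deriv (fun u => ∑ q ∈ s, inner ℂ (a q i u) (a q j u)) u) u := fun i j u =>
    ((hA i j).differentiable (by norm_num) u).hasDerivAt
  rw [h.integral_deriv_quadratic fun i j => hd i j u₀]
  -- Only the diagonal coefficients survive the expectation. Their real parts add up to the mean
  -- energy, so uniqueness of derivatives identifies the result with `m`.
  refine HasDerivAt.unique ?_ hm
  refine HasDerivAt.fun_sum fun i _ => HasDerivAt.const_mul _ ?_
  have := Complex.reCLM.hasFDerivAt.comp_hasDerivAt u₀ (hd i i u₀)
  refine this.congr_of_eventuallyEq (Eventually.of_forall fun u => ?_)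
  simp [@norm_sq_eq_re_inner ℂ]

lemma integral_deriv_deriv_energy (ha : ∀ q i, ContDiff ℝ 2 (a q i)) {u₀ k : ℝ} {m : ℝ → ℝ}
    (hm : ∀ u, HasDerivAt (fun u => ∑ i, v i * ∑ q ∈ s, ‖a q i u‖ ^ 2) (m u) u)
    (hk : HasDerivAt m k u₀) :
    ∫ ω, iteratedDeriv 2 (fun u => ∑ q ∈ s, ‖∑ i, X i ω • a q i u‖ ^ 2) u₀ ∂μ = k := by
  simp_rw [sum_norm_sq_sum_smul s]
  have hA : ∀ i j, ContDiff ℝ 2 fun u => ∑ q ∈ s, inner ℂ (a q i u) (a q j u) := fun i j =>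
    ContDiff.sum fun q _ => (ha q i).inner ℂ (ha q j)
  have hd : ∀ i j u, HasDerivAt (fun u => ∑ q ∈ s, inner ℂ (a q i u) (a q j u))
      (deriv (fun u => ∑ q ∈ s, inner ℂ (a q i u) (a q j u)) u) u := fun i j u =>
    ((hA i j).differentiable (by norm_num) u).hasDerivAt
  have hd' : ∀ i j u, HasDerivAt (deriv fun u => ∑ q ∈ s, inner ℂ (a q i u) (a q j u))
      (deriv (deriv fun u => ∑ q ∈ s, inner ℂ (a q i u) (a q j u)) u) u := fun i j u => by
    have h1 : ContDiff ℝ 1 (deriv fun u => ∑ q ∈ s, inner ℂ (a q i u) (a q j u)) :=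
      ((contDiff_succ_iff_deriv (n := 1)).1 (by exact_mod_cast hA i j)).2.2
    exact (h1.differentiable (by norm_num) u).hasDerivAt
  rw [h.integral_deriv_deriv_quadratic hd fun i j => hd' i j u₀]
  refine HasDerivAt.unique ?_ hk
  -- The mean slope has to be identified at every `u`, since it is differentiated once more.
  have hm' : m = fun u => ∑ i, v i *
      (deriv (fun u => ∑ q ∈ s, inner ℂ (a q i u) (a q i u)) u).re := by
    ext u
    refine (hm u).unique ?_
    refine HasDerivAt.fun_sum fun i _ => HasDerivAt.const_mul _ ?_
    have := Complex.reCLM.hasFDerivAt.comp_hasDerivAt u (hd i i u)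
    refine this.congr_of_eventuallyEq (Eventually.of_forall fun u => ?_)
    simp [@norm_sq_eq_re_inner ℂ]
  rw [hm']
  refine HasDerivAt.fun_sum fun i _ => HasDerivAt.const_mul _ ?_
  exact Complex.reCLM.hasFDerivAt.comp_hasDerivAt u₀ (hd' i i u₀)

end IsWhite

noncomputable section

/-! ### Frequency rotations as operators -/

/-- `E(φ)` as an operator on `ℂᴺ`. -/
def rot (N : ℕ) (t : ℝ) : EuclideanSpace ℂ (Fin N) →L[ℂ] EuclideanSpace ℂ (Fin N) :=
  Matrix.toEuclideanCLM (𝕜 := ℂ) (rotation N t)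

/-- `D` as an operator on `ℂᴺ`. -/
def gen (N : ℕ) : EuclideanSpace ℂ (Fin N) →L[ℂ] EuclideanSpace ℂ (Fin N) :=
  Matrix.toEuclideanCLM (𝕜 := ℂ) (rotationGenerator N)

variable {N : ℕ}

lemma rot_apply (t : ℝ) (v : EuclideanSpace ℂ (Fin N)) (n : Fin N) :
    rot N t v n =
      Complex.exp (Complex.I * ((2 * Real.pi * t * (n : ℝ) / (N : ℝ) : ℝ) : ℂ)) * v n := by
  simp only [rot, Matrix.ofLp_toEuclideanCLM, rotation, Matrix.mulVec_diagonal]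

lemma gen_apply (v : EuclideanSpace ℂ (Fin N)) (n : Fin N) :
    gen N v n = Complex.I * ((2 * Real.pi * (n : ℝ) / (N : ℝ) : ℝ) : ℂ) * v n := by
  simp only [gen, Matrix.ofLp_toEuclideanCLM, rotationGenerator, Matrix.mulVec_diagonal]

lemma rot_rot (s t : ℝ) (v : EuclideanSpace ℂ (Fin N)) : rot N s (rot N t v) = rot N (s + t) v := by
  ext n
  simp only [rot_apply]
  rw [← mul_assoc, ← Complex.exp_add]
  congr 2
  push_cast
  ring

lemma rot_gen (t : ℝ) (v : EuclideanSpace ℂ (Fin N)) : rot N t (gen N v) = gen N (rot N t v) := by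
  ext n
  simp only [rot_apply, gen_apply]
  ring

lemma norm_rot (t : ℝ) (v : EuclideanSpace ℂ (Fin N)) : ‖rot N t v‖ = ‖v‖ := by
  simp only [EuclideanSpace.norm_eq, rot_apply, norm_mul, Complex.norm_exp_I_mul_ofReal, one_mul]

lemma conjTranspose_rotation (t : ℝ) : (rotation N t)ᴴ = rotation N (-t) := by
  rw [rotation, rotation, Matrix.diagonal_conjTranspose]
  congr 1
  ext n
  simp only [Pi.star_apply, Complex.star_def, ← Complex.exp_conj, map_mul, Complex.conj_I,
    Complex.conj_ofReal]
  congr 1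
  push_cast
  ring

lemma inner_rot_left (t : ℝ) (v w : EuclideanSpace ℂ (Fin N)) :
    inner ℂ (rot N t v) w = inner ℂ v (rot N (-t) w) := by
  rw [← ContinuousLinearMap.adjoint_inner_right, ← ContinuousLinearMap.star_eq_adjoint, rot, rot,
    ← map_star, Matrix.star_eq_conjTranspose, conjTranspose_rotation]

lemma norm_le_mul_of_coord {c : ℝ} (hc : 0 ≤ c) {v w : EuclideanSpace ℂ (Fin N)}
    (h : ∀ n, ‖w n‖ ≤ c * ‖v n‖) : ‖w‖ ≤ c * ‖v‖ := by
  rw [EuclideanSpace.norm_eq, EuclideanSpace.norm_eq, ← Real.sqrt_sq hc,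
    ← Real.sqrt_mul (sq_nonneg c)]
  refine Real.sqrt_le_sqrt ?_
  rw [Finset.mul_sum]
  refine Finset.sum_le_sum fun n _ => ?_
  rw [← mul_pow]
  exact pow_le_pow_left₀ (norm_nonneg _) (h n) 2

lemma fin_div_le_one (n : Fin N) : (n : ℝ) / N ≤ 1 :=
  div_le_one_of_le₀ (by exact_mod_cast n.2.le) (Nat.cast_nonneg _)

/-- The factor `1/N` in `D` keeps the bound independent of the block length; this makes all later
Lipschitz constants uniform in `N`. -/
lemma norm_gen_le (v : EuclideanSpace ℂ (Fin N)) : ‖gen N v‖ ≤ 2 * Real.pi * ‖v‖ := by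
  refine norm_le_mul_of_coord Real.two_pi_pos.le fun n => ?_
  rw [gen_apply, norm_mul, norm_mul, Complex.norm_I, one_mul, Complex.norm_real, mul_div_assoc,
    Real.norm_of_nonneg (by positivity)]
  exact mul_le_mul_of_nonneg_right
    (mul_le_of_le_one_right Real.two_pi_pos.le (fin_div_le_one n)) (norm_nonneg _)

lemma norm_rot_sub_le (t : ℝ) (v : EuclideanSpace ℂ (Fin N)) :
    ‖rot N t v - v‖ ≤ 2 * Real.pi * |t| * ‖v‖ := by
  refine norm_le_mul_of_coord (by positivity) fun n => ?_
  rw [PiLp.sub_apply, rot_apply, ← sub_one_mul, norm_mul]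
  gcongr
  refine (Real.norm_exp_I_mul_ofReal_sub_one_le).trans ?_
  rw [mul_div_assoc, norm_mul, norm_mul, Real.norm_of_nonneg Real.two_pi_pos.le, Real.norm_eq_abs,
    Real.norm_of_nonneg (by positivity : (0 : ℝ) ≤ (n : ℝ) / N)]
  exact mul_le_of_le_one_right (by positivity) (fin_div_le_one n)

lemma hasDerivAt_rot (v : EuclideanSpace ℂ (Fin N)) (t : ℝ) :
    HasDerivAt (fun t => rot N t v) (gen N (rot N t v)) t := by
  have h : HasDerivAt (fun t => (rot N t v).ofLp) (gen N (rot N t v)).ofLp t := by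
    refine hasDerivAt_pi.2 fun n => ?_
    simp only [rot_apply, gen_apply]
    have h0 : HasDerivAt (fun t : ℝ => 2 * Real.pi * t * (n : ℝ) / (N : ℝ))
        (2 * Real.pi * (n : ℝ) / (N : ℝ)) t := by
      have := (((hasDerivAt_id t).const_mul (2 * Real.pi)).mul_const (n : ℝ)).div_const (N : ℝ)
      simpa using this
    have h1 := ((h0.ofReal_comp.const_mul Complex.I).cexp.mul_const (v n))
    refine h1.congr_deriv ?_
    ring
  exact (PiLp.continuousLinearEquiv 2 ℝ fun _ : Fin N =>
    ℂ).symm.toContinuousLinearMap.hasFDerivAt.comp_hasDerivAt t h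

/-- The derivative is a curve of the same type, with `v` replaced by `D v`, so regularity
bootstraps. -/
lemma contDiff_rot (v : EuclideanSpace ℂ (Fin N)) : ContDiff ℝ 2 fun t => rot N t v := by
  have hd : ∀ v : EuclideanSpace ℂ (Fin N), deriv (fun t => rot N t v) =
      fun t => rot N t (gen N v) :=
    fun v => by ext1 t; rw [(hasDerivAt_rot v t).deriv, rot_gen]
  have hdiff : ∀ v : EuclideanSpace ℂ (Fin N), Differentiable ℝ fun t => rot N t v :=
    fun v t => (hasDerivAt_rot v t).differentiableAt
  have h1 : ∀ v : EuclideanSpace ℂ (Fin N), ContDiff ℝ 1 fun t => rot N t v := fun v => by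
    refine contDiff_one_iff_deriv.2 ⟨hdiff v, ?_⟩
    rw [hd]; exact (hdiff _).continuous
  have : ContDiff ℝ (1 + 1) fun t => rot N t v := by
    refine contDiff_succ_iff_deriv.2 ⟨hdiff v, by simp, ?_⟩
    rw [hd]; exact h1 _
  simpa [one_add_one_eq_two] using this

/-! ### The projection onto the orthogonal complement of the pilot span -/

variable {L : ℕ} (x : Fin N → ℂ)

/-- The `l`-th column of `B`. -/
def col (L : ℕ) (x : Fin N → ℂ) (l : Fin L) : EuclideanSpace ℂ (Fin N) :=
  WithLp.toLp 2 fun n => pilotMatrix L x n l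

/-- The orthogonal projection onto the complement of the column space of `B`. -/
def perp (L : ℕ) (x : Fin N → ℂ) : EuclideanSpace ℂ (Fin N) →L[ℂ] EuclideanSpace ℂ (Fin N) :=
  (pilotSpan L x)ᗮ.starProjection

lemma col_mem_pilotSpan (l : Fin L) : col L x l ∈ pilotSpan L x :=
  Submodule.subset_span ⟨l, rfl⟩

lemma perp_eq_zero {v : EuclideanSpace ℂ (Fin N)} : perp L x v = 0 ↔ v ∈ pilotSpan L x := by
  rw [perp, Submodule.starProjection_apply_eq_zero_iff, Submodule.orthogonal_orthogonal]

lemma perp_col (l : Fin L) : perp L x (col L x l) = 0 := (perp_eq_zero x).2 (col_mem_pilotSpan x l)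

lemma norm_perp_le (v : EuclideanSpace ℂ (Fin N)) : ‖perp L x v‖ ≤ ‖v‖ :=
  Submodule.norm_starProjection_apply_le _ _

lemma inner_perp_left (v w : EuclideanSpace ℂ (Fin N)) :
    inner ℂ (perp L x v) w = inner ℂ v (perp L x w) :=
  Submodule.inner_starProjection_left_eq_right _ _ _

lemma perp_perp (v : EuclideanSpace ℂ (Fin N)) : perp L x (perp L x v) = perp L x v := by
  have h := Submodule.isIdempotentElem_starProjection (pilotSpan L x)ᗮ
  exact DFunLike.congr_fun h v

lemma hasDerivAt_perp {f : ℝ → EuclideanSpace ℂ (Fin N)} {f' : EuclideanSpace ℂ (Fin N)} {t : ℝ}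
    (h : HasDerivAt f f' t) : HasDerivAt (fun t => perp L x (f t)) (perp L x f') t :=
  ((perp L x).restrictScalars ℝ).hasFDerivAt.comp_hasDerivAt t h

lemma contDiff_perp {f : ℝ → EuclideanSpace ℂ (Fin N)} (h : ContDiff ℝ 2 f) :
    ContDiff ℝ 2 fun t => perp L x (f t) :=
  ((perp L x).restrictScalars ℝ).contDiff.comp h

/-! ### Branch residuals -/

/-- Response of the `r`-th beam to a plane wave with direction cosine `c`. -/
def kernel (M : ℕ) (dt c : ℝ) (r : Fin M) : ℂ :=
  1 / (M : ℂ) * ∑ m : Fin M,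
    Complex.exp (Complex.I * ((2 * Real.pi * dt * (m : ℝ) * (c - gridCos M dt r) : ℝ) : ℂ))

/-- Weight of the `m`-th antenna in the `r`-th beam. -/
def beamWeight (M : ℕ) (dt : ℝ) (r m : Fin M) : ℂ :=
  star (1 / (M : ℂ) *
    Complex.exp (Complex.I * ((2 * Real.pi * dt * (m : ℝ) * gridCos M dt r : ℝ) : ℂ)))

variable {M P : ℕ} {dt : ℝ}

/-- Outside the visible region `arccos` truncates. `kernel` and `beamWeight` therefore use `gridCos`
directly: they make sense for all `M` beams, as the Parseval identity requires, and agree with the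
model on the visible ones. -/
lemma cos_beamAngle {r : Fin M} (hr : r ∈ beams M dt) :
    Real.cos (beamAngle M dt r) = gridCos M dt r := by
  have := (Finset.mem_filter.1 hr).2
  rw [beamAngle, Real.cos_arccos (abs_le.1 this).1 (abs_le.1 this).2]

lemma beamWeight_eq {r : Fin M} (hr : r ∈ beams M dt) (m : Fin M) :
    star (1 / (M : ℂ) * steering M dt (beamAngle M dt r) m) = beamWeight M dt r m := by
  rw [steering, cos_beamAngle hr, beamWeight]

lemma steering_dotProduct_beamWeight (θ : ℝ) (r : Fin M) :
    steering M dt θ ⬝ᵥ beamWeight M dt r = kernel M dt (Real.cos θ) r := by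
  rw [kernel, Finset.mul_sum, dotProduct]
  refine Finset.sum_congr rfl fun m _ => ?_
  rw [steering, beamWeight, star_mul', Complex.star_def, ← Complex.exp_conj,
    mul_left_comm, ← Complex.exp_add]
  congr 1
  · simp
  · congr 1
    simp only [map_mul, Complex.conj_I, Complex.conj_ofReal]
    push_cast
    ring

lemma branchResidual_eq {r : Fin M} (hr : r ∈ beams M dt) (Y : Matrix (Fin N) (Fin M) ℂ) (f e : ℝ) :
    branchResidual L x dt Y f e r = perp L x (rot N (-(f * gridCos M dt r + e))
      (WithLp.toLp 2 (Y *ᵥ beamWeight M dt r))) := by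
  rw [branchResidual, beamOutput, perp, rot, conjTranspose_rotation, Matrix.toEuclideanCLM_toLp,
    cos_beamAngle hr]
  simp_rw [beamWeight_eq hr]

/-- The residual is linear in the gains, and the rotations form a one-parameter group, so the true
and the trial offset enter only through their difference. -/
lemma branchResidual_noiselessSignal {r : Fin M} (hr : r ∈ beams M dt) (fd xi f e : ℝ)
    (g : Fin L → Fin P → ℂ) :
    branchResidual L x dt (noiselessSignal x dt fd xi M P g) f e r =
      ∑ a : Fin L × Fin P, g a.1 a.2 • (kernel M dt (Real.cos (aoa P a.2)) r •
        perp L x (rot N (fd * Real.cos (aoa P a.2) + xi - (f * gridCos M dt r + e))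
          (col L x a.1))) := by
  rw [branchResidual_eq x hr, noiselessSignal, Matrix.sum_mulVec]
  have h : WithLp.toLp 2 (∑ p : Fin P, Matrix.vecMulVec
        (rotation N (fd * Real.cos (aoa P p) + xi) *ᵥ (pilotMatrix L x *ᵥ fun l => g l p))
        (steering M dt (aoa P p)) *ᵥ beamWeight M dt r) =
      ∑ p : Fin P, ∑ l : Fin L, g l p • (kernel M dt (Real.cos (aoa P p)) r •
        rot N (fd * Real.cos (aoa P p) + xi) (col L x l)) := by
    rw [WithLp.toLp_sum]
    refine Finset.sum_congr rfl fun p _ => ?_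
    rw [Matrix.vecMulVec_mulVec, steering_dotProduct_beamWeight]
    have : pilotMatrix L x *ᵥ (fun l => g l p) = (∑ l, g l p • col L x l).ofLp := by
      ext n
      simp [Matrix.mulVec, dotProduct, col, mul_comm]
    rw [this]
    have h2 : WithLp.toLp 2 (rotation N (fd * Real.cos (aoa P p) + xi) *ᵥ
        (∑ l, g l p • col L x l).ofLp) = rot N (fd * Real.cos (aoa P p) + xi)
          (∑ l, g l p • col L x l) := by
      rw [rot, ← Matrix.toEuclideanCLM_toLp]
    have h3 : ∀ v : Fin N → ℂ,
        WithLp.toLp 2 (MulOpposite.op (kernel M dt (Real.cos (aoa P p)) r) • v) =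
        kernel M dt (Real.cos (aoa P p)) r • (WithLp.toLp 2 v : EuclideanSpace ℂ (Fin N)) := by
      intro v
      ext n
      simp [mul_comm]
    rw [h3, h2, map_sum, Finset.smul_sum]
    refine Finset.sum_congr rfl fun l _ => ?_
    rw [map_smul, smul_comm]
  rw [h, map_sum, map_sum, Fintype.sum_prod_type_right]
  refine Finset.sum_congr rfl fun p _ => ?_
  rw [map_sum, map_sum]
  refine Finset.sum_congr rfl fun l _ => ?_
  simp only [map_smul, rot_rot]
  congr 5
  ring

lemma branchResidual_of {r : Fin M} (hr : r ∈ beams M dt) (f e : ℝ) (w : Fin N → Fin M → ℂ) :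
    branchResidual L x dt (Matrix.of w) f e r =
      ∑ a : Fin N × Fin M, w a.1 a.2 • (beamWeight M dt r a.2 •
        perp L x (rot N (-(f * gridCos M dt r + e)) (EuclideanSpace.single a.1 1))) := by
  have h : WithLp.toLp 2 (Matrix.of w *ᵥ beamWeight M dt r) = ∑ a : Fin N × Fin M,
      w a.1 a.2 • (beamWeight M dt r a.2 •
        (EuclideanSpace.single a.1 1 : EuclideanSpace ℂ (Fin N))) := by
    ext n
    rw [WithLp.ofLp_sum, Finset.sum_apply, Fintype.sum_prod_type]
    simp [Matrix.mulVec, dotProduct]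
  rw [branchResidual_eq x hr, h, map_sum, map_sum]
  simp only [map_smul]

end

/-! ### Exponential sums and orthogonality -/

lemma sum_exp_eq (N : ℕ) (k : ℤ) :
    ∑ m : Fin N, Complex.exp (Complex.I * ((2 * Real.pi * ((m : ℝ) * k / N) : ℝ) : ℂ)) =
      if (N : ℤ) ∣ k then (N : ℂ) else 0 := by
  rcases Nat.eq_zero_or_pos N with rfl | hN
  · simp
  have hN' : (N : ℂ) ≠ 0 := by exact_mod_cast hN.ne'
  set ζ : ℂ := Complex.exp (k / N * (2 * Real.pi * Complex.I)) with hζ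
  have h1 : ∀ m : Fin N, Complex.exp (Complex.I * ((2 * Real.pi * ((m : ℝ) * k / N) : ℝ) : ℂ)) =
      ζ ^ (m : ℕ) := by
    intro m
    rw [hζ, ← Complex.exp_nat_mul]
    congr 1
    push_cast
    ring
  simp_rw [h1]
  rw [Fin.sum_univ_eq_sum_range fun m => ζ ^ m]
  have hζN : ζ ^ N = 1 := by
    rw [hζ, ← Complex.exp_nat_mul, Complex.exp_eq_one_iff]
    exact ⟨k, by field_simp⟩
  by_cases hk : (N : ℤ) ∣ k
  · obtain ⟨j, rfl⟩ := hk
    have : ζ = 1 := by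
      rw [hζ, Complex.exp_eq_one_iff]
      exact ⟨j, by push_cast; field_simp⟩
    rw [this]; simp
  · rw [if_neg hk]
    have hne : ζ ≠ 1 := by
      rw [hζ, Ne, Complex.exp_eq_one_iff]
      rintro ⟨j, hj⟩
      have h2 : (2 * Real.pi * Complex.I : ℂ) ≠ 0 := Complex.two_pi_I_ne_zero
      have h3 : (k : ℂ) / N = j := mul_right_cancel₀ h2 hj
      rw [div_eq_iff hN'] at h3
      exact hk ⟨j, by have : (k : ℂ) = ((N * j : ℤ) : ℂ) := by rw [h3]; push_cast; ring
                      exact_mod_cast this⟩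
    have := mul_geom_sum ζ N
    rw [hζN, sub_self] at this
    exact (mul_eq_zero.1 this).resolve_left (sub_ne_zero.2 hne)

lemma fin_dvd_sub_iff {N : ℕ} (i j : Fin N) : (N : ℤ) ∣ ((i : ℤ) - j) ↔ i = j := by
  constructor
  · intro h
    have hi := i.2
    have hj := j.2
    have := Int.eq_zero_of_abs_lt_dvd h (by rw [abs_lt]; constructor <;> omega)
    ext; omega
  · rintro rfl; simp

/-- A matrix with `Uᴴ U = c` scales energies by `c`. The subset `s` allows for coefficient vectors
supported on the visible beams only. -/
lemma sum_norm_sq_of_orthogonal {ι κ : Type*} [Fintype κ] [DecidableEq ι] (s : Finset ι)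
    (U : κ → ι → ℂ) (c : ℝ)
    (hU : ∀ i j, ∑ k, star (U k i) * U k j = if i = j then (c : ℂ) else 0) (z : ι → ℂ) :
    ∑ k, ‖∑ i ∈ s, U k i * z i‖ ^ 2 = c * ∑ i ∈ s, ‖z i‖ ^ 2 := by
  have hsq : ∀ w : ℂ, ((‖w‖ ^ 2 : ℝ) : ℂ) = star w * w := fun w => by
    rw [Complex.star_def, Complex.conj_mul']; push_cast; rfl
  have : ((∑ k, ‖∑ i ∈ s, U k i * z i‖ ^ 2 : ℝ) : ℂ) = ((c * ∑ i ∈ s, ‖z i‖ ^ 2 : ℝ) : ℂ) := by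
    rw [Complex.ofReal_sum, Complex.ofReal_mul, Complex.ofReal_sum]
    simp_rw [hsq, star_sum, Finset.sum_mul_sum]
    rw [Finset.sum_comm]
    have : ∀ i ∈ s, ∑ k, ∑ j ∈ s, star (U k i * z i) * (U k j * z j) = c * (star (z i) * z i) := by
      intro i hi
      rw [Finset.sum_comm]
      have : ∀ j ∈ s, ∑ k, star (U k i * z i) * (U k j * z j) =
          (if i = j then (c : ℂ) else 0) * (star (z i) * z j) := by
        intro j _
        rw [← hU i j, Finset.sum_mul]
        refine Finset.sum_congr rfl fun k _ => ?_
        rw [star_mul']; ring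
      rw [Finset.sum_congr rfl this]
      simp [hi]
    rw [Finset.sum_congr rfl this, Finset.mul_sum]
  exact_mod_cast this

variable {M : ℕ} {dt : ℝ}

lemma dt_mul_gridCos (hdt : 0 < dt) (r : Fin M) : dt * gridCos M dt r = (r : ℝ) / M - 1 / 2 := by
  rw [gridCos, ← mul_assoc, mul_one_div_cancel hdt.ne', one_mul]

lemma star_beamWeight_mul (r r' m m' : Fin M) :
    star (beamWeight M dt r m) * beamWeight M dt r' m' = 1 / (M : ℂ) ^ 2 *
      Complex.exp (Complex.I * ((2 * Real.pi * (dt * gridCos M dt r * (m : ℝ) -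
        dt * gridCos M dt r' * (m' : ℝ)) : ℝ) : ℂ)) := by
  rw [beamWeight, beamWeight, star_star, star_mul', Complex.star_def,
    ← Complex.exp_conj, mul_mul_mul_comm, ← Complex.exp_add]
  congr 1
  · simp [sq]
  · congr 1
    simp only [map_mul, Complex.conj_I, Complex.conj_ofReal]
    push_cast
    ring

/-- The grid is uniform in `dt * cos ϑ` with step `1/M`, so the weights form, up to phases, a
unitary DFT matrix times `M^(-1/2)`. Orthogonality between beams decouples their noise;
orthogonality between antennas, proved next, gives the Parseval identity. -/
lemma sum_star_beamWeight_mul (hdt : 0 < dt) (r r' : Fin M) :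
    ∑ m, star (beamWeight M dt r m) * beamWeight M dt r' m =
      if r = r' then ((1 / (M : ℝ) : ℝ) : ℂ) else 0 := by
  simp_rw [star_beamWeight_mul]
  rw [← Finset.mul_sum]
  have : ∀ m : Fin M, 2 * Real.pi * (dt * gridCos M dt r * (m : ℝ) -
      dt * gridCos M dt r' * (m : ℝ)) =
      2 * Real.pi * ((m : ℝ) * (((r : ℤ) - r' : ℤ) : ℝ) / M) := by
    intro m
    rw [dt_mul_gridCos hdt, dt_mul_gridCos hdt]
    push_cast
    ring
  simp_rw [this]
  rw [sum_exp_eq]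
  simp_rw [fin_dvd_sub_iff]
  have hM : (M : ℂ) ≠ 0 := by exact_mod_cast (Fin.pos r).ne'
  split_ifs
  · push_cast; field_simp
  · simp

lemma sum_star_beamWeight_mul' (hdt : 0 < dt) (m m' : Fin M) :
    ∑ r, star (beamWeight M dt r m) * beamWeight M dt r m' =
      if m = m' then ((1 / (M : ℝ) : ℝ) : ℂ) else 0 := by
  simp_rw [star_beamWeight_mul]
  rw [← Finset.mul_sum]
  -- The shift by 1/2 in the grid only contributes a phase that does not depend on the beam.
  have : ∀ r : Fin M, Complex.exp (Complex.I * ((2 * Real.pi * (dt * gridCos M dt r * (m : ℝ) -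
        dt * gridCos M dt r * (m' : ℝ)) : ℝ) : ℂ)) =
      Complex.exp (Complex.I * ((- Real.pi * ((m : ℝ) - m') : ℝ) : ℂ)) *
      Complex.exp (Complex.I *
        ((2 * Real.pi * ((r : ℝ) * (((m : ℤ) - m' : ℤ) : ℝ) / M) : ℝ) : ℂ)) := by
    intro r
    rw [dt_mul_gridCos hdt, ← Complex.exp_add]
    congr 1
    push_cast
    ring
  simp_rw [this]
  rw [← Finset.mul_sum, sum_exp_eq]
  simp_rw [fin_dvd_sub_iff]
  have hM : (M : ℂ) ≠ 0 := by exact_mod_cast (Fin.pos m).ne'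
  split_ifs with h
  · subst h; simp; field_simp
  · simp

lemma kernel_eq_sum (c : ℝ) (r : Fin M) :
    kernel M dt c r = ∑ m, beamWeight M dt r m *
      Complex.exp (Complex.I * ((2 * Real.pi * dt * (m : ℝ) * c : ℝ) : ℂ)) := by
  rw [kernel, Finset.mul_sum]
  refine Finset.sum_congr rfl fun m _ => ?_
  rw [beamWeight, star_mul', Complex.star_def, ← Complex.exp_conj,
    mul_assoc (starRingEnd ℂ _), ← Complex.exp_add]
  congr 1
  · simp
  · congr 1
    simp only [map_mul, Complex.conj_I, Complex.conj_ofReal]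
    push_cast
    ring

/-- Parseval identity: the beams together collect the whole energy of a plane wave. -/
lemma sum_norm_kernel_sq (hdt : 0 < dt) (hM : 0 < M) (c : ℝ) :
    ∑ r, ‖kernel M dt c r‖ ^ 2 = 1 := by
  simp_rw [kernel_eq_sum]
  rw [sum_norm_sq_of_orthogonal Finset.univ (fun r m => beamWeight M dt r m) (1 / M)
    (sum_star_beamWeight_mul' hdt)]
  simp only [Complex.norm_exp_I_mul_ofReal]
  have : (M : ℝ) ≠ 0 := by exact_mod_cast hM.ne'
  simp [this]

noncomputable section

variable {L N : ℕ}

/-! ### Profiles of the mean cost as functions of the residual offset -/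

/-- Half the derivative of `t ↦ ‖P E(t) v‖²`, where `P` projects onto the complement of the pilot
span. -/
def slopeOf (L : ℕ) (x : Fin N → ℂ) (v : EuclideanSpace ℂ (Fin N)) (t : ℝ) : ℝ :=
  (inner ℂ (perp L x (rot N t v)) (perp L x (gen N (rot N t v)))).re

/-- Half the second derivative of `t ↦ ‖P E(t) v‖²`. -/
def curvatureOf (L : ℕ) (x : Fin N → ℂ) (v : EuclideanSpace ℂ (Fin N)) (t : ℝ) : ℝ :=
  (inner ℂ (perp L x (rot N t v)) (perp L x (gen N (gen N (rot N t v))))).re +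
    ‖perp L x (gen N (rot N t v))‖ ^ 2

/-- The commutator of `D` with the projection onto the complement of the pilot span. -/
def comm (L : ℕ) (x : Fin N → ℂ) (v : EuclideanSpace ℂ (Fin N)) : EuclideanSpace ℂ (Fin N) :=
  gen N (perp L x v) - perp L x (gen N v)

/-- Average over the taps, weighted with the power profile. -/
def tapMean (pdp : Fin L → ℝ≥0) (F : Fin L → ℝ) : ℝ := ∑ l, (pdp l : ℝ) * F l

/-- Average over the subpaths of the sum over the beams, weighted with the beam responses. -/
def beamMean (M P : ℕ) (dt : ℝ) (F : ℝ → ℝ → ℝ) : ℝ :=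
  1 / (P : ℝ) * ∑ p : Fin P, ∑ r ∈ beams M dt,
    ‖kernel M dt (Real.cos (aoa P p)) r‖ ^ 2 * F (Real.cos (aoa P p)) (gridCos M dt r)

variable (x : Fin N → ℂ)

lemma inner_gen_left (v w : EuclideanSpace ℂ (Fin N)) :
    inner ℂ (gen N v) w = -inner ℂ v (gen N w) := by
  simp only [PiLp.inner_apply, gen_apply, ← Finset.sum_neg_distrib, RCLike.inner_apply, map_mul,
    Complex.conj_I, Complex.conj_ofReal]
  refine Finset.sum_congr rfl fun n _ => ?_
  ring

lemma hasDerivAt_energy (v : EuclideanSpace ℂ (Fin N)) (t : ℝ) :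
    HasDerivAt (fun t => ‖perp L x (rot N t v)‖ ^ 2) (2 * slopeOf L x v t) t := by
  have h := hasDerivAt_perp (L := L) x (hasDerivAt_rot v t)
  have h2 := Complex.reCLM.hasFDerivAt.comp_hasDerivAt t (h.inner ℂ h)
  refine (h2.congr_of_eventuallyEq (Eventually.of_forall fun u => ?_)).congr_deriv ?_
  · simp [@norm_sq_eq_re_inner ℂ]
  · rw [Complex.reCLM_apply, Complex.add_re, slopeOf, two_mul]
    congr 1
    exact inner_re_symm (𝕜 := ℂ) _ _

lemma hasDerivAt_slopeOf (v : EuclideanSpace ℂ (Fin N)) (t : ℝ) :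
    HasDerivAt (slopeOf L x v) (curvatureOf L x v t) t := by
  have h := hasDerivAt_perp (L := L) x (hasDerivAt_rot v t)
  have h' := hasDerivAt_perp (L := L) x (hasDerivAt_rot (gen N v) t)
  simp_rw [rot_gen] at h'
  have h2 := Complex.reCLM.hasFDerivAt.comp_hasDerivAt t (h.inner ℂ h')
  refine h2.congr_deriv ?_
  rw [Complex.reCLM_apply, Complex.add_re, curvatureOf, @norm_sq_eq_re_inner ℂ]
  rfl

/-! ### Moments of the derivatives along lines of trial offsets -/

section Lines

variable (pdp : Fin L → ℝ≥0) (dt fd xi : ℝ) (s : ℝ≥0) (M P : ℕ)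
  {A B : ℝ → ℝ} {f e : ℝ → ℝ} (hfe : ∀ u γ, f u * γ + e u = u * A γ + B γ) {u₀ : ℝ}
  (hu₀ : ∀ γ, u₀ * A γ + B γ = fd * γ + xi)

/-- Contribution of the `l`-th tap and the `p`-th subpath to the `r`-th branch residual on the line
`u ↦ u * A γ + B γ` of trial offsets. -/
def component (dt fd xi : ℝ) (M P : ℕ) (A B : ℝ → ℝ) (r : Fin M) (a : Fin L × Fin P) (u : ℝ) :
    EuclideanSpace ℂ (Fin N) :=
  kernel M dt (Real.cos (aoa P a.2)) r • perp L x (rot N (fd * Real.cos (aoa P a.2) + xi -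
    (u * A (gridCos M dt r) + B (gridCos M dt r))) (col L x a.1))

lemma contDiff_component (r : Fin M) (a : Fin L × Fin P) :
    ContDiff ℝ 2 (component x dt fd xi M P A B r a) := by
  refine ContDiff.const_smul _ (contDiff_perp x ((contDiff_rot (col L x a.1)).comp ?_))
  fun_prop

-- A line `u ↦ (f u, e u)` in the parameter plane changes the trial offset of a beam affinely: `A γ`
-- is the sensitivity of a beam with cosine `γ`, and `hu₀` places the true parameters at `u₀`. The
-- DFO is the case `A γ = γ`, `B γ = ξ`; the OFO is the case `A γ = 1`, `B γ = f_d γ`.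
include hfe in
lemma g0_line (g : Fin L → Fin P → ℂ) (u : ℝ) :
    g0 x dt fd xi M P g (f u) (e u) =
      ∑ r ∈ beams M dt, ‖∑ a : Fin L × Fin P, g a.1 a.2 •
        component x dt fd xi M P A B r a u‖ ^ 2 := by
  rw [g0, cost]
  refine Finset.sum_congr rfl fun r hr => ?_
  rw [branchResidual_noiselessSignal x hr, hfe]
  rfl

/-- Both arguments rotate with the trial offset `φ`. As the projection `P` is self-adjoint and
idempotent and `D` is skew-adjoint, the two product-rule terms combine to `D P - P D` acting on the
signal side. -/
lemma hasDerivAt_inner_perp (v w : EuclideanSpace ℂ (Fin N)) (τ φ : ℝ) :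
    HasDerivAt (fun φ => inner ℂ (perp L x (rot N (τ - φ) v)) (perp L x (rot N (-φ) w)))
      (inner ℂ (comm L x (rot N (τ - φ) v)) (rot N (-φ) w)) φ := by
  have h1 : HasDerivAt (fun φ => rot N (τ - φ) v) ((-1 : ℝ) • gen N (rot N (τ - φ) v)) φ :=
    (hasDerivAt_rot v (τ - φ)).scomp φ ((hasDerivAt_id φ).const_sub τ)
  have h2 : HasDerivAt (fun φ => rot N (-φ) w) ((-1 : ℝ) • gen N (rot N (-φ) w)) φ :=
    (hasDerivAt_rot w (-φ)).scomp φ (hasDerivAt_neg φ)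
  refine ((hasDerivAt_perp (L := L) x h1).inner ℂ (hasDerivAt_perp (L := L) x h2)).congr_deriv ?_
  rw [neg_one_smul, neg_one_smul, map_neg, map_neg, inner_neg_left, inner_neg_right,
    ← inner_perp_left (L := L) x, perp_perp, ← inner_perp_left (L := L) x, perp_perp, comm,
    inner_sub_left, inner_gen_left]
  ring

/-- Contribution of one noise entry to the `r`-th branch residual on a line of trial offsets. -/
def noiseComponent (L : ℕ) (x : Fin N → ℂ) (dt : ℝ) (M : ℕ) (A B : ℝ → ℝ) (r : Fin M)
    (k : Fin N × Fin M) (u : ℝ) : EuclideanSpace ℂ (Fin N) :=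
  beamWeight M dt r k.2 • perp L x (rot N (-(u * A (gridCos M dt r) + B (gridCos M dt r)))
    (EuclideanSpace.single k.1 1))

lemma hasDerivAt_inner_component (dt fd xi : ℝ) (M P : ℕ) {A B : ℝ → ℝ} (r : Fin M)
    (a : Fin L × Fin P) (k : Fin N × Fin M) (u : ℝ) :
    HasDerivAt (fun u => inner ℂ (component x dt fd xi M P A B r a u)
      (noiseComponent L x dt M A B r k u))
      (beamWeight M dt r k.2 * (star (kernel M dt (Real.cos (aoa P a.2)) r) *
        (A (gridCos M dt r) : ℂ) * inner ℂ
        (rot N (u * A (gridCos M dt r) + B (gridCos M dt r)) (comm L x (rot N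
          (fd * Real.cos (aoa P a.2) + xi - (u * A (gridCos M dt r) + B (gridCos M dt r)))
          (col L x a.1)))) (EuclideanSpace.single k.1 1))) u := by
  simp_rw [component, noiseComponent, inner_smul_left, inner_smul_right]
  have h := (hasDerivAt_inner_perp (L := L) x (col L x a.1) (EuclideanSpace.single k.1 1)
    (fd * Real.cos (aoa P a.2) + xi) _).scomp u
    (((hasDerivAt_id u).mul_const (A (gridCos M dt r))).add_const (B (gridCos M dt r)))
  refine ((h.const_mul (beamWeight M dt r k.2)).const_mul _).congr_deriv ?_
  rw [inner_rot_left, Complex.real_smul, Complex.star_def]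
  simp only [id_eq, one_mul]
  ring

lemma sum_norm_inner_single_sq (y : EuclideanSpace ℂ (Fin N)) :
    ∑ n, ‖(inner ℂ y (EuclideanSpace.single n 1) : ℂ)‖ ^ 2 = ‖y‖ ^ 2 := by
  simp [EuclideanSpace.norm_sq_eq, EuclideanSpace.inner_single_right]

lemma isWhite_gains :
    IsWhite (Measure.pi fun l => Measure.pi fun _ : Fin P => complexNormal (pdp l / (P : ℝ≥0)))
      (fun (a : Fin L × Fin P) g => g a.1 a.2) (fun a => (pdp a.1 : ℝ) / P) := by
  have := isWhite_pi_pi fun (l : Fin L) (_ : Fin P) => pdp l / (P : ℝ≥0)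
  simpa using this

lemma sum_gains_eq_beamMean (F : Fin L → ℝ → ℝ → ℝ) :
    ∑ a : Fin L × Fin P, (pdp a.1 : ℝ) / P * ∑ r ∈ beams M dt,
      ‖kernel M dt (Real.cos (aoa P a.2)) r‖ ^ 2 *
        F a.1 (Real.cos (aoa P a.2)) (gridCos M dt r) =
    beamMean M P dt fun c γ => tapMean pdp fun l => F l c γ := by
  rw [beamMean, Fintype.sum_prod_type_right, Finset.mul_sum]
  refine Finset.sum_congr rfl fun p _ => ?_
  simp_rw [Finset.mul_sum]
  rw [Finset.sum_comm]
  refine Finset.sum_congr rfl fun r _ => ?_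
  rw [tapMean, Finset.mul_sum, Finset.mul_sum]
  refine Finset.sum_congr rfl fun l _ => ?_
  ring

variable (A B) in
/-- First derivative of the mean cost along a line of trial offsets. -/
def lineSlope (u : ℝ) : ℝ :=
  ∑ a : Fin L × Fin P, (pdp a.1 : ℝ) / P * ∑ r ∈ beams M dt,
    ‖kernel M dt (Real.cos (aoa P a.2)) r‖ ^ 2 * (-(A (gridCos M dt r)) * (2 *
      slopeOf L x (col L x a.1) (fd * Real.cos (aoa P a.2) + xi -
        (u * A (gridCos M dt r) + B (gridCos M dt r)))))

lemma hasDerivAt_line (α β τ u : ℝ) : HasDerivAt (fun u => τ - (u * α + β)) (-α) u := by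
  have := (((hasDerivAt_id u).mul_const α).add_const β).const_sub τ
  simpa using this

lemma hasDerivAt_meanCost (u : ℝ) :
    HasDerivAt (fun u => ∑ a : Fin L × Fin P, (pdp a.1 : ℝ) / P *
      ∑ r ∈ beams M dt, ‖component x dt fd xi M P A B r a u‖ ^ 2)
      (lineSlope x pdp dt fd xi M P A B u) u := by
  refine HasDerivAt.fun_sum fun a _ => HasDerivAt.const_mul _
    (HasDerivAt.fun_sum fun r _ => ?_)
  simp_rw [component, norm_smul, mul_pow]
  refine HasDerivAt.const_mul _ ?_
  refine ((hasDerivAt_energy x (col L x a.1) _).comp u (hasDerivAt_line _ _ _ u)).congr_deriv ?_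
  rw [mul_comm]

lemma hasDerivAt_lineSlope (u : ℝ) :
    HasDerivAt (lineSlope x pdp dt fd xi M P A B)
      (∑ a : Fin L × Fin P, (pdp a.1 : ℝ) / P * ∑ r ∈ beams M dt,
        ‖kernel M dt (Real.cos (aoa P a.2)) r‖ ^ 2 * (A (gridCos M dt r) ^ 2 * (2 *
          curvatureOf L x (col L x a.1) (fd * Real.cos (aoa P a.2) + xi -
            (u * A (gridCos M dt r) + B (gridCos M dt r)))))) u := by
  refine HasDerivAt.fun_sum fun a _ => HasDerivAt.const_mul _
    (HasDerivAt.fun_sum fun r _ => HasDerivAt.const_mul _ ?_)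
  refine (((hasDerivAt_slopeOf x (col L x a.1) _).comp u
    (hasDerivAt_line _ _ _ u)).const_mul 2).const_mul _ |>.congr_deriv ?_
  ring

include hfe hu₀

lemma integral_deriv_g0 :
    ∫ ω, deriv (fun u => g0 x dt fd xi M P ω.1 (f u) (e u)) u₀ ∂(law pdp s N M P) =
      beamMean M P dt fun c γ => tapMean pdp fun l =>
        -A γ * (2 * slopeOf L x (col L x l) (fd * (c - γ))) := by
  simp_rw [g0_line x dt fd xi M P hfe]
  rw [law, integral_fun_fst (fun g : Fin L → Fin P → ℂ => deriv (fun u => ∑ r ∈ beams M dt,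
      ‖∑ a : Fin L × Fin P, g a.1 a.2 • component x dt fd xi M P A B r a u‖ ^ 2) u₀),
    (isWhite_gains pdp P).integral_deriv_energy (beams M dt)
      (fun r a => contDiff_component x dt fd xi M P r a)
      (hasDerivAt_meanCost x pdp dt fd xi M P u₀), probReal_univ, one_smul, lineSlope]
  rw [← sum_gains_eq_beamMean pdp dt M P
    fun l c γ => -A γ * (2 * slopeOf L x (col L x l) (fd * (c - γ)))]
  -- At the true parameters the OFO cancels, and only the mismatch `f_d (c - γ)` between path and
  -- beam is left.
  simp_rw [hu₀]
  refine Finset.sum_congr rfl fun a _ => congrArg _ (Finset.sum_congr rfl fun r _ => ?_)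
  congr 4
  ring

lemma integral_deriv_deriv_g0 :
    ∫ ω, iteratedDeriv 2 (fun u => g0 x dt fd xi M P ω.1 (f u) (e u)) u₀ ∂(law pdp s N M P) =
      beamMean M P dt fun c γ => tapMean pdp fun l =>
        A γ ^ 2 * (2 * curvatureOf L x (col L x l) (fd * (c - γ))) := by
  simp_rw [g0_line x dt fd xi M P hfe]
  rw [law, integral_fun_fst (fun g : Fin L → Fin P → ℂ => iteratedDeriv 2 (fun u =>
      ∑ r ∈ beams M dt, ‖∑ a : Fin L × Fin P, g a.1 a.2 •
        component x dt fd xi M P A B r a u‖ ^ 2) u₀),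
    (isWhite_gains pdp P).integral_deriv_deriv_energy (beams M dt)
      (fun r a => contDiff_component x dt fd xi M P r a)
      (hasDerivAt_meanCost x pdp dt fd xi M P)
      (hasDerivAt_lineSlope x pdp dt fd xi M P u₀), probReal_univ, one_smul]
  rw [← sum_gains_eq_beamMean pdp dt M P
    fun l c γ => A γ ^ 2 * (2 * curvatureOf L x (col L x l) (fd * (c - γ)))]
  simp_rw [hu₀]
  refine Finset.sum_congr rfl fun a _ => congrArg _ (Finset.sum_congr rfl fun r _ => ?_)
  congr 4
  ring

omit hu₀ in
lemma gn_line (g : Fin L → Fin P → ℂ) (w : Fin N → Fin M → ℂ) (u : ℝ) :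
    gn x dt fd xi M P g w (f u) (e u) = 2 * (∑ a : Fin L × Fin P, ∑ k : Fin N × Fin M,
      star (g a.1 a.2) * w k.1 k.2 * ∑ r ∈ beams M dt,
        inner ℂ (component x dt fd xi M P A B r a u) (noiseComponent L x dt M A B r k u)).re := by
  have : ∑ r ∈ beams M dt, inner ℂ
        (branchResidual L x dt (noiselessSignal x dt fd xi M P g) (f u) (e u) r)
        (branchResidual L x dt (Matrix.of w) (f u) (e u) r) =
      ∑ r ∈ beams M dt, ∑ a : Fin L × Fin P, ∑ k : Fin N × Fin M,
      star (g a.1 a.2) * w k.1 k.2 *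
        inner ℂ (component x dt fd xi M P A B r a u) (noiseComponent L x dt M A B r k u) := by
    refine Finset.sum_congr rfl fun r hr => ?_
    rw [branchResidual_noiselessSignal x hr, branchResidual_of x hr, hfe, sum_inner]
    refine Finset.sum_congr rfl fun a _ => ?_
    rw [inner_sum]
    refine Finset.sum_congr rfl fun k _ => ?_
    rw [inner_smul_left, inner_smul_right, Complex.star_def, mul_assoc]
    rfl
  rw [gn, crossCost, this, Finset.sum_comm]
  congr 2
  refine Finset.sum_congr rfl fun a _ => ?_
  rw [Finset.sum_comm]
  simp_rw [Finset.mul_sum]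

/-- Summing over the antennas uses the orthogonality of the beam weights: it yields the factor `1/M`
and removes all terms between different beams. Summing over the time samples gives the squared norm
of the commutator term, since the outer rotation is an isometry. -/
lemma integral_sq_deriv_gn (hdt : 0 < dt) :
    ∫ ω, (deriv (fun u => gn x dt fd xi M P ω.1 ω.2 (f u) (e u)) u₀) ^ 2 ∂(law pdp s N M P) =
      2 * s / M * beamMean M P dt fun c γ => tapMean pdp fun l =>
        A γ ^ 2 * ‖comm L x (rot N (fd * (c - γ)) (col L x l))‖ ^ 2 := by
  simp_rw [gn_line x dt fd xi M P hfe]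
  have hW : IsWhite (Measure.pi fun _ : Fin N => Measure.pi fun _ : Fin M => complexNormal s)
      (fun (k : Fin N × Fin M) w => w k.1 k.2) (fun _ => (s : ℝ)) :=
    isWhite_pi_pi fun (_ : Fin N) (_ : Fin M) => s
  rw [law, (isWhite_gains pdp P).integral_sq_deriv_bilinear hW fun a k =>
    HasDerivAt.fun_sum fun r _ => hasDerivAt_inner_component x dt fd xi M P r a k u₀]
  rw [← sum_gains_eq_beamMean pdp dt M P
    fun l c γ => A γ ^ 2 * ‖comm L x (rot N (fd * (c - γ)) (col L x l))‖ ^ 2,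
    Finset.mul_sum, Finset.mul_sum]
  refine Finset.sum_congr rfl fun a _ => ?_
  rw [← Finset.mul_sum, Fintype.sum_prod_type]
  simp_rw [sum_norm_sq_of_orthogonal (beams M dt) (fun m r => beamWeight M dt r m) (1 / M)
    (sum_star_beamWeight_mul hdt)]
  rw [← Finset.mul_sum, Finset.sum_comm]
  have : ∀ r : Fin M, ∑ n : Fin N, ‖star (kernel M dt (Real.cos (aoa P a.2)) r) *
        (A (gridCos M dt r) : ℂ) * inner ℂ
        (rot N (u₀ * A (gridCos M dt r) + B (gridCos M dt r)) (comm L x (rot N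
          (fd * Real.cos (aoa P a.2) + xi - (u₀ * A (gridCos M dt r) + B (gridCos M dt r)))
          (col L x a.1)))) (EuclideanSpace.single n 1)‖ ^ 2 =
      ‖kernel M dt (Real.cos (aoa P a.2)) r‖ ^ 2 * (A (gridCos M dt r) ^ 2 *
        ‖comm L x (rot N (fd * (Real.cos (aoa P a.2) - gridCos M dt r)) (col L x a.1))‖ ^ 2) := by
    intro r
    simp_rw [norm_mul, mul_pow]
    rw [← Finset.mul_sum, sum_norm_inner_single_sq, norm_rot, norm_star, Complex.norm_real,
      Real.norm_eq_abs, sq_abs, hu₀, mul_assoc]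
    congr 5
    ring_nf
  simp_rw [this]
  ring

end Lines

/-! ### Decay and leakage of the beam responses -/

/-- Decay constant of the beam responses. -/
def decay (dt : ℝ) : ℝ := (dt + 1 / 2) / (dt * Real.sin (Real.pi * (dt + 1 / 2)))

variable {M P : ℕ} {dt : ℝ}

lemma sin_pos_of_spacing (hdt : 0 < dt) (hdt' : dt < 1 / 2) :
    0 < Real.sin (Real.pi * (dt + 1 / 2)) :=
  Real.sin_pos_of_pos_of_lt_pi (by have := Real.pi_pos; positivity)
    (by have := Real.pi_pos; nlinarith)

lemma decay_pos (hdt : 0 < dt) (hdt' : dt < 1 / 2) : 0 < decay dt := by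
  have := sin_pos_of_spacing hdt hdt'
  rw [decay]; positivity

/-- By concavity on `[0, π]`, the sine lies above its chord from `0` to `πρ`; this works up to any
`ρ < 1`, beyond the usual `1/2`. -/
lemma abs_mul_le_abs_sin {ρ t : ℝ} (hρ : 0 < ρ) (hρ' : ρ < 1) (ht : |t| ≤ ρ) :
    |t| * (Real.sin (Real.pi * ρ) / ρ) ≤ |Real.sin (Real.pi * t)| := by
  have hπ := Real.pi_pos
  have h0 : (0 : ℝ) ∈ Set.Icc 0 Real.pi := ⟨le_rfl, hπ.le⟩
  have h1 : Real.pi * ρ ∈ Set.Icc 0 Real.pi := ⟨by positivity, by nlinarith⟩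
  have h : (1 - |t| / ρ) • Real.sin 0 + (|t| / ρ) • Real.sin (Real.pi * ρ) ≤
      Real.sin ((1 - |t| / ρ) • 0 + (|t| / ρ) • (Real.pi * ρ)) :=
    strictConcaveOn_sin_Icc.concaveOn.2 h0 h1
      (sub_nonneg.2 (div_le_one_of_le₀ ht hρ.le)) (by positivity) (by ring)
  have e1 : |t| / ρ * (Real.pi * ρ) = Real.pi * |t| := by field_simp
  simp only [smul_eq_mul, mul_zero, Real.sin_zero, zero_add, e1] at h
  have h2 : |Real.sin (Real.pi * t)| = |Real.sin (Real.pi * |t|)| := by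
    rcases abs_choice t with h | h <;> rw [h]
    rw [mul_neg, Real.sin_neg, abs_neg]
  rw [h2]
  refine le_trans (le_of_eq ?_) (h.trans (le_abs_self _))
  ring

lemma abs_dt_mul_gridCos_le (hdt : 0 < dt) (r : Fin M) : |dt * gridCos M dt r| ≤ 1 / 2 := by
  have h1 := fin_div_le_one r
  have h2 : (0 : ℝ) ≤ (r : ℝ) / M := by positivity
  rw [dt_mul_gridCos hdt, abs_le]
  constructor <;> linarith

/-- The response is a geometric sum with ratio `e^{2πjt}`, `t = dt (c - γ)`, hence at most `1 / (M
|sin πt|)` where the sine is nonzero. Here `|t| ≤ dt + 1/2 < 1`, so the sine vanishes only at `t =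
0` and the chord bound applies: no grating lobes occur, which is the role of `dt < 1/2`. -/
lemma norm_kernel_mul_le (hdt : 0 < dt) (hdt' : dt < 1 / 2) {c : ℝ} (hc : |c| ≤ 1) (r : Fin M) :
    ‖kernel M dt c r‖ * |c - gridCos M dt r| ≤ decay dt / M := by
  have hM : (0 : ℝ) < M := by exact_mod_cast Fin.pos r
  have hs := sin_pos_of_spacing hdt hdt'
  set t := dt * (c - gridCos M dt r) with ht
  set ζ := Complex.exp (Complex.I * ((2 * Real.pi * t : ℝ) : ℂ)) with hζ
  have hk : kernel M dt c r = 1 / (M : ℂ) * ∑ m ∈ Finset.range M, ζ ^ m := by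
    rw [kernel, ← Fin.sum_univ_eq_sum_range fun m => ζ ^ m]
    congr 1
    refine Finset.sum_congr rfl fun m _ => ?_
    rw [hζ, ← Complex.exp_nat_mul]
    congr 1
    push_cast [ht]
    ring
  have hgeom : ‖ζ - 1‖ * ‖∑ m ∈ Finset.range M, ζ ^ m‖ ≤ 2 := by
    rw [← norm_mul, mul_geom_sum]
    refine (norm_sub_le _ _).trans ?_
    rw [norm_pow, hζ, Complex.norm_exp_I_mul_ofReal]
    norm_num
  have hζ1 : ‖ζ - 1‖ = 2 * |Real.sin (Real.pi * t)| := by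
    rw [hζ, Complex.norm_exp_I_mul_ofReal_sub_one, norm_mul, Real.norm_eq_abs, Real.norm_eq_abs,
      abs_two]
    congr 3
    ring
  have htρ : |t| ≤ dt + 1 / 2 := by
    rw [ht, mul_sub]
    refine (abs_sub _ _).trans (add_le_add ?_ (abs_dt_mul_gridCos_le hdt r))
    rw [abs_mul, abs_of_pos hdt]
    exact mul_le_of_le_one_right hdt.le hc
  have hsin := abs_mul_le_abs_sin (by positivity) (by linarith) htρ
  rw [hk, norm_mul, norm_div, norm_one, Complex.norm_natCast]
  have ht' : |t| = dt * |c - gridCos M dt r| := by rw [ht, abs_mul, abs_of_pos hdt]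
  set S := ‖∑ m ∈ Finset.range M, ζ ^ m‖
  have hS : 0 ≤ S := norm_nonneg _
  rw [hζ1] at hgeom
  have h3 : |t| * (Real.sin (Real.pi * (dt + 1 / 2)) / (dt + 1 / 2)) * S ≤ 1 := by
    have := mul_le_mul_of_nonneg_right hsin hS
    linarith
  rw [one_div_mul_eq_div, div_mul_eq_mul_div]
  refine div_le_div_of_nonneg_right ?_ hM.le
  rw [decay, le_div_iff₀ (by positivity)]
  rw [ht'] at h3
  have h4 : dt * |c - gridCos M dt r| * (Real.sin (Real.pi * (dt + 1 / 2)) / (dt + 1 / 2)) * S =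
      S * |c - gridCos M dt r| * (dt * Real.sin (Real.pi * (dt + 1 / 2))) / (dt + 1 / 2) := by ring
  rw [h4, div_le_one (by positivity)] at h3
  exact h3

lemma card_filter_abs_sub_le (n : ℕ) (a : ℝ) {R : ℝ} (hR : 0 ≤ R) :
    ((Finset.univ.filter fun i : Fin n => |(i : ℝ) - a| ≤ R).card : ℝ) ≤ 2 * R + 1 := by
  have hinj : (Finset.univ.filter fun i : Fin n => |(i : ℝ) - a| ≤ R).card ≤
      (Finset.Icc ⌈a - R⌉ ⌊a + R⌋).card := by
    refine Finset.card_le_card_of_injOn (fun i => (i : ℤ)) (fun i hi => ?_)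
      (fun i _ j _ hij => by ext; simpa using hij)
    have h := abs_le.1 (Finset.mem_filter.1 (Finset.mem_coe.1 hi)).2
    simp only [Finset.coe_Icc, Set.mem_Icc, Int.ceil_le, Int.le_floor]
    constructor <;> push_cast <;> linarith [h.1, h.2]
  have h2 : ((Finset.Icc ⌈a - R⌉ ⌊a + R⌋).card : ℝ) ≤ 2 * R + 1 := by
    rw [Int.card_Icc]
    rcases le_total 0 (⌊a + R⌋ + 1 - ⌈a - R⌉) with h | h
    · have : (((⌊a + R⌋ + 1 - ⌈a - R⌉).toNat : ℕ) : ℝ) = ((⌊a + R⌋ + 1 - ⌈a - R⌉ : ℤ) : ℝ) := by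
        exact_mod_cast congrArg (Int.cast : ℤ → ℝ) (Int.toNat_of_nonneg h)
      rw [this]
      push_cast
      linarith [Int.floor_le (a + R), Int.le_ceil (a - R)]
    · rw [Int.toNat_of_nonpos h]
      simp; positivity
  exact (by exact_mod_cast hinj : ((Finset.univ.filter fun i : Fin n =>
    |(i : ℝ) - a| ≤ R).card : ℝ) ≤ _).trans h2

/-- At most `δM + 1` beams lie within `δ` of the wave; Cauchy–Schwarz and Parseval bound their share
by the square root. Each of the at most `M` others responds with at most `decay dt / (M δ)`. -/
lemma sum_norm_kernel_le (hdt : 0 < dt) (hdt' : dt < 1 / 2) (hM : 0 < M) {c : ℝ} (hc : |c| ≤ 1)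
    {δ : ℝ} (hδ : 0 < δ) :
    ∑ r, ‖kernel M dt c r‖ ≤ Real.sqrt (δ * M + 1) + decay dt / δ := by
  have hM' : (0 : ℝ) < M := by exact_mod_cast hM
  rw [← Finset.sum_filter_add_sum_filter_not Finset.univ fun r => |c - gridCos M dt r| ≤ δ]
  refine add_le_add ?_ ?_
  · set S := Finset.univ.filter fun r => |c - gridCos M dt r| ≤ δ
    have hcard : (S.card : ℝ) ≤ δ * M + 1 := by
      have h1 : S ⊆ Finset.univ.filter fun r : Fin M =>
          |(r : ℝ) - M * (dt * c + 1 / 2)| ≤ dt * δ * M := by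
        intro r hr
        have hr' := (Finset.mem_filter.1 hr).2
        refine Finset.mem_filter.2 ⟨Finset.mem_univ _, ?_⟩
        have : (r : ℝ) - M * (dt * c + 1 / 2) = -(dt * M * (c - gridCos M dt r)) := by
          have := dt_mul_gridCos hdt r
          have h2 : (r : ℝ) = M * (dt * gridCos M dt r + 1 / 2) := by rw [this]; field_simp; ring
          rw [h2]; ring
        rw [this, abs_neg, abs_mul, abs_of_pos (by positivity)]
        calc dt * M * |c - gridCos M dt r| ≤ dt * M * δ := by gcongr
          _ = _ := by ring
      have h2 : (S.card : ℝ) ≤ _ := Nat.cast_le.2 (Finset.card_le_card h1)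
      -- The window of half-width `dt δ M` holds at most `2 dt δ M + 1` integers, and `2 dt < 1`.
      refine h2.trans ((card_filter_abs_sub_le M _ (by positivity)).trans ?_)
      have : 0 < δ * M := by positivity
      nlinarith
    refine Real.le_sqrt_of_sq_le ?_
    refine (sq_sum_le_card_mul_sum_sq).trans ?_
    have h1 : ∑ r ∈ S, ‖kernel M dt c r‖ ^ 2 ≤ 1 := by
      rw [← sum_norm_kernel_sq hdt hM c]
      exact Finset.sum_le_sum_of_subset_of_nonneg (Finset.subset_univ _) fun _ _ _ => by positivity
    have h0 : 0 ≤ ∑ r ∈ S, ‖kernel M dt c r‖ ^ 2 := Finset.sum_nonneg fun _ _ => by positivity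
    nlinarith [(Nat.cast_nonneg S.card : (0 : ℝ) ≤ S.card)]
  · have hb : ∀ r ∈ Finset.univ.filter fun r => ¬ |c - gridCos M dt r| ≤ δ,
        ‖kernel M dt c r‖ ≤ decay dt / M / δ := by
      intro r hr
      have hr' := not_le.1 (Finset.mem_filter.1 hr).2
      rw [le_div_iff₀ hδ]
      exact (mul_le_mul_of_nonneg_left hr'.le (norm_nonneg _)).trans
        (norm_kernel_mul_le hdt hdt' hc r)
    refine (Finset.sum_le_card_nsmul _ _ _ hb).trans ?_
    rw [nsmul_eq_mul]
    have hcard : ((Finset.univ.filter fun r => ¬ |c - gridCos M dt r| ≤ δ).card : ℝ) ≤ M := by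
      exact_mod_cast (Finset.card_le_univ _).trans_eq (Fintype.card_fin M)
    have hC := decay_pos hdt hdt'
    calc _ ≤ (M : ℝ) * (decay dt / M / δ) := by gcongr
      _ = _ := by field_simp

/-- Bound on the mean angular spread `∑ |κ|² |c - γ|` of a beam response. -/
def spread (dt : ℝ) (M : ℕ) : ℝ :=
  decay dt / M * (Real.sqrt (1 / √√(M : ℝ) * M + 1) + decay dt / (1 / √√(M : ℝ)))

/-- One factor `|κ|` absorbs `|c - γ|` through the decay bound; the other is summed by
`sum_norm_kernel_le` with `δ = M^(-1/4)`. -/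
lemma sum_kernel_mul_abs_le (hdt : 0 < dt) (hdt' : dt < 1 / 2) (hM : 0 < M) {c : ℝ}
    (hc : |c| ≤ 1) :
    ∑ r, ‖kernel M dt c r‖ ^ 2 * |c - gridCos M dt r| ≤ spread dt M := by
  have hM' : (0 : ℝ) < M := by exact_mod_cast hM
  have hC := decay_pos hdt hdt'
  have h1 : ∑ r, ‖kernel M dt c r‖ ^ 2 * |c - gridCos M dt r| ≤
      ∑ r, decay dt / M * ‖kernel M dt c r‖ := by
    refine Finset.sum_le_sum fun r _ => ?_
    have := mul_le_mul_of_nonneg_right (norm_kernel_mul_le hdt hdt' hc r)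
      (norm_nonneg (kernel M dt c r))
    calc _ = ‖kernel M dt c r‖ * |c - gridCos M dt r| * ‖kernel M dt c r‖ := by ring
      _ ≤ _ := this
  refine h1.trans ?_
  rw [← Finset.mul_sum, spread]
  exact mul_le_mul_of_nonneg_left (sum_norm_kernel_le hdt hdt' hM hc (by positivity))
    (by positivity)

/-- With `δ = M^(-1/4)` the spread is `O(M^(-5/8))`; any exponent strictly between `-1/2` and `0`
would do. The rate must beat `M^(-1/2)` because the floor, which is multiplied by `M`, contains the
square of the slope. -/
lemma tendsto_sqrt_mul_spread (dt : ℝ) :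
    Tendsto (fun M : ℕ => √(M : ℝ) * spread dt M) atTop (𝓝 0) := by
  have hk : Tendsto (fun M : ℕ => (√√(M : ℝ))⁻¹) atTop (𝓝 0) :=
    tendsto_inv_atTop_zero.comp (Real.tendsto_sqrt_atTop.comp
      (Real.tendsto_sqrt_atTop.comp tendsto_natCast_atTop_atTop))
  have h1 : Tendsto (fun M : ℕ => decay dt * (√((√√(M : ℝ))⁻¹ + (√√(M : ℝ))⁻¹ ^ 4) +
      decay dt * (√√(M : ℝ))⁻¹)) atTop (𝓝 (decay dt * (√(0 + 0 ^ 4) + decay dt * 0))) :=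
    (((hk.add (hk.pow 4)).sqrt).add (hk.const_mul _)).const_mul _
  simp only [ne_eq, OfNat.ofNat_ne_zero, not_false_eq_true, zero_pow, add_zero, Real.sqrt_zero,
    mul_zero] at h1
  refine h1.congr' ?_
  filter_upwards [eventually_gt_atTop 0] with M hM
  have hM' : (0 : ℝ) < M := by exact_mod_cast hM
  obtain ⟨k, hk0, hkM⟩ : ∃ k : ℝ, 0 < k ∧ (M : ℝ) = k ^ 4 := by
    refine ⟨√√(M : ℝ), by positivity, ?_⟩
    rw [show (4 : ℕ) = 2 * 2 from rfl, pow_mul, Real.sq_sqrt (by positivity),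
      Real.sq_sqrt hM'.le]
  have e1 : √(M : ℝ) = k ^ 2 := by
    rw [hkM, show k ^ 4 = (k ^ 2) ^ 2 by ring, Real.sqrt_sq (by positivity)]
  have e2 : √(k ^ 2) = k := Real.sqrt_sq hk0.le
  rw [spread, e1, e2, hkM]
  have e3 : √(1 / k * k ^ 4 + 1) = k ^ 2 * √(k⁻¹ + k⁻¹ ^ 4) := by
    have : 1 / k * k ^ 4 + 1 = (k ^ 2) ^ 2 * (k⁻¹ + k⁻¹ ^ 4) := by field_simp
    rw [this, Real.sqrt_mul (by positivity), Real.sqrt_sq (by positivity)]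
  rw [e3]
  field_simp

lemma tendsto_spread (dt : ℝ) : Tendsto (spread dt) atTop (𝓝 0) := by
  have h := (tendsto_sqrt_mul_spread dt).mul (tendsto_inv_atTop_zero.comp
    (Real.tendsto_sqrt_atTop.comp (tendsto_natCast_atTop_atTop (R := ℝ))))
  rw [mul_zero] at h
  refine h.congr' ?_
  filter_upwards [eventually_gt_atTop 0] with M hM
  have hM' : (0 : ℝ) < M := by exact_mod_cast hM
  simp only [Function.comp]
  field_simp

/-! ### Subpath directions -/

/-- After the double-angle formula this is the vanishing of a sum of roots of unity with frequency
2, which needs `P ∤ 2`; for `P = 1, 2` every `cos²` equals 1. -/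
lemma sum_cos_aoa_sq (hP : 3 ≤ P) : ∑ p : Fin P, Real.cos (aoa P p) ^ 2 = P / 2 := by
  have h0 : ∑ p : Fin P, Real.cos (2 * aoa P p) = 0 := by
    have h := sum_exp_eq P 2
    rw [if_neg (by intro h; have := Int.le_of_dvd (by norm_num) h; omega)] at h
    have h2 : ∑ p : Fin P, Complex.exp (Complex.I * ((2 * aoa P p : ℝ) : ℂ)) = 0 := by
      have : ∀ p : Fin P, Complex.exp (Complex.I * ((2 * aoa P p : ℝ) : ℂ)) =
          Complex.exp (Complex.I * ((4 * Real.pi / P : ℝ) : ℂ)) *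
          Complex.exp (Complex.I * ((2 * Real.pi * ((p : ℝ) * (2 : ℤ) / P) : ℝ) : ℂ)) := by
        intro p
        rw [← Complex.exp_add, aoa]
        congr 1
        push_cast
        ring
      simp_rw [this]
      rw [← Finset.mul_sum, h, mul_zero]
    have h3 := congrArg Complex.re h2
    rw [Complex.re_sum] at h3
    simpa only [mul_comm Complex.I, Complex.exp_ofReal_mul_I_re, Complex.zero_re] using h3
  have : ∀ p : Fin P, Real.cos (aoa P p) ^ 2 = 1 / 2 + Real.cos (2 * aoa P p) / 2 := fun p =>
    Real.cos_sq _
  simp_rw [this]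
  rw [Finset.sum_add_distrib, ← Finset.sum_div Finset.univ (fun p => Real.cos (2 * aoa P p)), h0]
  simp
  ring

/-- `|cos θ| > 1 - δ` forces `|sin θ| ≤ √(2δ)`, so `θ` is close to one of `0, π, 2π`. Each of the
three windows contains few of the equidistant angles. -/
lemma card_extreme_directions_le {δ : ℝ} (hδ : 0 < δ) :
    ((Finset.univ.filter fun p : Fin P => 1 - δ < |Real.cos (aoa P p)|).card : ℝ) ≤
      3 * (√(2 * δ) / 2 * P + 1) := by
  rcases Nat.eq_zero_or_pos P with rfl | hP
  · simp
  have hP' : (0 : ℝ) < P := by exact_mod_cast hP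
  set η := √(2 * δ) with hη
  have hη0 : 0 ≤ η := Real.sqrt_nonneg _
  have hsub : (Finset.univ.filter fun p : Fin P => 1 - δ < |Real.cos (aoa P p)|) ⊆
      (Finset.range 3).biUnion fun k => Finset.univ.filter fun p : Fin P =>
        |(p : ℝ) - (k * P / 2 - 1)| ≤ η / 4 * P := by
    intro p hp
    have hp' := (Finset.mem_filter.1 hp).2
    have hsin : |Real.sin (aoa P p)| ≤ η := by
      refine Real.le_sqrt_of_sq_le ?_
      rw [sq_abs, Real.sin_sq, ← sq_abs (Real.cos _)]
      have := Real.abs_cos_le_one (aoa P p)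
      nlinarith [abs_nonneg (Real.cos (aoa P p))]
    -- `y = θ / π`, and `k` below is a nearest integer, so that the linear lower bound for the sine
    -- applies on `|y - k| ≤ 1/2`.
    set y : ℝ := 2 * ((p : ℝ) + 1) / P with hy
    have hy0 : 0 ≤ y := by positivity
    have hy2 : y ≤ 2 := by
      rw [hy, div_le_iff₀ hP']
      have : (p : ℝ) + 1 ≤ P := by exact_mod_cast p.2
      linarith
    obtain ⟨k, hk3, hk⟩ : ∃ k : ℕ, k < 3 ∧ |y - k| ≤ 1 / 2 := by
      rcases le_total y (1 / 2) with h | h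
      · exact ⟨0, by norm_num, by rw [abs_le]; constructor <;> push_cast <;> linarith⟩
      · rcases le_total y (3 / 2) with h' | h'
        · exact ⟨1, by norm_num, by rw [abs_le]; constructor <;> push_cast <;> linarith⟩
        · exact ⟨2, by norm_num, by rw [abs_le]; constructor <;> push_cast <;> linarith⟩
    refine Finset.mem_biUnion.2 ⟨k, Finset.mem_range.2 hk3, Finset.mem_filter.2
      ⟨Finset.mem_univ _, ?_⟩⟩
    have h1 : |Real.sin (aoa P p)| = |Real.sin (Real.pi * (y - k))| := by
      have : Real.pi * (y - k) = aoa P p - k * Real.pi := by rw [aoa, hy]; ring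
      rw [this, Real.sin_sub_nat_mul_pi, abs_mul, abs_pow, abs_neg, abs_one, one_pow, one_mul]
    have h2 := abs_mul_le_abs_sin (ρ := 1 / 2) (t := y - k) (by norm_num) (by norm_num) hk
    rw [mul_one_div, Real.sin_pi_div_two, ← h1] at h2
    have h3 : |y - k| * 2 ≤ η := by
      refine le_trans (le_of_eq ?_) (h2.trans hsin); norm_num
    have h4 : (p : ℝ) - (k * P / 2 - 1) = (y - k) * (P / 2) := by rw [hy]; field_simp; ring
    rw [h4, abs_mul, abs_of_pos (by positivity : (0 : ℝ) < P / 2)]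
    nlinarith
  have h1 : ((Finset.univ.filter fun p : Fin P => 1 - δ < |Real.cos (aoa P p)|).card : ℝ) ≤ _ :=
    Nat.cast_le.2 ((Finset.card_le_card hsub).trans Finset.card_biUnion_le)
  refine h1.trans ?_
  push_cast
  refine (Finset.sum_le_card_nsmul _ _ (2 * (η / 4 * P) + 1) fun k _ =>
    card_filter_abs_sub_le P _ (by positivity)).trans (le_of_eq ?_)
  rw [Finset.card_range, nsmul_eq_mul]
  push_cast
  ring

/-- Bound on the mean energy that the beams outside the visible region collect. -/
def leak (dt : ℝ) (M P : ℕ) : ℝ :=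
  decay dt ^ 2 / √(M : ℝ) + 3 * (√(2 * (1 / √√(M : ℝ))) / 2 + 1 / P)

/-- A path within `δ = M^(-1/4)` of endfire may lose all its energy, but such paths are a small
fraction. Any other path is at distance at least `δ` from every invisible beam, so it loses at most
`M (decay dt / (M δ))² = decay dt ^ 2 / √M`. -/
lemma sum_kernel_not_beams_le (hdt : 0 < dt) (hdt' : dt < 1 / 2) (hM : 0 < M) (hP : 0 < P) :
    1 / (P : ℝ) * ∑ p : Fin P, ∑ r ∈ (beams M dt)ᶜ, ‖kernel M dt (Real.cos (aoa P p)) r‖ ^ 2 ≤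
      leak dt M P := by
  have hM' : (0 : ℝ) < M := by exact_mod_cast hM
  have hP' : (0 : ℝ) < P := by exact_mod_cast hP
  set δ : ℝ := 1 / √√(M : ℝ) with hδ
  have hδ0 : 0 < δ := by positivity
  have hδM : (M : ℝ) * δ ^ 2 = √(M : ℝ) := by
    rw [hδ, div_pow, Real.sq_sqrt (by positivity), one_pow, mul_one_div, Real.div_sqrt]
  have hp : ∀ p : Fin P, ∑ r ∈ (beams M dt)ᶜ, ‖kernel M dt (Real.cos (aoa P p)) r‖ ^ 2 ≤
      decay dt ^ 2 / √(M : ℝ) + if 1 - δ < |Real.cos (aoa P p)| then 1 else 0 := by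
    intro p
    split_ifs with h
    · have : ∑ r ∈ (beams M dt)ᶜ, ‖kernel M dt (Real.cos (aoa P p)) r‖ ^ 2 ≤ 1 := by
        rw [← sum_norm_kernel_sq hdt hM (Real.cos (aoa P p))]
        exact Finset.sum_le_sum_of_subset_of_nonneg (Finset.subset_univ _)
          fun _ _ _ => by positivity
      have h2 : 0 ≤ decay dt ^ 2 / √(M : ℝ) := by positivity
      linarith
    · rw [add_zero]
      have hb : ∀ r ∈ (beams M dt)ᶜ, ‖kernel M dt (Real.cos (aoa P p)) r‖ ^ 2 ≤
          (decay dt / M / δ) ^ 2 := by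
        intro r hr
        have hr' : 1 < |gridCos M dt r| := by
          simpa [beams] using hr
        have hd : δ ≤ |Real.cos (aoa P p) - gridCos M dt r| := by
          have := abs_sub_abs_le_abs_sub (gridCos M dt r) (Real.cos (aoa P p))
          rw [abs_sub_comm] at this
          linarith [not_lt.1 h]
        refine pow_le_pow_left₀ (norm_nonneg _) ?_ 2
        rw [le_div_iff₀ hδ0]
        exact (mul_le_mul_of_nonneg_left hd (norm_nonneg _)).trans
          (norm_kernel_mul_le hdt hdt' (Real.abs_cos_le_one _) r)
      refine (Finset.sum_le_card_nsmul _ _ _ hb).trans ?_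
      rw [nsmul_eq_mul]
      have hcard : ((beams M dt)ᶜ.card : ℝ) ≤ M := by
        exact_mod_cast (Finset.card_le_univ _).trans_eq (Fintype.card_fin M)
      calc _ ≤ (M : ℝ) * (decay dt / M / δ) ^ 2 := by gcongr
        _ = decay dt ^ 2 / (M * δ ^ 2) := by field_simp
        _ = _ := by rw [hδM]
  have h1 := Finset.sum_le_sum fun p (_ : p ∈ (Finset.univ : Finset (Fin P))) => hp p
  rw [Finset.sum_add_distrib, Finset.sum_const, Finset.card_univ, Fintype.card_fin, nsmul_eq_mul,
    Finset.sum_boole] at h1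
  have h2 := h1.trans (add_le_add le_rfl (card_extreme_directions_le (P := P) hδ0))
  rw [one_div_mul_eq_div, div_le_iff₀ hP', leak, ← hδ]
  refine h2.trans (le_of_eq ?_)
  field_simp

lemma leak_nonneg (dt : ℝ) (M P : ℕ) : 0 ≤ leak dt M P := by rw [leak]; positivity

lemma spread_nonneg (hdt : 0 < dt) (hdt' : dt < 1 / 2) (M : ℕ) : 0 ≤ spread dt M := by
  have := decay_pos hdt hdt'
  rw [spread]; positivity

lemma tendsto_leak {α : Type*} {F : Filter α} {m p : α → ℕ} (hm : Tendsto m F atTop)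
    (hp : Tendsto p F atTop) (dt : ℝ) : Tendsto (fun a => leak dt (m a) (p a)) F (𝓝 0) := by
  have hs : Tendsto (fun a => √(m a : ℝ)) F atTop :=
    Real.tendsto_sqrt_atTop.comp (tendsto_natCast_atTop_atTop.comp hm)
  have hss : Tendsto (fun a => √√(m a : ℝ)) F atTop := Real.tendsto_sqrt_atTop.comp hs
  have hpp : Tendsto (fun a => (p a : ℝ)) F atTop := tendsto_natCast_atTop_atTop.comp hp
  have h := (hs.const_div_atTop (decay dt ^ 2)).add
    (((((hss.const_div_atTop 1).const_mul 2).sqrt.div_const 2).add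
      (hpp.const_div_atTop 1)).const_mul 3)
  simpa [leak] using h

/-- Averages over the beams are averages over the subpaths up to the leakage. -/
lemma abs_beamMean_sub_le (hdt : 0 < dt) (hdt' : dt < 1 / 2) (hM : 0 < M) (hP : 0 < P)
    {F : ℝ → ℝ → ℝ} {G : ℝ → ℝ} {K K' : ℝ} (hK' : 0 ≤ K')
    (hF : ∀ c γ, |c| ≤ 1 → |γ| ≤ 1 → |F c γ - G c| ≤ K * |c - γ|) (hG : ∀ c, |c| ≤ 1 → |G c| ≤ K')
    (hK : 0 ≤ K) :
    |beamMean M P dt F - 1 / (P : ℝ) * ∑ p : Fin P, G (Real.cos (aoa P p))| ≤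
      K * spread dt M + K' * leak dt M P := by
  have hP' : (0 : ℝ) < P := by exact_mod_cast hP
  have hp : ∀ p : Fin P, |∑ r ∈ beams M dt, ‖kernel M dt (Real.cos (aoa P p)) r‖ ^ 2 *
      F (Real.cos (aoa P p)) (gridCos M dt r) - G (Real.cos (aoa P p))| ≤
      K * spread dt M + K' * ∑ r ∈ (beams M dt)ᶜ, ‖kernel M dt (Real.cos (aoa P p)) r‖ ^ 2 := by
    intro p
    set c := Real.cos (aoa P p)
    have hc : |c| ≤ 1 := Real.abs_cos_le_one _
    have hsum := sum_norm_kernel_sq hdt hM c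
    rw [← Finset.sum_add_sum_compl (beams M dt)] at hsum
    -- By Parseval, `G c` splits into a part carried by the visible beams and a leaked part.
    have e : ∑ r ∈ beams M dt, ‖kernel M dt c r‖ ^ 2 * F c (gridCos M dt r) - G c =
        ∑ r ∈ beams M dt, ‖kernel M dt c r‖ ^ 2 * (F c (gridCos M dt r) - G c) -
          G c * ∑ r ∈ (beams M dt)ᶜ, ‖kernel M dt c r‖ ^ 2 := by
      simp_rw [mul_sub]
      rw [Finset.sum_sub_distrib, ← Finset.sum_mul]
      linear_combination G c * hsum
    rw [e]
    refine (abs_sub _ _).trans (add_le_add ?_ ?_)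
    · refine (Finset.abs_sum_le_sum_abs _ _).trans ?_
      calc ∑ r ∈ beams M dt, |‖kernel M dt c r‖ ^ 2 * (F c (gridCos M dt r) - G c)|
          ≤ ∑ r ∈ beams M dt, K * (‖kernel M dt c r‖ ^ 2 * |c - gridCos M dt r|) := by
            refine Finset.sum_le_sum fun r hr => ?_
            rw [abs_mul, abs_of_nonneg (by positivity)]
            have := mul_le_mul_of_nonneg_left (hF c _ hc (Finset.mem_filter.1 hr).2)
              (sq_nonneg ‖kernel M dt c r‖)
            linarith
        _ ≤ ∑ r, K * (‖kernel M dt c r‖ ^ 2 * |c - gridCos M dt r|) :=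
            Finset.sum_le_sum_of_subset_of_nonneg (Finset.subset_univ _)
              fun _ _ _ => by positivity
        _ ≤ K * spread dt M := by
            rw [← Finset.mul_sum]
            exact mul_le_mul_of_nonneg_left (sum_kernel_mul_abs_le hdt hdt' hM hc) hK
    · have h0 : 0 ≤ ∑ r ∈ (beams M dt)ᶜ, ‖kernel M dt c r‖ ^ 2 :=
        Finset.sum_nonneg fun _ _ => by positivity
      rw [abs_mul, abs_of_nonneg h0]
      exact mul_le_mul_of_nonneg_right (hG c hc) h0
  rw [beamMean, ← mul_sub, ← Finset.sum_sub_distrib, abs_mul, abs_of_pos (by positivity)]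
  have h1 := (Finset.abs_sum_le_sum_abs _ _).trans (Finset.sum_le_sum fun p
    (_ : p ∈ (Finset.univ : Finset (Fin P))) => hp p)
  rw [Finset.sum_add_distrib, Finset.sum_const, Finset.card_univ, Fintype.card_fin, nsmul_eq_mul,
    ← Finset.mul_sum] at h1
  have h2 := mul_le_mul_of_nonneg_left h1 (by positivity : (0 : ℝ) ≤ 1 / P)
  refine h2.trans ?_
  have h3 := mul_le_mul_of_nonneg_left (sum_kernel_not_beams_le hdt hdt' hM hP) hK'
  have e : 1 / (P : ℝ) * (P * (K * spread dt M)) = K * spread dt M := by field_simp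
  rw [mul_add, e]
  linarith

variable {L N : ℕ}

/-! ### Columns of the pilot matrix -/

/-- Matrix that maps the pilot block to the `l`-th column of `B`. -/
def colMatrix (N : ℕ) {L : ℕ} (l : Fin L) (n k : Fin N) : ℂ :=
  ((√(N : ℝ) : ℝ) : ℂ) * star (dftColumns N N k n) * dftColumns N L k l

lemma col_apply (x : Fin N → ℂ) (l : Fin L) (n : Fin N) :
    col L x l n = ∑ k, colMatrix N l n k * x k := by
  rw [col, pilotMatrix]
  simp only [Matrix.smul_apply]
  rw [Matrix.mul_apply, smul_eq_mul, Finset.mul_sum]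
  refine Finset.sum_congr rfl fun k _ => ?_
  rw [colMatrix, Matrix.mul_diagonal, Matrix.conjTranspose_apply]
  ring

lemma star_dftColumns_mul (k k' : Fin N) {L L' : ℕ} (l : Fin L) (l' : Fin L') :
    star (dftColumns N L k l) * dftColumns N L' k' l' = 1 / (N : ℂ) * Complex.exp (Complex.I *
      ((2 * Real.pi * (((k : ℝ) * l - k' * l') / N) : ℝ) : ℂ)) := by
  have hN : ((√(N : ℝ) : ℝ) : ℂ) * ((√(N : ℝ) : ℝ) : ℂ) = N := by
    rw [← Complex.ofReal_mul, Real.mul_self_sqrt (Nat.cast_nonneg N)]; simp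
  rw [dftColumns, dftColumns, Matrix.of_apply, Matrix.of_apply, star_div₀, Complex.star_def,
    ← Complex.exp_conj, Complex.conj_ofReal, div_mul_div_comm, hN,
    ← Complex.exp_add, one_div_mul_eq_div]
  congr 2
  simp only [map_neg, map_mul, Complex.conj_I, Complex.conj_ofReal]
  push_cast
  ring

lemma sum_star_dftColumns_mul (k k' : Fin N) :
    ∑ n, star (dftColumns N N k n) * dftColumns N N k' n = if k = k' then 1 else 0 := by
  have : ∀ n : Fin N, 2 * Real.pi * (((k : ℝ) * n - k' * n) / N) =
      2 * Real.pi * ((n : ℝ) * (((k : ℤ) - k' : ℤ) : ℝ) / N) := by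
    intro n; push_cast; ring
  simp_rw [star_dftColumns_mul, this]
  rw [← Finset.mul_sum, sum_exp_eq]
  simp_rw [fin_dvd_sub_iff]
  have hN : (N : ℂ) ≠ 0 := by exact_mod_cast (Fin.pos k).ne'
  split_ifs
  · field_simp
  · simp

/-- The map from pilot to column is `√N Fᴴ` times a diagonal matrix with entries of modulus
`N^(-1/2)`, hence unitary. Every column of `B` thus carries the whole pilot power. -/
lemma sum_star_colMatrix_mul (l : Fin L) (k k' : Fin N) :
    ∑ n, star (colMatrix N l n k) * colMatrix N l n k' = if k = k' then ((1 : ℝ) : ℂ) else 0 := by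
  have hN : ((√(N : ℝ) : ℝ) : ℂ) * ((√(N : ℝ) : ℝ) : ℂ) = N := by
    rw [← Complex.ofReal_mul, Real.mul_self_sqrt (Nat.cast_nonneg N)]; simp
  have hN0 : (N : ℂ) ≠ 0 := by exact_mod_cast (Fin.pos k).ne'
  have : ∀ n, star (colMatrix N l n k) * colMatrix N l n k' =
      N * (star (dftColumns N L k l) * dftColumns N L k' l) *
        (star (dftColumns N N k' n) * dftColumns N N k n) := by
    intro n
    rw [colMatrix, colMatrix, star_mul', star_mul', star_star, ← hN]
    rw [show star ((√(N : ℝ) : ℝ) : ℂ) = ((√(N : ℝ) : ℝ) : ℂ) from Complex.conj_ofReal _]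
    ring
  simp_rw [this]
  rw [← Finset.mul_sum, sum_star_dftColumns_mul]
  split_ifs with h h' h'
  · subst h
    rw [star_dftColumns_mul]
    simp [hN0]
  · exact absurd h.symm h'
  · exact absurd h'.symm h
  · simp

/-- Total power of the pilot block. -/
def power (x : Fin N → ℂ) : ℝ := ∑ k, ‖x k‖ ^ 2

lemma norm_col_sq (x : Fin N → ℂ) (l : Fin L) : ‖col L x l‖ ^ 2 = power x := by
  rw [EuclideanSpace.norm_sq_eq, power]
  simp_rw [col_apply]
  rw [sum_norm_sq_of_orthogonal Finset.univ (fun n k => colMatrix N l n k) 1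
    (sum_star_colMatrix_mul l), one_mul]

lemma power_nonneg (x : Fin N → ℂ) : 0 ≤ power x := Finset.sum_nonneg fun _ _ => by positivity

/-! ### Lipschitz bounds for the profiles -/

section Bounds

variable {x : Fin N → ℂ} {v : EuclideanSpace ℂ (Fin N)}

/-- Subtracting `v` inside the projection changes nothing, and `E(t) v - v` is linear in `t`; this
is why the slope vanishes at zero offset. -/
lemma norm_perp_rot_le (hv : perp L x v = 0) (t : ℝ) :
    ‖perp L x (rot N t v)‖ ≤ 2 * Real.pi * |t| * ‖v‖ := by
  have : perp L x (rot N t v) = perp L x (rot N t v - v) := by rw [map_sub, hv, sub_zero]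
  rw [this]
  exact (norm_perp_le x _).trans (norm_rot_sub_le t v)

lemma norm_perp_gen_le (v : EuclideanSpace ℂ (Fin N)) :
    ‖perp L x (gen N v)‖ ≤ 2 * Real.pi * ‖v‖ :=
  (norm_perp_le x _).trans (norm_gen_le v)

lemma norm_comm_le (v : EuclideanSpace ℂ (Fin N)) : ‖comm L x v‖ ≤ 4 * Real.pi * ‖v‖ := by
  have h1 := norm_sub_le (gen N (perp L x v)) (perp L x (gen N v))
  have h2 := (norm_gen_le (perp L x v)).trans
    (mul_le_mul_of_nonneg_left (norm_perp_le x v) Real.two_pi_pos.le)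
  have h3 := norm_perp_gen_le (L := L) (x := x) v
  rw [comm]
  linarith

lemma abs_sq_sub_sq_le {a b d c : ℝ} (ha : 0 ≤ a) (hb : 0 ≤ b) (hd : |a - b| ≤ d) (hac : a ≤ c)
    (hbc : b ≤ c) : |a ^ 2 - b ^ 2| ≤ d * (2 * c) := by
  rw [sq_sub_sq, abs_mul, abs_of_nonneg (add_nonneg ha hb), mul_comm]
  exact mul_le_mul hd (by linarith) (by positivity) ((abs_nonneg _).trans hd)

lemma abs_slopeOf_le (hv : perp L x v = 0) (t : ℝ) :
    |slopeOf L x v t| ≤ 4 * Real.pi ^ 2 * |t| * ‖v‖ ^ 2 := by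
  refine (Complex.abs_re_le_norm _).trans ((norm_inner_le_norm _ _).trans ?_)
  have h1 := norm_perp_gen_le (L := L) (x := x) (rot N t v)
  rw [norm_rot] at h1
  calc _ ≤ (2 * Real.pi * |t| * ‖v‖) * (2 * Real.pi * ‖v‖) :=
        mul_le_mul (norm_perp_rot_le hv t) h1 (norm_nonneg _) (by positivity)
    _ = _ := by ring

/-- The term with the second derivative contains the small factor `P E(t) v` and contributes 8; the
Lipschitz bound for `‖P D E(t) v‖²` contributes 16. -/
lemma abs_curvatureOf_sub_le (hv : perp L x v = 0) (t : ℝ) :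
    |curvatureOf L x v t - ‖perp L x (gen N v)‖ ^ 2| ≤ 24 * Real.pi ^ 3 * |t| * ‖v‖ ^ 2 := by
  have h1 : |(inner ℂ (perp L x (rot N t v)) (perp L x (gen N (gen N (rot N t v))))).re| ≤
      8 * Real.pi ^ 3 * |t| * ‖v‖ ^ 2 := by
    refine (Complex.abs_re_le_norm _).trans ((norm_inner_le_norm _ _).trans ?_)
    have h1 := (norm_perp_gen_le (L := L) (x := x) (gen N (rot N t v))).trans
      (mul_le_mul_of_nonneg_left (norm_gen_le _) Real.two_pi_pos.le)
    rw [norm_rot] at h1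
    calc _ ≤ (2 * Real.pi * |t| * ‖v‖) * (2 * Real.pi * (2 * Real.pi * ‖v‖)) :=
          mul_le_mul (norm_perp_rot_le hv t) h1 (norm_nonneg _) (by positivity)
      _ = _ := by ring
  have h2 : |‖perp L x (gen N (rot N t v))‖ ^ 2 - ‖perp L x (gen N v)‖ ^ 2| ≤
      16 * Real.pi ^ 3 * |t| * ‖v‖ ^ 2 := by
    have h3 := norm_perp_gen_le (L := L) (x := x) (rot N t v)
    rw [norm_rot] at h3
    refine (abs_sq_sub_sq_le (norm_nonneg _) (norm_nonneg _) ((abs_norm_sub_norm_le _ _).trans ?_)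
      h3 (norm_perp_gen_le v)).trans_eq (?_ : 4 * Real.pi ^ 2 * |t| * ‖v‖ * _ = _)
    · rw [← map_sub, ← map_sub]
      refine (norm_perp_gen_le _).trans ?_
      have := mul_le_mul_of_nonneg_left (norm_rot_sub_le t v) Real.two_pi_pos.le
      linarith
    · ring
  rw [curvatureOf, add_sub_assoc]
  refine (abs_add_le _ _).trans ?_
  linarith

/-- On a vector annihilated by `P` the commutator reduces to `-P D v`, so noise and curvature share
the same value at zero offset. -/
lemma abs_norm_comm_rot_sq_sub_le (hv : perp L x v = 0) (t : ℝ) :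
    |‖comm L x (rot N t v)‖ ^ 2 - ‖perp L x (gen N v)‖ ^ 2| ≤ 64 * Real.pi ^ 3 * |t| * ‖v‖ ^ 2 := by
  have h0 : ‖perp L x (gen N v)‖ = ‖comm L x v‖ := by
    rw [comm, hv, map_zero, zero_sub, norm_neg]
  have h3 := norm_comm_le (L := L) (x := x) (rot N t v)
  rw [norm_rot] at h3
  rw [h0]
  refine (abs_sq_sub_sq_le (norm_nonneg _) (norm_nonneg _) ((abs_norm_sub_norm_le _ _).trans ?_)
    h3 (norm_comm_le v)).trans_eq (?_ : 8 * Real.pi ^ 2 * |t| * ‖v‖ * _ = _)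
  · have : comm L x (rot N t v) - comm L x v = comm L x (rot N t v - v) := by
      simp only [comm, map_sub]; abel
    rw [this]
    refine (norm_comm_le _).trans ?_
    have := mul_le_mul_of_nonneg_left (norm_rot_sub_le t v) Real.two_pi_pos.le
    linarith
  · ring

end Bounds

/-! ### Asymptotics of the moments of the derivatives -/

section Asymptotics

variable {pdp : Fin L → ℝ≥0}

lemma abs_tapMean_le (hpdp : ∑ l, pdp l = 1) {F : Fin L → ℝ} {K : ℝ} (h : ∀ l, |F l| ≤ K) :
    |tapMean pdp F| ≤ K := by
  have h1 : ∑ l, (pdp l : ℝ) = 1 := by exact_mod_cast congrArg ((↑) : ℝ≥0 → ℝ) hpdp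
  calc |tapMean pdp F| ≤ ∑ l, |(pdp l : ℝ) * F l| := Finset.abs_sum_le_sum_abs _ _
    _ ≤ ∑ l, (pdp l : ℝ) * K := Finset.sum_le_sum fun l _ => by
        rw [abs_mul, abs_of_nonneg (pdp l).coe_nonneg]
        exact mul_le_mul_of_nonneg_left (h l) (pdp l).2
    _ = K := by rw [← Finset.sum_mul, h1, one_mul]

lemma tapMean_sub (F G : Fin L → ℝ) :
    tapMean pdp F - tapMean pdp G = tapMean pdp fun l => F l - G l := by
  simp only [tapMean, mul_sub, Finset.sum_sub_distrib]

lemma tapMean_const_mul (a : ℝ) (F : Fin L → ℝ) :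
    tapMean pdp (fun l => a * F l) = a * tapMean pdp F := by
  simp only [tapMean, Finset.mul_sum]
  exact Finset.sum_congr rfl fun l _ => by ring

variable (pdp) in
/-- Information of the pilot on a frequency offset: mean energy of the part of `D b_l` that is
orthogonal to the pilot span. -/
def information (x : Fin N → ℂ) : ℝ := tapMean pdp fun l => ‖perp L x (gen N (col L x l))‖ ^ 2

lemma information_pos {x : Fin N → ℂ} (h : Informative pdp x) : 0 < information pdp x := by
  obtain ⟨l, hl, hmem⟩ := h
  refine Finset.sum_pos' (fun l _ => mul_nonneg (pdp l).coe_nonneg (by positivity))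
    ⟨l, Finset.mem_univ _, ?_⟩
  refine mul_pos hl (pow_pos (norm_pos_iff.2 fun h0 => hmem ?_) 2)
  rw [perp_eq_zero, gen, col, Matrix.toEuclideanCLM_toLp] at h0
  exact h0

lemma norm_perp_gen_col_sq_le (x : Fin N → ℂ) (l : Fin L) :
    ‖perp L x (gen N (col L x l))‖ ^ 2 ≤ 4 * Real.pi ^ 2 * power x := by
  have := pow_le_pow_left₀ (norm_nonneg _) (norm_perp_gen_le (L := L) (x := x) (col L x l)) 2
  rw [mul_pow, norm_col_sq] at this
  linarith

/-- Common Lipschitz constant of the profiles of a pilot of unit power. -/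
def lip (fd : ℝ) : ℝ := 64 * Real.pi ^ 3 * |fd| + 16 * Real.pi ^ 2

lemma lip_nonneg (fd : ℝ) : 0 ≤ lip fd := by rw [lip]; positivity

/-- Admissible sensitivities of the trial offset of a beam, as functions of its direction cosine. -/
structure IsSensitivity (A : ℝ → ℝ) (κ : ℝ) : Prop where
  abs_le_one : ∀ γ, |γ| ≤ 1 → |A γ| ≤ 1
  abs_sq_sub_le : ∀ c γ, |c| ≤ 1 → |γ| ≤ 1 → |A γ ^ 2 - A c ^ 2| ≤ 2 * |c - γ|
  mean_sq : ∀ P : ℕ, 3 ≤ P → 1 / (P : ℝ) * ∑ p : Fin P, A (Real.cos (aoa P p)) ^ 2 = κ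

lemma isSensitivity_one : IsSensitivity (fun _ => 1) 1 where
  abs_le_one _ _ := by simp
  abs_sq_sub_le _ _ _ _ := by simp
  mean_sq P hP := by
    have : (P : ℝ) ≠ 0 := by positivity
    simp [this]

lemma isSensitivity_id : IsSensitivity (fun γ => γ) (1 / 2) where
  abs_le_one _ h := h
  abs_sq_sub_le c γ hc hγ := by
    rw [sq_sub_sq, abs_mul, abs_sub_comm γ c]
    exact mul_le_mul_of_nonneg_right ((abs_add_le _ _).trans (by linarith)) (abs_nonneg _)
  mean_sq P hP := by
    have : (P : ℝ) ≠ 0 := by positivity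
    rw [sum_cos_aoa_sq hP]
    field_simp

variable {A : ℝ → ℝ} {κ : ℝ} (hA : IsSensitivity A κ) (hpdp : ∑ l, pdp l = 1)
  {dt : ℝ} (hdt : 0 < dt) (hdt' : dt < 1 / 2) (fd : ℝ) {M P : ℕ} (hM : 0 < M)
  (x : Fin N → ℂ)

include hA hpdp hdt hdt' hM

/-- Comparing with the zero profile avoids any leakage term. This matters because `leak` is only
`O(M^(-1/8) + 1/P)`, too large for the `o(M^(-1/2))` that the floors require. -/
lemma abs_beamMean_slope_le (hP : 0 < P) :
    |beamMean M P dt fun c γ => tapMean pdp fun l =>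
      -A γ * (2 * slopeOf L x (col L x l) (fd * (c - γ)))| ≤ lip fd * power x * spread dt M := by
  have h := abs_beamMean_sub_le (F := fun c γ => tapMean pdp fun l =>
      -A γ * (2 * slopeOf L x (col L x l) (fd * (c - γ)))) (G := fun _ => 0)
    (K := lip fd * power x) (K' := 0) hdt hdt' hM hP le_rfl
    (fun c γ _ hγ => ?_) (fun _ _ => by simp) (mul_nonneg (lip_nonneg _) (power_nonneg _))
  · simpa using h
  rw [sub_zero]
  refine abs_tapMean_le hpdp fun l => ?_
  have h1 := abs_slopeOf_le (perp_col x l) (fd * (c - γ))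
  rw [norm_col_sq, abs_mul] at h1
  rw [abs_mul, abs_neg, abs_mul, abs_two]
  have h2 : 2 * (4 * Real.pi ^ 2 * (|fd| * |c - γ|) * power x) ≤
      lip fd * power x * |c - γ| := by
    have hπ := Real.pi_gt_three
    have : 8 * Real.pi ^ 2 * |fd| ≤ lip fd := by
      rw [lip]
      have : 0 ≤ Real.pi ^ 2 * |fd| := by positivity
      nlinarith [sq_nonneg Real.pi]
    have h3 := mul_le_mul_of_nonneg_right this
      (mul_nonneg (power_nonneg x) (abs_nonneg (c - γ)))
    linarith
  have h4 := mul_le_mul (hA.abs_le_one γ hγ)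
    (mul_le_mul_of_nonneg_left h1 (by norm_num : (0 : ℝ) ≤ 2)) (by positivity) (by norm_num)
  linarith

omit hpdp hdt hdt' hM in
lemma abs_sensitivity_mul_sub_le {c γ y z d b : ℝ} (hc : |c| ≤ 1) (hγ : |γ| ≤ 1)
    (hyz : |y - z| ≤ d) (hz : |z| ≤ b) : |A γ ^ 2 * y - A c ^ 2 * z| ≤ d + 2 * |c - γ| * b := by
  have e : A γ ^ 2 * y - A c ^ 2 * z = A γ ^ 2 * (y - z) + (A γ ^ 2 - A c ^ 2) * z := by ring
  rw [e]
  refine (abs_add_le _ _).trans (add_le_add ?_ ?_)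
  · rw [abs_mul, abs_pow]
    exact (mul_le_of_le_one_left (abs_nonneg _)
      (pow_le_one₀ (abs_nonneg _) (hA.abs_le_one γ hγ))).trans hyz
  · rw [abs_mul]
    exact mul_le_mul (hA.abs_sq_sub_le c γ hc hγ) hz (abs_nonneg _) (by positivity)

/-- A profile that is Lipschitz at the origin is averaged over the beams as if all energy arrived
from the look directions. -/
lemma abs_beamMean_profile_sub_le (hP : 3 ≤ P) {y : Fin L → ℝ → ℝ} {z : Fin L → ℝ} {b : ℝ}
    (hyz : ∀ l t, |y l t - z l| ≤ 64 * Real.pi ^ 3 * |t| * power x)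
    (hz : ∀ l, |z l| ≤ 8 * Real.pi ^ 2 * power x) (hb : tapMean pdp z = b) :
    |(beamMean M P dt fun c γ => tapMean pdp fun l => A γ ^ 2 * y l (fd * (c - γ))) - κ * b| ≤
      lip fd * power x * (spread dt M + leak dt M P) := by
  have hpow := power_nonneg x
  have h := abs_beamMean_sub_le (F := fun c γ => tapMean pdp fun l => A γ ^ 2 * y l (fd * (c - γ)))
    (G := fun c => A c ^ 2 * b) (P := P) (K := lip fd * power x) (K' := lip fd * power x)
    hdt hdt' hM (by omega) (mul_nonneg (lip_nonneg _) hpow)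
    (fun c γ hc hγ => ?_) (fun c hc => ?_) (mul_nonneg (lip_nonneg _) hpow)
  · rw [← Finset.sum_mul, ← mul_assoc, hA.mean_sq P hP] at h
    linarith
  · rw [← hb, ← tapMean_const_mul, tapMean_sub]
    refine abs_tapMean_le hpdp fun l => ?_
    have h1 := hyz l (fd * (c - γ))
    -- The two parts of `lip` appear here: `64 π³ |fd|` from the profile and `16 π² = 2 · 8 π²` from
    -- the variation of `A²`.
    refine (abs_sensitivity_mul_sub_le hA hc hγ h1 (hz l)).trans (le_of_eq ?_)
    rw [abs_mul, lip]
    ring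
  · rw [← hb, ← tapMean_const_mul]
    refine abs_tapMean_le hpdp fun l => ?_
    rw [abs_mul, abs_pow]
    refine (mul_le_of_le_one_left (abs_nonneg _)
      (pow_le_one₀ (abs_nonneg _) (hA.abs_le_one c hc))).trans ((hz l).trans ?_)
    refine mul_le_mul_of_nonneg_right ?_ hpow
    rw [lip]
    have : 0 ≤ 64 * Real.pi ^ 3 * |fd| := by positivity
    nlinarith [sq_nonneg Real.pi]

lemma abs_beamMean_curvature_sub_le (hP : 3 ≤ P) :
    |(beamMean M P dt fun c γ => tapMean pdp fun l =>
      A γ ^ 2 * (2 * curvatureOf L x (col L x l) (fd * (c - γ)))) - κ * (2 * information pdp x)| ≤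
      lip fd * power x * (spread dt M + leak dt M P) := by
  refine abs_beamMean_profile_sub_le hA hpdp hdt hdt' fd hM x hP
    (y := fun l t => 2 * curvatureOf L x (col L x l) t)
    (z := fun l => 2 * ‖perp L x (gen N (col L x l))‖ ^ 2) (fun l t => ?_) (fun l => ?_)
    (tapMean_const_mul _ _)
  · have := abs_curvatureOf_sub_le (perp_col x l) t
    rw [norm_col_sq] at this
    rw [← mul_sub, abs_mul, abs_two]
    have h0 : 0 ≤ Real.pi ^ 3 * |t| * power x := mul_nonneg (by positivity) (power_nonneg x)
    linarith
  · rw [abs_of_nonneg (by positivity)]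
    linarith [norm_perp_gen_col_sq_le x l]

lemma abs_beamMean_noise_sub_le (hP : 3 ≤ P) :
    |(beamMean M P dt fun c γ => tapMean pdp fun l =>
      A γ ^ 2 * ‖comm L x (rot N (fd * (c - γ)) (col L x l))‖ ^ 2) - κ * information pdp x| ≤
      lip fd * power x * (spread dt M + leak dt M P) := by
  refine abs_beamMean_profile_sub_le hA hpdp hdt hdt' fd hM x hP
    (y := fun l t => ‖comm L x (rot N t (col L x l))‖ ^ 2)
    (z := fun l => ‖perp L x (gen N (col L x l))‖ ^ 2) (fun l t => ?_) (fun l => ?_) rfl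
  · have := abs_norm_comm_rot_sq_sub_le (perp_col x l) t
    rwa [norm_col_sq] at this
  · rw [abs_of_nonneg (by positivity)]
    have := mul_nonneg (sq_nonneg Real.pi) (power_nonneg x)
    linarith [norm_perp_gen_col_sq_le x l]

end Asymptotics

/-! ### Limits of the MSEs along a regime -/

lemma tendsto_div_of_abs_sub_le {α : Type*} {F : Filter α} {u w q e n : α → ℝ} {c C ℓ : ℝ}
    (hc : 0 ≤ c) (hn : ∀ᶠ a in F, 0 < n a) (h : ∀ᶠ a in F, |u a - w a| ≤ c * q a * e a)
    (hq : ∀ᶠ a in F, q a ≤ C * n a) (he0 : ∀ a, 0 ≤ e a) (he : Tendsto e F (𝓝 0))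
    (hw : Tendsto (fun a => w a / n a) F (𝓝 ℓ)) : Tendsto (fun a => u a / n a) F (𝓝 ℓ) := by
  have h0 : Tendsto (fun a => u a / n a - w a / n a) F (𝓝 0) := by
    refine squeeze_zero_norm' (a := fun a => c * C * e a) ?_ (by simpa using he.const_mul (c * C))
    filter_upwards [hn, h, hq] with a hn h hq
    rw [← sub_div, Real.norm_eq_abs, abs_div, abs_of_pos hn, div_le_iff₀ hn]
    have := mul_le_mul_of_nonneg_right (mul_le_mul_of_nonneg_left hq hc) (he0 a)
    linarith
  simpa using h0.add hw

variable {L : ℕ}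

/-- A family of experiments in which `m a` antennas, `p a` subpaths and the pilot `x a` are used,
such that the information of the pilot grows like `γ₀ * n a` and its power is `O(n a)`. -/
structure Regime {α : Type*} (F : Filter α) (pdp : Fin L → ℝ≥0) (m p N : α → ℕ)
    (x : ∀ a, Fin (N a) → ℂ) (n : α → ℝ) (γ₀ : ℝ) : Prop where
  antennas : Tendsto m F atTop
  subpaths : Tendsto p F atTop
  scale_pos : ∀ᶠ a in F, 0 < n a
  pos : 0 < γ₀
  information : Tendsto (fun a => information pdp (x a) / n a) F (𝓝 γ₀)
  power : ∃ C, ∀ᶠ a in F, power (x a) ≤ C * n a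

namespace Regime

variable {α : Type*} {F : Filter α} {pdp : Fin L → ℝ≥0} {m p N : α → ℕ}
  {x : ∀ a, Fin (N a) → ℂ} {n : α → ℝ} {γ₀ : ℝ} {dt : ℝ} {A B f e : ℝ → ℝ} {κ : ℝ}

section Line

variable (h : Regime F pdp m p N x n γ₀) (hpdp : ∑ l, pdp l = 1) (hdt : 0 < dt)
  (hdt' : dt < 1 / 2) (fd xi : ℝ) (s : ℝ≥0) (hA : IsSensitivity A κ)
  (hfe : ∀ u γ, f u * γ + e u = u * A γ + B γ) {u₀ : ℝ}
  (hu₀ : ∀ γ, u₀ * A γ + B γ = fd * γ + xi)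

include h hpdp hdt hdt' hA hfe hu₀

lemma tendsto_slope : Tendsto (fun a => √(m a : ℝ) * (∫ ω, deriv
    (fun u => g0 (x a) dt fd xi (m a) (p a) ω.1 (f u) (e u)) u₀ ∂(law pdp s (N a) (m a) (p a))) /
    n a) F (𝓝 0) := by
  obtain ⟨C, hC⟩ := h.power
  refine tendsto_div_of_abs_sub_le (w := fun _ => 0) (e := fun a => √(m a : ℝ) * spread dt (m a))
    (q := fun a => JointCFO.power (x a)) (lip_nonneg fd) h.scale_pos ?_ hC
    (fun a => mul_nonneg (Real.sqrt_nonneg _) (spread_nonneg hdt hdt' _))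
    ((tendsto_sqrt_mul_spread dt).comp h.antennas) (by simpa using tendsto_const_nhds)
  filter_upwards [h.antennas.eventually_gt_atTop 0, h.subpaths.eventually_gt_atTop 0] with a hm hp
  rw [sub_zero, integral_deriv_g0 (x a) pdp dt fd xi s (m a) (p a) hfe hu₀, abs_mul,
    abs_of_nonneg (Real.sqrt_nonneg _)]
  have := mul_le_mul_of_nonneg_left
    (abs_beamMean_slope_le hA hpdp hdt hdt' fd hm (x a) hp) (Real.sqrt_nonneg (m a : ℝ))
  linarith

lemma tendsto_curvature : Tendsto (fun a => (∫ ω, iteratedDeriv 2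
    (fun u => g0 (x a) dt fd xi (m a) (p a) ω.1 (f u) (e u)) u₀ ∂(law pdp s (N a) (m a) (p a))) /
    n a) F (𝓝 (2 * κ * γ₀)) := by
  obtain ⟨C, hC⟩ := h.power
  refine tendsto_div_of_abs_sub_le (w := fun a => κ * (2 * JointCFO.information pdp (x a)))
    (e := fun a => spread dt (m a) + leak dt (m a) (p a)) (q := fun a => JointCFO.power (x a))
    (lip_nonneg fd) h.scale_pos ?_ hC
    (fun a => add_nonneg (spread_nonneg hdt hdt' _) (leak_nonneg _ _ _)) ?_ ?_
  · filter_upwards [h.antennas.eventually_gt_atTop 0, h.subpaths.eventually_ge_atTop 3] with a hm hp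
    rw [integral_deriv_deriv_g0 (x a) pdp dt fd xi s (m a) (p a) hfe hu₀]
    exact abs_beamMean_curvature_sub_le hA hpdp hdt hdt' fd hm (x a) hp
  · simpa using ((tendsto_spread dt).comp h.antennas).add (tendsto_leak h.antennas h.subpaths dt)
  · refine (h.information.const_mul (2 * κ)).congr fun a => ?_
    ring

lemma tendsto_noise : Tendsto (fun a => (m a : ℝ) * (∫ ω,
    (deriv (fun u => gn (x a) dt fd xi (m a) (p a) ω.1 ω.2 (f u) (e u)) u₀) ^ 2
      ∂(law pdp s (N a) (m a) (p a))) / n a) F (𝓝 (2 * s * κ * γ₀)) := by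
  obtain ⟨C, hC⟩ := h.power
  have h1 : Tendsto (fun a => (beamMean (m a) (p a) dt fun c γ => tapMean pdp fun l =>
      A γ ^ 2 * ‖comm L (x a) (rot (N a) (fd * (c - γ)) (col L (x a) l))‖ ^ 2) / n a) F
      (𝓝 (κ * γ₀)) := by
    refine tendsto_div_of_abs_sub_le (w := fun a => κ * JointCFO.information pdp (x a))
      (e := fun a => spread dt (m a) + leak dt (m a) (p a)) (q := fun a => JointCFO.power (x a))
      (lip_nonneg fd) h.scale_pos ?_ hC
      (fun a => add_nonneg (spread_nonneg hdt hdt' _) (leak_nonneg _ _ _)) ?_ ?_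
    · filter_upwards [h.antennas.eventually_gt_atTop 0, h.subpaths.eventually_ge_atTop 3]
        with a hm hp
      exact abs_beamMean_noise_sub_le hA hpdp hdt hdt' fd hm (x a) hp
    · simpa using ((tendsto_spread dt).comp h.antennas).add
        (tendsto_leak h.antennas h.subpaths dt)
    · refine (h.information.const_mul κ).congr fun a => ?_
      ring
  have h2 := h1.const_mul (2 * (s : ℝ))
  rw [← mul_assoc] at h2
  refine h2.congr' ?_
  filter_upwards [h.antennas.eventually_gt_atTop 0] with a hm
  have hm' : (m a : ℝ) ≠ 0 := by exact_mod_cast hm.ne'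
  rw [integral_sq_deriv_gn (x a) pdp dt fd xi s (m a) (p a) hfe hu₀ hdt]
  field_simp

end Line

variable (h : Regime F pdp m p N x n γ₀) (hpdp : ∑ l, pdp l = 1) (hdt : 0 < dt)
  (hdt' : dt < 1 / 2) (fd xi : ℝ) (s : ℝ≥0)
include h

lemma tendsto_ratio {u k : α → ℝ} {ℓ c : ℝ} (hc : c ≠ 0)
    (hu : Tendsto (fun a => (m a : ℝ) * u a / n a) F (𝓝 ℓ))
    (hk : Tendsto (fun a => k a / n a) F (𝓝 c)) :
    Tendsto (fun a => u a / k a ^ 2 * (m a * n a)) F (𝓝 (ℓ / c ^ 2)) := by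
  refine (hu.div (hk.pow 2) (pow_ne_zero 2 hc)).congr' ?_
  filter_upwards [h.scale_pos] with a hn
  simp only [Pi.div_apply]
  -- A vanishing curvature needs no exclusion: division by zero gives 0 on both sides.
  rcases eq_or_ne (k a) 0 with h0 | h0
  · simp [h0]
  · field_simp

lemma tendsto_floor {u k : α → ℝ} {c : ℝ} (hc : c ≠ 0)
    (hu : Tendsto (fun a => √(m a : ℝ) * u a / n a) F (𝓝 0))
    (hk : Tendsto (fun a => k a / n a) F (𝓝 c)) :
    Tendsto (fun a => (m a : ℝ) * (u a ^ 2 / k a ^ 2)) F (𝓝 0) := by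
  have h1 := (hu.pow 2).div (hk.pow 2) (pow_ne_zero 2 hc)
  rw [zero_pow two_ne_zero, zero_div] at h1
  refine h1.congr' ?_
  filter_upwards [h.scale_pos] with a hn
  simp only [Pi.div_apply]
  rw [div_pow, mul_pow, Real.sq_sqrt (Nat.cast_nonneg _)]
  rcases eq_or_ne (k a) 0 with h0 | h0
  · simp [h0]
  · field_simp

include hpdp hdt hdt'

lemma tendsto_meanCurvatureDFO :
    Tendsto (fun a => meanCurvatureDFO pdp (x a) dt fd xi s (m a) (p a) / n a) F (𝓝 γ₀) := by
  have := h.tendsto_curvature (f := fun u => u) (e := fun _ => xi) (B := fun _ => xi) hpdp hdt hdt'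
    fd xi s isSensitivity_id (fun _ _ => rfl) (u₀ := fd) (fun _ => rfl)
  simpa [meanCurvatureDFO] using this

lemma tendsto_meanCurvatureOFO :
    Tendsto (fun a => meanCurvatureOFO pdp (x a) dt fd xi s (m a) (p a) / n a) F (𝓝 (2 * γ₀)) := by
  have := h.tendsto_curvature (f := fun _ => fd) (e := fun u => u) (B := fun γ => fd * γ) hpdp hdt
    hdt' fd xi s isSensitivity_one (fun u γ => by ring) (u₀ := xi) (fun γ => by ring)
  simpa [meanCurvatureOFO] using this

/-- The noise limit `2 s κ γ₀` over the squared curvature limit `(2 κ γ₀)²` is `s / (2 κ γ₀)`. The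
sensitivities have `κ = 1/2` here and `κ = 1` for the OFO, which is the origin of the factor 2
between the two MSEs. -/
lemma tendsto_mseNoiseDFO :
    Tendsto (fun a => mseNoiseDFO pdp (x a) dt fd xi s (m a) (p a) * (m a * n a)) F
      (𝓝 (s / γ₀)) := by
  have h1 := h.tendsto_noise (f := fun u => u) (e := fun _ => xi) (B := fun _ => xi) hpdp hdt hdt'
    fd xi s isSensitivity_id (fun _ _ => rfl) (u₀ := fd) (fun _ => rfl)
  have h2 := h.tendsto_ratio h.pos.ne' h1 (h.tendsto_meanCurvatureDFO hpdp hdt hdt' fd xi s)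
  have h3 := h.pos.ne'
  have e : s / γ₀ = 2 * s * (1 / 2) * γ₀ / γ₀ ^ 2 := by field_simp
  rw [e]
  exact h2

lemma tendsto_mseNoiseOFO :
    Tendsto (fun a => mseNoiseOFO pdp (x a) dt fd xi s (m a) (p a) * (m a * n a)) F
      (𝓝 (s / (2 * γ₀))) := by
  have h1 := h.tendsto_noise (f := fun _ => fd) (e := fun u => u) (B := fun γ => fd * γ) hpdp hdt
    hdt' fd xi s isSensitivity_one (fun u γ => by ring) (u₀ := xi) (fun γ => by ring)
  have h3 := h.pos.ne'
  have h2 := h.tendsto_ratio (mul_ne_zero two_ne_zero h3) h1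
    (h.tendsto_meanCurvatureOFO hpdp hdt hdt' fd xi s)
  have e : s / (2 * γ₀) = 2 * s * 1 * γ₀ / (2 * γ₀) ^ 2 := by field_simp
  rw [e]
  exact h2

lemma tendsto_mseFloorDFO :
    Tendsto (fun a => (m a : ℝ) * mseFloorDFO pdp (x a) dt fd xi s (m a) (p a)) F (𝓝 0) :=
  h.tendsto_floor h.pos.ne' (h.tendsto_slope (f := fun u => u) (e := fun _ => xi)
    (B := fun _ => xi) hpdp hdt hdt' fd xi s isSensitivity_id (fun _ _ => rfl) (u₀ := fd)
    (fun _ => rfl)) (h.tendsto_meanCurvatureDFO hpdp hdt hdt' fd xi s)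

lemma tendsto_mseFloorOFO :
    Tendsto (fun a => (m a : ℝ) * mseFloorOFO pdp (x a) dt fd xi s (m a) (p a)) F (𝓝 0) :=
  h.tendsto_floor (mul_ne_zero two_ne_zero h.pos.ne') (h.tendsto_slope (f := fun _ => fd)
    (e := fun u => u) (B := fun γ => fd * γ) hpdp hdt hdt' fd xi s isSensitivity_one
    (fun u γ => by ring) (u₀ := xi) (fun γ => by ring))
    (h.tendsto_meanCurvatureOFO hpdp hdt hdt' fd xi s)

end Regime

/-! ### Quadratic forms in independent variables -/

/-- Pythagoras in `L²`. -/
lemma integral_norm_sq_sum_le {Ω ι : Type*} [MeasurableSpace Ω] {μ : Measure Ω} (s : Finset ι)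
    {Z : ι → Ω → ℂ} {C : ℝ} (hZ : ∀ i ∈ s, MemLp (Z i) 2 μ)
    (horth : ∀ i ∈ s, ∀ j ∈ s, i ≠ j → ∫ ω, star (Z i ω) * Z j ω ∂μ = 0)
    (hC : ∀ i ∈ s, ∫ ω, ‖Z i ω‖ ^ 2 ∂μ ≤ C) (c : ι → ℂ) :
    ∫ ω, ‖∑ i ∈ s, c i * Z i ω‖ ^ 2 ∂μ ≤ C * ∑ i ∈ s, ‖c i‖ ^ 2 := by
  classical
  have hint : ∀ i ∈ s, ∀ j ∈ s, Integrable (fun ω => star (c i) * c j * (star (Z i ω) * Z j ω)) μ :=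
    fun i hi j hj => (((hZ i hi).star.integrable_mul (hZ j hj)).const_mul _)
  have key : ∫ ω, ((‖∑ i ∈ s, c i * Z i ω‖ ^ 2 : ℝ) : ℂ) ∂μ =
      ∑ i ∈ s, ((‖c i‖ ^ 2 * ∫ ω, ‖Z i ω‖ ^ 2 ∂μ : ℝ) : ℂ) := by
    have e : ∀ ω, ((‖∑ i ∈ s, c i * Z i ω‖ ^ 2 : ℝ) : ℂ) =
        ∑ i ∈ s, ∑ j ∈ s, star (c i) * c j * (star (Z i ω) * Z j ω) := by
      intro ω
      rw [Complex.ofReal_pow, ← Complex.conj_mul', ← Complex.star_def, star_sum,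
        Finset.sum_mul_sum]
      refine Finset.sum_congr rfl fun i _ => Finset.sum_congr rfl fun j _ => ?_
      rw [star_mul']; ring
    simp_rw [e]
    rw [integral_finsetSum _ fun i hi => integrable_finsetSum _ fun j hj => hint i hi j hj]
    refine Finset.sum_congr rfl fun i hi => ?_
    rw [integral_finsetSum _ fun j hj => hint i hi j hj, Finset.sum_eq_single i]
    · rw [integral_const_mul, Complex.ofReal_mul, ← integral_complex_ofReal, Complex.ofReal_pow,
        ← Complex.conj_mul']
      congr 2
      ext ω
      rw [Complex.ofReal_pow, ← Complex.conj_mul', Complex.star_def]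
    · intro j hj hji
      rw [integral_const_mul, horth i hi j hj hji.symm, mul_zero]
    · exact fun h => absurd hi h
  rw [integral_complex_ofReal, ← Complex.ofReal_sum] at key
  rw [Complex.ofReal_injective key, Finset.mul_sum]
  refine Finset.sum_le_sum fun i hi => ?_
  rw [mul_comm]
  exact mul_le_mul_of_nonneg_right (hC i hi) (sq_nonneg _)

/-- Variance of the power of a pilot symbol. -/
def powerVariance (ν : Measure ℂ) : ℝ := ∫ z, ‖star z * z - 1‖ ^ 2 ∂ν

/-- Law of a pilot symbol: centred, of unit power and with finite fourth moment. -/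
structure IsSymbolLaw (ν : Measure ℂ) : Prop where
  memLp : MemLp (fun z : ℂ => z) 4 ν
  mean : ∫ z, z ∂ν = 0
  power : ∫ z, ‖z‖ ^ 2 ∂ν = 1

namespace IsSymbolLaw

variable {ν : Measure ℂ} [IsProbabilityMeasure ν] (h : IsSymbolLaw ν) {N : ℕ}
include h

lemma memLp_mul (i j : Fin N) :
    MemLp (fun x : Fin N → ℂ => star (x i) * x j) 2 (Measure.pi fun _ => ν) := by
  have hi : MemLp (fun x : Fin N → ℂ => star (x i)) 4 (Measure.pi fun _ => ν) :=
    (h.memLp.comp_measurePreserving (measurePreserving_eval (fun _ : Fin N => ν) i)).star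
  have hj : MemLp (fun x : Fin N → ℂ => x j) 4 (Measure.pi fun _ => ν) :=
    h.memLp.comp_measurePreserving (measurePreserving_eval (fun _ : Fin N => ν) j)
  have : ENNReal.HolderTriple 4 4 2 := ⟨by
    rw [← two_mul, show (4 : ℝ≥0∞) = 2 * 2 by norm_num, ENNReal.mul_inv (by simp) (by simp),
      ← mul_assoc, ENNReal.mul_inv_cancel (by simp) (by simp), one_mul]⟩
  exact hj.mul hi

omit [IsProbabilityMeasure ν] in
lemma integral_star_mean : ∫ z, star z ∂ν = 0 := by
  have := integral_conj (μ := ν) (f := fun z : ℂ => z)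
  rw [h.mean, map_zero] at this
  exact this

/-- Some index occurs exactly once: the smaller of `i` and `k` if they differ, otherwise `j`; its
factor has mean zero. Without the orderings the pairs `(i, j)` and `(j, i)` could be correlated
through `E z²`, which is not assumed to vanish. -/
lemma integral_four_eq_zero {i j k l : Fin N} (hij : i < j) (hkl : k < l) (hne : (i, j) ≠ (k, l)) :
    ∫ x : Fin N → ℂ, star (star (x i) * x j) * (star (x k) * x l) ∂(Measure.pi fun _ => ν) = 0 := by
  set f : Fin N → ℂ → ℂ := fun t z => (if t = i then z else 1) * (if t = j then star z else 1) *
    ((if t = k then star z else 1) * (if t = l then z else 1)) with hf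
  have e : ∀ x : Fin N → ℂ, star (star (x i) * x j) * (star (x k) * x l) = ∏ t, f t (x t) := by
    intro x
    simp only [hf, Finset.prod_mul_distrib, Finset.prod_ite_eq', Finset.mem_univ, if_true,
      star_mul', star_star]
  simp_rw [e]
  rw [integral_fintype_prod_eq_prod (μ := fun _ : Fin N => ν) f]
  have hstar := h.integral_star_mean
  have hmean := h.mean
  rcases lt_trichotomy i k with hik | rfl | hik
  · refine Finset.prod_eq_zero (Finset.mem_univ i) ?_
    simp only [hf, hij.ne, hik.ne, (hik.trans hkl).ne, if_true, if_false, mul_one]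
    exact hmean
  · have hjl : j ≠ l := fun hjl => hne (by rw [hjl])
    refine Finset.prod_eq_zero (Finset.mem_univ j) ?_
    simp only [hf, hij.ne', hjl, if_true, if_false, mul_one, one_mul]
    exact hstar
  · refine Finset.prod_eq_zero (Finset.mem_univ k) ?_
    simp only [hf, hkl.ne, hik.ne, (hik.trans hij).ne, if_true, if_false, mul_one, one_mul]
    exact hstar

lemma integral_norm_mul_sq {i j : Fin N} (hij : i ≠ j) :
    ∫ x : Fin N → ℂ, ‖star (x i) * x j‖ ^ 2 ∂(Measure.pi fun _ => ν) = 1 := by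
  have hm : AEStronglyMeasurable (fun z : ℂ => ((‖z‖ ^ 2 : ℝ) : ℂ)) ν := by
    refine Continuous.aestronglyMeasurable ?_
    fun_prop
  have := integral_pi_eval_mul_eval (μ := fun _ : Fin N => ν) (k := i) (l := j)
    (fun z : ℂ => ((‖z‖ ^ 2 : ℝ) : ℂ)) (fun z : ℂ => ((‖z‖ ^ 2 : ℝ) : ℂ)) hij hm hm
  simp_rw [← Complex.ofReal_mul] at this
  rw [integral_complex_ofReal, integral_complex_ofReal, h.power] at this
  have h2 : ∫ x : Fin N → ℂ, ‖x i‖ ^ 2 * ‖x j‖ ^ 2 ∂(Measure.pi fun _ => ν) = 1 := by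
    rw [← Complex.ofReal_mul, one_mul] at this
    exact Complex.ofReal_injective this
  rw [← h2]
  congr 1 with x
  rw [norm_mul, norm_star, mul_pow]

lemma memLp_power_sub_one :
    MemLp (fun z : ℂ => star z * z - 1) 2 ν := by
  have : ENNReal.HolderTriple 4 4 2 := ⟨by
    rw [← two_mul, show (4 : ℝ≥0∞) = 2 * 2 by norm_num, ENNReal.mul_inv (by simp) (by simp),
      ← mul_assoc, ENNReal.mul_inv_cancel (by simp) (by simp), one_mul]⟩
  exact (h.memLp.mul h.memLp.star).sub (memLp_const 1)

lemma integral_power_sub_one : ∫ z, (star z * z - 1) ∂ν = 0 := by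
  have e : ∀ z : ℂ, star z * z - 1 = ((‖z‖ ^ 2 - 1 : ℝ) : ℂ) := fun z => by
    rw [Complex.star_def, Complex.conj_mul']; push_cast; rfl
  simp_rw [e]
  have hi : Integrable (fun z : ℂ => ‖z‖ ^ 2) ν := by
    refine MemLp.integrable_norm_pow (p := 2) ?_ (by norm_num)
    exact h.memLp.mono_exponent (by norm_num)
  rw [integral_complex_ofReal, integral_sub hi (integrable_const _), h.power]
  simp

lemma integrable_quadratic_sub (A : Fin N → Fin N → ℂ) :
    Integrable (fun x : Fin N → ℂ => ‖∑ i, ∑ j, star (x i) * x j * A i j - ∑ i, A i i‖ ^ 2)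
      (Measure.pi fun _ => ν) := by
  have : MemLp (fun x : Fin N → ℂ => ∑ i, ∑ j, star (x i) * x j * A i j - ∑ i, A i i) 2
      (Measure.pi fun _ => ν) := by
    refine MemLp.sub ?_ (memLp_const _)
    exact memLp_finsetSum _ fun i _ => memLp_finsetSum _ fun j _ => (h.memLp_mul i j).mul_const _
  exact (memLp_two_iff_integrable_sq_norm this.1).1 this

/-- Quadratic forms in independent pilot symbols concentrate around their trace. -/
lemma integral_norm_quadratic_sub_sq_le (A : Fin N → Fin N → ℂ) :
    ∫ x : Fin N → ℂ, ‖∑ i, ∑ j, star (x i) * x j * A i j - ∑ i, A i i‖ ^ 2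
      ∂(Measure.pi fun _ => ν) ≤ (3 * (powerVariance ν + 2)) * ∑ i, ∑ j, ‖A i j‖ ^ 2 := by
  set μ := Measure.pi fun _ : Fin N => ν
  -- The diagonal, upper and lower parts are orthogonal families separately, but not jointly as no
  -- circularity is assumed. Bounding the square of their sum costs a factor 3; the three variances
  -- are at most `powerVariance ν`, 1 and 1.
  set up : Finset (Fin N × Fin N) := Finset.univ.filter fun a => a.1 < a.2
  set lo : Finset (Fin N × Fin N) := Finset.univ.filter fun a => a.2 < a.1
  set Q : (Fin N → ℂ) → ℂ := fun x => ∑ i, A i i * (star (x i) * x i - 1)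
  set U : (Fin N → ℂ) → ℂ := fun x => ∑ a ∈ up, A a.1 a.2 * (star (x a.1) * x a.2)
  set V : (Fin N → ℂ) → ℂ := fun x => ∑ a ∈ lo, A a.1 a.2 * (star (x a.1) * x a.2)
  have hdiag : ∀ i, MemLp (fun x : Fin N → ℂ => star (x i) * x i - 1) 2 μ := fun i =>
    (h.memLp_mul i i).sub (memLp_const 1)
  have split : ∀ x : Fin N → ℂ, ∑ i, ∑ j, star (x i) * x j * A i j - ∑ i, A i i =
      Q x + U x + V x := by
    intro x
    have e1 : ∑ i, ∑ j, star (x i) * x j * A i j =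
        ∑ a : Fin N × Fin N, A a.1 a.2 * (star (x a.1) * x a.2) := by
      rw [Fintype.sum_prod_type]
      exact Finset.sum_congr rfl fun i _ => Finset.sum_congr rfl fun j _ => by ring
    have e2 : ∀ a : Fin N × Fin N, A a.1 a.2 * (star (x a.1) * x a.2) =
        (if a.1 = a.2 then A a.1 a.2 * (star (x a.1) * x a.2) else 0) +
        (if a.1 < a.2 then A a.1 a.2 * (star (x a.1) * x a.2) else 0) +
        (if a.2 < a.1 then A a.1 a.2 * (star (x a.1) * x a.2) else 0) := by
      intro a
      rcases lt_trichotomy a.1 a.2 with h | h | h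
      · simp [h, h.ne, h.not_gt]
      · simp [h]
      · simp [h, h.ne', h.not_gt]
    rw [e1, Finset.sum_congr rfl fun a _ => e2 a, Finset.sum_add_distrib, Finset.sum_add_distrib,
      ← Finset.sum_filter (fun a : Fin N × Fin N => a.1 < a.2),
      ← Finset.sum_filter (fun a : Fin N × Fin N => a.2 < a.1), Fintype.sum_prod_type]
    simp only [Q, U, V, up, lo, mul_sub, mul_one, Finset.sum_sub_distrib, Finset.sum_ite_eq,
      Finset.mem_univ, if_true]
    ring
  have bQ : ∫ x, ‖Q x‖ ^ 2 ∂μ ≤ powerVariance ν * ∑ i, ‖A i i‖ ^ 2 := by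
    refine integral_norm_sq_sum_le Finset.univ (fun i _ => hdiag i) (fun i _ j _ hij => ?_)
      (fun i _ => ?_) _
    · have hm := h.memLp_power_sub_one.1
      rw [integral_pi_eval_mul_eval (μ := fun _ : Fin N => ν) (fun z => star (star z * z - 1))
        (fun z => star z * z - 1) hij hm.star hm, h.integral_power_sub_one, mul_zero]
    · have := integral_pi_eval (μ := fun _ : Fin N => ν) (k := i)
        (fun z => ((‖star z * z - 1‖ ^ 2 : ℝ) : ℂ))
        (Continuous.aestronglyMeasurable (by fun_prop))
      rw [integral_complex_ofReal, integral_complex_ofReal] at this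
      exact (Complex.ofReal_injective this).le
  have bU : ∫ x, ‖U x‖ ^ 2 ∂μ ≤ 1 * ∑ a ∈ up, ‖A a.1 a.2‖ ^ 2 := by
    refine integral_norm_sq_sum_le up (fun a _ => h.memLp_mul a.1 a.2) (fun a ha b hb hab => ?_)
      (fun a ha => ?_) _
    · exact h.integral_four_eq_zero (Finset.mem_filter.1 ha).2 (Finset.mem_filter.1 hb).2 hab
    · exact (h.integral_norm_mul_sq (Finset.mem_filter.1 ha).2.ne).le
  have bV : ∫ x, ‖V x‖ ^ 2 ∂μ ≤ 1 * ∑ a ∈ lo, ‖A a.1 a.2‖ ^ 2 := by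
    refine integral_norm_sq_sum_le lo (fun a _ => h.memLp_mul a.1 a.2) (fun a ha b hb hab => ?_)
      (fun a ha => ?_) _
    -- Transposing both pairs and exchanging their roles reduces this to the upper triangular case.
    · rw [← h.integral_four_eq_zero (i := b.2) (j := b.1) (k := a.2) (l := a.1)
        (Finset.mem_filter.1 hb).2 (Finset.mem_filter.1 ha).2 fun e => hab
          (Prod.ext (congrArg Prod.snd e).symm (congrArg Prod.fst e).symm)]
      congr 1 with x
      simp only [star_mul', star_star]
      ring
    · exact (h.integral_norm_mul_sq (Finset.mem_filter.1 ha).2.ne').le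
  have iQ : MemLp Q 2 μ := memLp_finsetSum _ fun i _ => (hdiag i).const_mul _
  have iU : MemLp U 2 μ := memLp_finsetSum _ fun a _ => (h.memLp_mul a.1 a.2).const_mul _
  have iV : MemLp V 2 μ := memLp_finsetSum _ fun a _ => (h.memLp_mul a.1 a.2).const_mul _
  have jQ := (memLp_two_iff_integrable_sq_norm iQ.1).1 iQ
  have jU := (memLp_two_iff_integrable_sq_norm iU.1).1 iU
  have jV := (memLp_two_iff_integrable_sq_norm iV.1).1 iV
  have hpt : ∀ x, ‖∑ i, ∑ j, star (x i) * x j * A i j - ∑ i, A i i‖ ^ 2 ≤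
      3 * (‖Q x‖ ^ 2 + ‖U x‖ ^ 2 + ‖V x‖ ^ 2) := by
    intro x
    rw [split]
    have h1 : ‖Q x + U x + V x‖ ≤ ‖Q x‖ + ‖U x‖ + ‖V x‖ := norm_add₃_le
    have h2 := pow_le_pow_left₀ (norm_nonneg _) h1 2
    nlinarith [sq_nonneg (‖Q x‖ - ‖U x‖), sq_nonneg (‖Q x‖ - ‖V x‖), sq_nonneg (‖U x‖ - ‖V x‖)]
  have jQU : Integrable (fun x => ‖Q x‖ ^ 2 + ‖U x‖ ^ 2) μ := jQ.add jU
  have jQUV : Integrable (fun x => ‖Q x‖ ^ 2 + ‖U x‖ ^ 2 + ‖V x‖ ^ 2) μ := jQU.add jV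
  refine (integral_mono (h.integrable_quadratic_sub A) (jQUV.const_mul 3) hpt).trans ?_
  rw [integral_const_mul, integral_add jQU jV, integral_add jQ jU]
  have hS : ∑ i, ∑ j, ‖A i j‖ ^ 2 = ∑ a : Fin N × Fin N, ‖A a.1 a.2‖ ^ 2 := by
    rw [Fintype.sum_prod_type]
  have sU : ∑ a ∈ up, ‖A a.1 a.2‖ ^ 2 ≤ ∑ i, ∑ j, ‖A i j‖ ^ 2 := by
    rw [hS]
    exact Finset.sum_le_sum_of_subset_of_nonneg (Finset.subset_univ _) fun _ _ _ => by positivity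
  have sV : ∑ a ∈ lo, ‖A a.1 a.2‖ ^ 2 ≤ ∑ i, ∑ j, ‖A i j‖ ^ 2 := by
    rw [hS]
    exact Finset.sum_le_sum_of_subset_of_nonneg (Finset.subset_univ _) fun _ _ _ => by positivity
  have sQ : ∑ i, ‖A i i‖ ^ 2 ≤ ∑ i, ∑ j, ‖A i j‖ ^ 2 := by
    refine Finset.sum_le_sum fun i _ => ?_
    exact Finset.single_le_sum (f := fun j => ‖A i j‖ ^ 2) (fun _ _ => by positivity)
      (Finset.mem_univ i)
  have hv : 0 ≤ powerVariance ν := integral_nonneg fun _ => by positivity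
  have := mul_le_mul_of_nonneg_left sQ hv
  linarith

end IsSymbolLaw

/-! ### Convergence in probability over varying spaces -/

section InProbability

variable {β : Type*} {Ω : β → Type*} [∀ b, MeasurableSpace (Ω b)]

/-- The filter of the families of events whose probability tends to one along `G`, on the union of
the probability spaces: convergence along this filter is convergence in probability. -/
def inProbability (G : Filter β) (μ : ∀ b, Measure (Ω b)) : Filter (Σ b, Ω b) where
  sets := {S | Tendsto (fun b => μ b {ω | (⟨b, ω⟩ : Σ b, Ω b) ∉ S}) G (𝓝 0)}
  univ_sets := by simpa using tendsto_const_nhds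
  sets_of_superset {S S'} hS hSS' := tendsto_of_tendsto_of_tendsto_of_le_of_le tendsto_const_nhds hS
    (fun _ => zero_le) fun b => measure_mono fun ω hω h => hω (hSS' h)
  inter_sets {S S'} hS hS' := by
    have h : Tendsto (fun b => μ b {ω | (⟨b, ω⟩ : Σ b, Ω b) ∉ S} +
        μ b {ω | (⟨b, ω⟩ : Σ b, Ω b) ∉ S'}) G (𝓝 0) := by
      simpa using Tendsto.add hS hS'
    refine tendsto_of_tendsto_of_tendsto_of_le_of_le tendsto_const_nhds h
      (fun _ => zero_le) fun b => ?_
    refine (measure_mono fun ω hω => ?_).trans (measure_union_le _ _)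
    by_contra hcon
    simp only [Set.mem_union, Set.mem_ofPred_eq, not_or, not_not] at hcon
    exact hω hcon

variable {G : Filter β} {μ : ∀ b, Measure (Ω b)}

lemma mem_inProbability {S : Set (Σ b, Ω b)} : S ∈ inProbability G μ ↔
    Tendsto (fun b => μ b {ω | (⟨b, ω⟩ : Σ b, Ω b) ∉ S}) G (𝓝 0) := Iff.rfl

lemma tendsto_fst_inProbability : Tendsto Sigma.fst (inProbability G μ) G := by
  intro S hS
  rw [mem_map, mem_inProbability]
  refine tendsto_const_nhds.congr' ?_
  filter_upwards [hS] with b hb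
  simp [hb]

lemma tendsto_measure_of_tendsto_inProbability {u : (Σ b, Ω b) → ℝ} {ℓ : ℝ}
    (h : Tendsto u (inProbability G μ) (𝓝 ℓ)) {ε : ℝ} (hε : 0 < ε) :
    Tendsto (fun b => μ b {ω | ε ≤ |u ⟨b, ω⟩ - ℓ|}) G (𝓝 0) := by
  have h1 := mem_inProbability.1 (h (Metric.ball_mem_nhds ℓ hε))
  simpa [Real.dist_eq] using h1

/-- Chebyshev's inequality, applied in each probability space separately. -/
lemma tendsto_inProbability_of_integral_norm_sq_le {E : Type*} [NormedAddCommGroup E]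
    {u : (Σ b, Ω b) → E} {c : β → ℝ} [∀ b, IsFiniteMeasure (μ b)]
    (hint : ∀ᶠ b in G, Integrable (fun ω => ‖u ⟨b, ω⟩‖ ^ 2) (μ b))
    (hle : ∀ᶠ b in G, ∫ ω, ‖u ⟨b, ω⟩‖ ^ 2 ∂(μ b) ≤ c b) (hc : Tendsto c G (𝓝 0)) :
    Tendsto u (inProbability G μ) (𝓝 0) := by
  rw [Metric.tendsto_nhds]
  intro ε hε
  refine mem_inProbability.2 ?_
  have h1 : Tendsto (fun b => ENNReal.ofReal (c b / ε ^ 2)) G (𝓝 0) := by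
    have := ENNReal.tendsto_ofReal (hc.div_const (ε ^ 2))
    simpa using this
  refine tendsto_of_tendsto_of_tendsto_of_le_of_le' tendsto_const_nhds h1
    (Eventually.of_forall fun _ => zero_le) ?_
  filter_upwards [hint, hle] with b hi hl
  have h2 := mul_meas_ge_le_integral_of_nonneg (Eventually.of_forall fun ω => by positivity) hi
    (ε ^ 2)
  refine (measure_mono (t := {ω | ε ^ 2 ≤ ‖u ⟨b, ω⟩‖ ^ 2}) fun ω hω => ?_).trans ?_
  · simp only [dist_zero_right, Set.mem_ofPred_eq, not_lt] at hω
    exact pow_le_pow_left₀ hε.le hω 2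
  · rw [← ENNReal.ofReal_toReal (measure_ne_top (μ b) _)]
    refine ENNReal.ofReal_le_ofReal ?_
    rw [le_div_iff₀ (by positivity), mul_comm]
    exact h2.trans hl

end InProbability

/-! ### Sesquilinear forms in the columns of the pilot matrix -/

variable {L N : ℕ}

lemma sum_star_colMatrix_mul' (l : Fin L) (n n' : Fin N) :
    ∑ k, star (colMatrix N l n k) * colMatrix N l n' k = if n = n' then ((1 : ℝ) : ℂ) else 0 := by
  have hN : ((√(N : ℝ) : ℝ) : ℂ) * ((√(N : ℝ) : ℝ) : ℂ) = N := by
    rw [← Complex.ofReal_mul, Real.mul_self_sqrt (Nat.cast_nonneg N)]; simp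
  have hN0 : (N : ℂ) ≠ 0 := by exact_mod_cast (Fin.pos n).ne'
  have hsymm : ∀ k n, dftColumns N N k n = dftColumns N N n k := by
    intro k n
    rw [dftColumns, Matrix.of_apply, Matrix.of_apply]
    congr 5
    ring
  have : ∀ k, star (colMatrix N l n k) * colMatrix N l n' k =
      star (dftColumns N N n' k) * dftColumns N N n k := by
    intro k
    have h1 : (N : ℂ) * (star (dftColumns N L k l) * dftColumns N L k l) = 1 := by
      rw [star_dftColumns_mul]
      simp [hN0]
    rw [colMatrix, colMatrix, star_mul', star_mul', star_star, hsymm k n, hsymm k n']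
    rw [show star ((√(N : ℝ) : ℝ) : ℂ) = ((√(N : ℝ) : ℝ) : ℂ) from Complex.conj_ofReal _]
    linear_combination (star (dftColumns N N n' k) * dftColumns N N n k) * h1 +
      (star (dftColumns N N n' k) * dftColumns N N n k) *
        (star (dftColumns N L k l) * dftColumns N L k l) * hN
  simp_rw [this, sum_star_dftColumns_mul]
  simp [eq_comm]

/-- The phases of the `n`-th DFT column cancel and a full sum of `e^{2πjk(l-l')/N}` remains.
Distinct taps stay distinct modulo `N` because `L ≤ N`; hence different columns of `B` are
uncorrelated. -/
lemma sum_star_colMatrix_mul_cross (hLN : L ≤ N) (l l' : Fin L) (n : Fin N) :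
    ∑ k, star (colMatrix N l n k) * colMatrix N l' n k = if l = l' then 1 else 0 := by
  have hN : ((√(N : ℝ) : ℝ) : ℂ) * ((√(N : ℝ) : ℝ) : ℂ) = N := by
    rw [← Complex.ofReal_mul, Real.mul_self_sqrt (Nat.cast_nonneg N)]; simp
  have hN0 : (N : ℂ) ≠ 0 := by exact_mod_cast (Fin.pos n).ne'
  have : ∀ k, star (colMatrix N l n k) * colMatrix N l' n k =
      1 / (N : ℂ) * Complex.exp (Complex.I *
        ((2 * Real.pi * ((k : ℝ) * (((l : ℤ) - l' : ℤ) : ℝ) / N) : ℝ) : ℂ)) := by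
    intro k
    have h1 : (N : ℂ) * (star (dftColumns N N k n) * dftColumns N N k n) = 1 := by
      rw [star_dftColumns_mul]
      simp [hN0]
    have h2 : star (dftColumns N L k l) * dftColumns N L k l' = 1 / (N : ℂ) * Complex.exp
        (Complex.I * ((2 * Real.pi * ((k : ℝ) * (((l : ℤ) - l' : ℤ) : ℝ) / N) : ℝ) : ℂ)) := by
      rw [star_dftColumns_mul]
      congr 5
      push_cast
      ring
    rw [← h2, colMatrix, colMatrix, star_mul', star_mul', star_star]
    rw [show star ((√(N : ℝ) : ℝ) : ℂ) = ((√(N : ℝ) : ℝ) : ℂ) from Complex.conj_ofReal _]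
    linear_combination (star (dftColumns N L k l) * dftColumns N L k l') * h1 +
      (star (dftColumns N N k n) * dftColumns N N k n) *
        (star (dftColumns N L k l) * dftColumns N L k l') * hN
  simp_rw [this]
  rw [← Finset.mul_sum, sum_exp_eq]
  have h3 : (N : ℤ) ∣ ((l : ℤ) - l') ↔ l = l' := by
    have := fin_dvd_sub_iff (l.castLE hLN) (l'.castLE hLN)
    simpa using this
  simp_rw [h3]
  split_ifs
  · field_simp
  · simp

/-- The form `b_lᴴ diag(d) b_{l'}` in the columns of the pilot matrix. -/
def colForm (d : Fin N → ℂ) (l l' : Fin L) (x : Fin N → ℂ) : ℂ :=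
  ∑ n, d n * (star (col L x l n) * col L x l' n)

/-- The matrix of `colForm` as a quadratic form in the pilot symbols. -/
def colFormMatrix (d : Fin N → ℂ) (l l' : Fin L) (i j : Fin N) : ℂ :=
  ∑ n, d n * (star (colMatrix N l n i) * colMatrix N l' n j)

lemma colForm_eq (d : Fin N → ℂ) (l l' : Fin L) (x : Fin N → ℂ) :
    colForm d l l' x = ∑ i, ∑ j, star (x i) * x j * colFormMatrix d l l' i j := by
  have : ∀ n, d n * (star (col L x l n) * col L x l' n) =
      ∑ i, ∑ j, star (x i) * x j * (d n * (star (colMatrix N l n i) * colMatrix N l' n j)) := by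
    intro n
    rw [col_apply, col_apply, star_sum, Finset.sum_mul_sum, Finset.mul_sum]
    refine Finset.sum_congr rfl fun i _ => ?_
    rw [Finset.mul_sum]
    refine Finset.sum_congr rfl fun j _ => ?_
    rw [star_mul']
    ring
  simp_rw [colForm, this, colFormMatrix, Finset.mul_sum]
  rw [Finset.sum_comm]
  refine Finset.sum_congr rfl fun i _ => ?_
  rw [Finset.sum_comm]

lemma sum_colFormMatrix_diag (hLN : L ≤ N) (d : Fin N → ℂ) (l l' : Fin L) :
    ∑ i, colFormMatrix d l l' i i = if l = l' then ∑ n, d n else 0 := by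
  simp_rw [colFormMatrix]
  rw [Finset.sum_comm]
  simp_rw [← Finset.mul_sum, sum_star_colMatrix_mul_cross hLN]
  split_ifs <;> simp

/-- The matrix is `U_lᴴ diag(d) U_{l'}` with unitary factors, so its Frobenius norm is that of
`diag(d)`. -/
lemma sum_norm_colFormMatrix_sq (d : Fin N → ℂ) (l l' : Fin L) :
    ∑ i, ∑ j, ‖colFormMatrix d l l' i j‖ ^ 2 = ∑ n, ‖d n‖ ^ 2 := by
  have h1 : ∀ i, ∑ j, ‖colFormMatrix d l l' i j‖ ^ 2 =
      ∑ n, ‖d n‖ ^ 2 * ‖colMatrix N l n i‖ ^ 2 := by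
    intro i
    have e : ∀ j, colFormMatrix d l l' i j =
        ∑ n, colMatrix N l' n j * (d n * star (colMatrix N l n i)) := fun j => by
      rw [colFormMatrix]
      exact Finset.sum_congr rfl fun n _ => by ring
    simp_rw [e]
    rw [sum_norm_sq_of_orthogonal Finset.univ (fun j n => colMatrix N l' n j) 1
      (sum_star_colMatrix_mul' l'), one_mul]
    simp_rw [norm_mul, norm_star, mul_pow]
  have h2 : ∀ n, ∑ i, ‖colMatrix N l n i‖ ^ 2 = 1 := by
    intro n
    have := sum_star_colMatrix_mul' l n n
    rw [if_pos rfl] at this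
    apply Complex.ofReal_injective
    rw [← this, Complex.ofReal_sum]
    refine Finset.sum_congr rfl fun k _ => ?_
    rw [Complex.star_def, Complex.conj_mul', Complex.ofReal_pow]
  simp_rw [h1]
  rw [Finset.sum_comm]
  simp_rw [← Finset.mul_sum, h2, mul_one]

/-- Convergence in probability of the normalized forms in the columns of the pilot matrix. -/
lemma tendsto_colForm {ν : Measure ℂ} [IsProbabilityMeasure ν] (hν : IsSymbolLaw ν)
    {β : Type*} {G : Filter β} {N : β → ℕ} (hN : Tendsto N G atTop) (d : ∀ n : ℕ, Fin n → ℂ)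
    {b : ℝ} (hd : ∀ n k, ‖d n k‖ ≤ b) {t : ℂ}
    (ht : Tendsto (fun n : ℕ => (∑ k, d n k) / (n : ℂ)) atTop (𝓝 t)) (l l' : Fin L) :
    Tendsto (fun a : Σ b, (Fin (N b) → ℂ) => colForm (d (N a.1)) l l' a.2 / (N a.1 : ℂ))
      (inProbability G fun b => Measure.pi fun _ : Fin (N b) => ν)
      (𝓝 (if l = l' then t else 0)) := by
  set μ : ∀ b, Measure (Fin (N b) → ℂ) := fun b => Measure.pi fun _ : Fin (N b) => ν
  have h0 : Tendsto (fun a : Σ b, (Fin (N b) → ℂ) => (colForm (d (N a.1)) l l' a.2 -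
      ∑ i, colFormMatrix (d (N a.1)) l l' i i) / (N a.1 : ℂ)) (inProbability G μ) (𝓝 0) := by
    refine tendsto_inProbability_of_integral_norm_sq_le
      -- The squared Frobenius norm is at most `N b²`, while the normalization contributes `N²`.
      (c := fun a => 3 * (powerVariance ν + 2) * b ^ 2 / N a) ?_ ?_ ?_
    · refine Eventually.of_forall fun a => ?_
      simp_rw [norm_div, div_pow, colForm_eq]
      exact (hν.integrable_quadratic_sub _).div_const _
    · filter_upwards [hN.eventually_gt_atTop 0] with a ha
      have ha' : (0 : ℝ) < N a := by exact_mod_cast ha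
      simp_rw [norm_div, div_pow, colForm_eq]
      rw [integral_div]
      have h1 := hν.integral_norm_quadratic_sub_sq_le (colFormMatrix (d (N a)) l l')
      rw [sum_norm_colFormMatrix_sq] at h1
      have h2 : ∑ n, ‖d (N a) n‖ ^ 2 ≤ N a * b ^ 2 := by
        refine (Finset.sum_le_card_nsmul _ _ (b ^ 2) fun n _ =>
          pow_le_pow_left₀ (norm_nonneg _) (hd _ n) 2).trans (le_of_eq ?_)
        simp
      have hv : 0 ≤ powerVariance ν := integral_nonneg fun _ => by positivity
      have h3 := h1.trans (mul_le_mul_of_nonneg_left h2 (by positivity))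
      rw [Complex.norm_natCast, div_le_div_iff₀ (by positivity) ha']
      calc _ ≤ _ := mul_le_mul_of_nonneg_right h3 ha'.le
        _ = _ := by ring
    · exact (tendsto_natCast_atTop_atTop.comp hN).const_div_atTop _
  have hf : Tendsto (fun a : Σ b, (Fin (N b) → ℂ) => N a.1) (inProbability G μ) atTop :=
    hN.comp tendsto_fst_inProbability
  have h1 : Tendsto (fun a : Σ b, (Fin (N b) → ℂ) =>
      (∑ i, colFormMatrix (d (N a.1)) l l' i i) / (N a.1 : ℂ)) (inProbability G μ)
      (𝓝 (if l = l' then t else 0)) := by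
    have h2 : Tendsto (fun a : Σ b, (Fin (N b) → ℂ) =>
        if l = l' then (∑ k, d (N a.1) k) / (N a.1 : ℂ) else 0) (inProbability G μ)
        (𝓝 (if l = l' then t else 0)) := by
      split_ifs
      · exact ht.comp hf
      · exact tendsto_const_nhds
    refine h2.congr' ?_
    filter_upwards [hf.eventually_ge_atTop L] with a ha
    rw [sum_colFormMatrix_diag ha]
    split_ifs <;> simp
  have h3 := h0.add h1
  rw [zero_add] at h3
  refine h3.congr fun a => ?_
  rw [← add_div, sub_add_cancel]

variable {L N : ℕ}

/-! ### Information of a random pilot -/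

/-- If the Gram matrix of `B` is close to a multiple of the identity, the energy of a vector in the
pilot span is controlled by its correlations with the columns of `B`. -/
lemma norm_sq_sub_le_norm_perp_sq (x : Fin N → ℂ) (hN : 0 < N)
    (hG : ∀ k k' : Fin L, ‖(inner ℂ (col L x k) (col L x k') : ℂ) / N - if k = k' then 1 else 0‖ ≤
      1 / (2 * L)) (w : EuclideanSpace ℂ (Fin N)) :
    ‖w‖ ^ 2 - 2 / N * ∑ k : Fin L, ‖(inner ℂ (col L x k) w : ℂ)‖ ^ 2 ≤ ‖perp L x w‖ ^ 2 := by
  have hN' : (0 : ℝ) < N := by exact_mod_cast hN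
  have hNC : (N : ℂ) ≠ 0 := by exact_mod_cast hN.ne'
  set u := w - perp L x w with hu
  have hpu : perp L x u = 0 := by rw [hu, map_sub, perp_perp, sub_self]
  have horth : inner ℂ u (perp L x w) = (0 : ℂ) := by
    rw [← inner_perp_left, hpu, inner_zero_left]
  have hw : w = u + perp L x w := by rw [hu, sub_add_cancel]
  have hpyth : ‖w‖ ^ 2 = ‖u‖ ^ 2 + ‖perp L x w‖ ^ 2 := by
    have := norm_add_sq_eq_norm_sq_add_norm_sq_of_inner_eq_zero u (perp L x w) horth
    rw [← hw] at this
    simpa [sq] using this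
  obtain ⟨c, hc⟩ : ∃ c : Fin L → ℂ, ∑ k, c k • col L x k = u :=
    (Submodule.mem_span_range_iff_exists_fun ℂ).1 ((perp_eq_zero x).1 hpu)
  set S := ∑ k, ‖c k‖ ^ 2
  set H := ∑ k : Fin L, ‖(inner ℂ (col L x k) w : ℂ)‖ ^ 2
  have hS0 : 0 ≤ S := Finset.sum_nonneg fun _ _ => by positivity
  have hH0 : 0 ≤ H := Finset.sum_nonneg fun _ _ => by positivity
  -- `‖u‖² = ⟨u, w⟩`, as `u` is the component of `w` in the pilot span; expanding `u` in the columns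
  -- and applying Cauchy–Schwarz gives the bound.
  have hupper : (‖u‖ ^ 2) ^ 2 ≤ S * H := by
    have h1 : ‖u‖ ^ 2 ≤ ∑ k, ‖c k‖ * ‖(inner ℂ (col L x k) w : ℂ)‖ := by
      have h2 : (inner ℂ u w : ℂ) = inner ℂ u u := by
        conv_lhs => rw [hw]
        rw [inner_add_right, horth, add_zero]
      rw [@norm_sq_eq_re_inner ℂ, ← h2, ← hc, sum_inner]
      refine (Complex.re_le_norm _).trans ((norm_sum_le _ _).trans (le_of_eq ?_))
      refine Finset.sum_congr rfl fun k _ => ?_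
      rw [inner_smul_left, norm_mul, RCLike.norm_conj]
    exact (pow_le_pow_left₀ (by positivity) h1 2).trans
      (Finset.sum_mul_sq_le_sq_mul_sq _ _ _)
  -- The Gram matrix is `N (1 + Δ)` with entries of `Δ` at most `1/(2L)`, so the quadratic form of
  -- `Δ` is at most `(∑ ‖c k‖)² / (2L) ≤ S / 2`.
  have hlower : N / 2 * S ≤ ‖u‖ ^ 2 := by
    have e : ((‖u‖ ^ 2 : ℝ) : ℂ) = N * (S + ∑ k, ∑ k', star (c k) * c k' *
        ((inner ℂ (col L x k) (col L x k') : ℂ) / N - if k = k' then 1 else 0)) := by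
      rw [Complex.ofReal_pow]
      rw [show ((‖u‖ : ℝ) : ℂ) ^ 2 = inner ℂ u u from (inner_self_eq_norm_sq_to_K (𝕜 := ℂ) u).symm,
        ← hc, sum_inner]
      simp_rw [inner_sum, inner_smul_left, inner_smul_right, mul_sub, Finset.sum_sub_distrib]
      have hS : (S : ℂ) = ∑ k, ∑ k', star (c k) * c k' * if k = k' then 1 else 0 := by
        simp only [S, Complex.ofReal_sum, Complex.ofReal_pow, mul_ite, mul_one, mul_zero,
          Finset.sum_ite_eq, Finset.mem_univ, if_true, Complex.star_def, Complex.conj_mul']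
      rw [hS, add_sub_cancel, Finset.mul_sum]
      refine Finset.sum_congr rfl fun k _ => ?_
      rw [Finset.mul_sum]
      refine Finset.sum_congr rfl fun k' _ => ?_
      rw [Complex.star_def]
      field_simp
    have hb : ‖∑ k, ∑ k', star (c k) * c k' *
        ((inner ℂ (col L x k) (col L x k') : ℂ) / N - if k = k' then 1 else 0)‖ ≤ S / 2 := by
      refine (norm_sum_le _ _).trans ((Finset.sum_le_sum fun k _ => norm_sum_le _ _).trans ?_)
      have h1 : ∀ k k', ‖star (c k) * c k' *
          ((inner ℂ (col L x k) (col L x k') : ℂ) / N - if k = k' then 1 else 0)‖ ≤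
          ‖c k‖ * ‖c k'‖ * (1 / (2 * L)) := fun k k' => by
        rw [norm_mul, norm_mul, norm_star]
        exact mul_le_mul_of_nonneg_left (hG k k') (by positivity)
      refine (Finset.sum_le_sum fun k _ => Finset.sum_le_sum fun k' _ => h1 k k').trans ?_
      simp_rw [← Finset.sum_mul, ← Finset.mul_sum, ← Finset.sum_mul]
      rw [← sq]
      have h2 := sq_sum_le_card_mul_sum_sq (s := Finset.univ) (f := fun k => ‖c k‖)
      rw [Finset.card_univ, Fintype.card_fin] at h2
      refine (mul_le_mul_of_nonneg_right h2 (by positivity)).trans ?_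
      calc (L * ∑ k, ‖c k‖ ^ 2) * (1 / (2 * L)) = S / 2 * ((L : ℝ) / L) := by ring
        _ ≤ S / 2 := mul_le_of_le_one_right (by positivity) (div_self_le_one _)
    generalize ∑ k, ∑ k', star (c k) * c k' *
        ((inner ℂ (col L x k) (col L x k') : ℂ) / N - if k = k' then 1 else 0) = Z at e hb
    have h3 := congrArg Complex.re e
    rw [Complex.ofReal_re, ← Complex.ofReal_natCast, Complex.re_ofReal_mul, Complex.add_re,
      Complex.ofReal_re] at h3
    rw [h3]
    have h4 := (abs_le.1 ((Complex.abs_re_le_norm _).trans hb)).1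
    rw [div_mul_eq_mul_div, mul_div_assoc]
    exact mul_le_mul_of_nonneg_left (by linarith) hN'.le
  have hfinal : ‖u‖ ^ 2 ≤ 2 / N * H := by
    rcases eq_or_lt_of_le (sq_nonneg ‖u‖) with h0 | h0
    · rw [← h0]; positivity
    · refine le_of_mul_le_mul_left ?_ h0
      have h1 : S ≤ 2 / N * ‖u‖ ^ 2 := by
        rw [div_mul_eq_mul_div, le_div_iff₀ hN']
        linarith
      calc ‖u‖ ^ 2 * ‖u‖ ^ 2 = (‖u‖ ^ 2) ^ 2 := by ring
        _ ≤ S * H := hupper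
        _ ≤ 2 / N * ‖u‖ ^ 2 * H := mul_le_mul_of_nonneg_right h1 hH0
        _ = _ := by ring
  linarith

/-- Diagonal of `D - jπ`, up to the factor `j`. -/
def centredPhase (n : ℕ) (k : Fin n) : ℝ := 2 * Real.pi * (k : ℝ) / n - Real.pi

lemma abs_centredPhase_le (n : ℕ) (k : Fin n) : |centredPhase n k| ≤ Real.pi := by
  have h1 := fin_div_le_one k
  have h2 : (0 : ℝ) ≤ (k : ℝ) / n := by positivity
  have hπ := Real.pi_pos
  rw [centredPhase, mul_div_assoc, abs_le]
  constructor <;> nlinarith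

lemma sum_fin_cast (n : ℕ) : ∑ k : Fin n, (k : ℝ) = n * (n - 1) / 2 := by
  induction n with
  | zero => simp
  | succ n ih => rw [Fin.sum_univ_castSucc]; simp only [Fin.val_castSucc, Fin.val_last, ih]
                 push_cast; ring

lemma sum_fin_cast_sq (n : ℕ) : ∑ k : Fin n, (k : ℝ) ^ 2 = n * (n - 1) * (2 * n - 1) / 6 := by
  induction n with
  | zero => simp
  | succ n ih => rw [Fin.sum_univ_castSucc]; simp only [Fin.val_castSucc, Fin.val_last, ih]
                 push_cast; ring

lemma tendsto_mean_centredPhase :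
    Tendsto (fun n : ℕ => (∑ k, centredPhase n k) / n) atTop (𝓝 0) := by
  have h := (tendsto_natCast_atTop_atTop (R := ℝ)).const_div_atTop (-Real.pi)
  refine h.congr' ?_
  filter_upwards [eventually_gt_atTop 0] with n hn
  have hn' : (n : ℝ) ≠ 0 := by exact_mod_cast hn.ne'
  simp only [centredPhase]
  rw [Finset.sum_sub_distrib, ← Finset.sum_div, ← Finset.mul_sum, sum_fin_cast, Finset.sum_const,
    Finset.card_univ, Fintype.card_fin, nsmul_eq_mul]
  field_simp
  ring

/-- The limit is the variance of the uniform law on `[-π, π]`. -/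
lemma tendsto_mean_centredPhase_sq :
    Tendsto (fun n : ℕ => (∑ k, centredPhase n k ^ 2) / n) atTop (𝓝 (Real.pi ^ 2 / 3)) := by
  have h0 := tendsto_inv_atTop_zero.comp (tendsto_natCast_atTop_atTop (R := ℝ))
  have h : Tendsto (fun n : ℕ => Real.pi ^ 2 * (1 / 3 + 2 / 3 * ((n : ℝ)⁻¹) ^ 2)) atTop
      (𝓝 (Real.pi ^ 2 * (1 / 3 + 2 / 3 * 0 ^ 2))) :=
    (((h0.pow 2).const_mul (2 / 3)).const_add (1 / 3)).const_mul (Real.pi ^ 2)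
  have e : Real.pi ^ 2 * (1 / 3 + 2 / 3 * 0 ^ 2) = Real.pi ^ 2 / 3 := by ring
  rw [e] at h
  refine h.congr' ?_
  filter_upwards [eventually_gt_atTop 0] with n hn
  have hn' : (n : ℝ) ≠ 0 := by exact_mod_cast hn.ne'
  have e : ∀ k : Fin n, centredPhase n k ^ 2 = 4 * Real.pi ^ 2 / n ^ 2 * (k : ℝ) ^ 2 -
      4 * Real.pi ^ 2 / n * k + Real.pi ^ 2 := fun k => by
    rw [centredPhase]; field_simp; ring
  simp_rw [e]
  rw [Finset.sum_add_distrib, Finset.sum_sub_distrib, ← Finset.mul_sum, ← Finset.mul_sum,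
    sum_fin_cast, sum_fin_cast_sq, Finset.sum_const, Finset.card_univ, Fintype.card_fin,
    nsmul_eq_mul]
  field_simp
  ring

/-- `(D - jπ) v`. -/
def centredGen (v : EuclideanSpace ℂ (Fin N)) : EuclideanSpace ℂ (Fin N) :=
  gen N v - (Complex.I * (Real.pi : ℂ)) • v

lemma centredGen_apply (v : EuclideanSpace ℂ (Fin N)) (n : Fin N) :
    centredGen v n = Complex.I * (centredPhase N n : ℂ) * v n := by
  rw [centredGen, PiLp.sub_apply, gen_apply, PiLp.smul_apply, centredPhase, smul_eq_mul]
  push_cast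
  ring

/-- Centring is free because the projection kills `b_l`. It makes the diagonal asymptotically
mean-free, so that `(D - jπ) b_l` decorrelates from all columns and the projection costs no energy
in the limit. -/
lemma perp_gen_col (x : Fin N → ℂ) (l : Fin L) :
    perp L x (gen N (col L x l)) = perp L x (centredGen (col L x l)) := by
  rw [centredGen, map_sub, map_smul, perp_col, smul_zero, sub_zero]

lemma inner_col_col (x : Fin N → ℂ) (k l : Fin L) :
    inner ℂ (col L x k) (col L x l) = colForm (fun _ => 1) k l x := by
  rw [PiLp.inner_apply, colForm]
  refine Finset.sum_congr rfl fun n _ => ?_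
  rw [RCLike.inner_apply, Complex.star_def]
  ring

lemma inner_col_centredGen_col (x : Fin N → ℂ) (k l : Fin L) :
    inner ℂ (col L x k) (centredGen (col L x l)) =
      colForm (fun n => Complex.I * (centredPhase N n : ℂ)) k l x := by
  rw [PiLp.inner_apply, colForm]
  refine Finset.sum_congr rfl fun n _ => ?_
  rw [RCLike.inner_apply, centredGen_apply, Complex.star_def]
  ring

lemma norm_centredGen_col_sq (x : Fin N → ℂ) (l : Fin L) :
    ((‖centredGen (col L x l)‖ ^ 2 : ℝ) : ℂ) =
      colForm (fun n => ((centredPhase N n ^ 2 : ℝ) : ℂ)) l l x := by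
  rw [EuclideanSpace.norm_sq_eq, colForm, Complex.ofReal_sum]
  refine Finset.sum_congr rfl fun n _ => ?_
  rw [centredGen_apply, norm_mul, norm_mul, Complex.norm_I, one_mul, Complex.norm_real, mul_pow,
    Real.norm_eq_abs, sq_abs, Complex.star_def, Complex.conj_mul']
  push_cast
  rfl

section RandomPilot

variable {ν : Measure ℂ} [IsProbabilityMeasure ν] (hν : IsSymbolLaw ν) {β : Type*} {G : Filter β}
  {N : β → ℕ} (hN : Tendsto N G atTop)

include hν hN

lemma tendsto_gram (k l : Fin L) :
    Tendsto (fun a : Σ b, (Fin (N b) → ℂ) =>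
      (inner ℂ (col L a.2 k) (col L a.2 l) : ℂ) / (N a.1 : ℂ))
      (inProbability G fun b => Measure.pi fun _ : Fin (N b) => ν)
      (𝓝 (if k = l then 1 else 0)) := by
  simp_rw [inner_col_col]
  refine tendsto_colForm hν hN (fun _ _ => 1) (b := 1) (fun _ _ => by simp) ?_ k l
  refine tendsto_const_nhds.congr' ?_
  filter_upwards [eventually_gt_atTop 0] with n hn
  have hn' : (n : ℂ) ≠ 0 := by exact_mod_cast hn.ne'
  simp [hn']

lemma tendsto_inner_centredGen (k l : Fin L) :
    Tendsto (fun a : Σ b, (Fin (N b) → ℂ) =>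
      (inner ℂ (col L a.2 k) (centredGen (col L a.2 l)) : ℂ) / (N a.1 : ℂ))
      (inProbability G fun b => Measure.pi fun _ : Fin (N b) => ν) (𝓝 0) := by
  simp_rw [inner_col_centredGen_col]
  have h := tendsto_colForm hν hN (fun n k => Complex.I * (centredPhase n k : ℂ)) (b := Real.pi)
    (fun n k => by
      rw [norm_mul, Complex.norm_I, one_mul, Complex.norm_real]; exact abs_centredPhase_le n k)
    (t := 0) ?_ k l
  · simpa using h
  have h1 := ((Complex.continuous_ofReal.tendsto 0).comp tendsto_mean_centredPhase).const_mul
    Complex.I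
  simp only [Complex.ofReal_zero, mul_zero] at h1
  refine h1.congr fun n => ?_
  simp only [Function.comp]
  rw [← Finset.mul_sum, mul_div_assoc]
  push_cast
  rfl

lemma tendsto_norm_centredGen_sq (l : Fin L) :
    Tendsto (fun a : Σ b, (Fin (N b) → ℂ) => ‖centredGen (col L a.2 l)‖ ^ 2 / N a.1)
      (inProbability G fun b => Measure.pi fun _ : Fin (N b) => ν) (𝓝 (Real.pi ^ 2 / 3)) := by
  have h := tendsto_colForm hν hN (fun n k => ((centredPhase n k ^ 2 : ℝ) : ℂ))
    (b := Real.pi ^ 2) (fun n k => by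
      rw [Complex.norm_real, norm_pow]
      exact pow_le_pow_left₀ (norm_nonneg _) (abs_centredPhase_le n k) 2)
    (t := ((Real.pi ^ 2 / 3 : ℝ) : ℂ)) ?_ l l
  · rw [if_pos rfl] at h
    have h2 := (Complex.continuous_re.tendsto _).comp h
    rw [Complex.ofReal_re] at h2
    refine h2.congr fun a => ?_
    simp only [Function.comp]
    rw [← norm_centredGen_col_sq, ← Complex.ofReal_natCast, ← Complex.ofReal_div,
      Complex.ofReal_re]
  · refine ((Complex.continuous_ofReal.tendsto _).comp tendsto_mean_centredPhase_sq).congr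
      fun n => ?_
    simp only [Function.comp]
    push_cast
    rfl

/-- Squeezed between the energy of the centred vector and that energy minus its correlations with
the columns, which vanish after normalization once the Gram matrix is close to the identity. -/
lemma tendsto_norm_perp_gen_sq (l : Fin L) :
    Tendsto (fun a : Σ b, (Fin (N b) → ℂ) => ‖perp L a.2 (gen (N a.1) (col L a.2 l))‖ ^ 2 / N a.1)
      (inProbability G fun b => Measure.pi fun _ : Fin (N b) => ν) (𝓝 (Real.pi ^ 2 / 3)) := by
  have hup := tendsto_norm_centredGen_sq hν hN l
  have hcorr : Tendsto (fun a : Σ b, (Fin (N b) → ℂ) => 2 * ∑ k : Fin L,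
      ‖(inner ℂ (col L a.2 k) (centredGen (col L a.2 l)) : ℂ) / (N a.1 : ℂ)‖ ^ 2)
      (inProbability G fun b => Measure.pi fun _ : Fin (N b) => ν) (𝓝 0) := by
    have := (tendsto_finsetSum Finset.univ fun k _ =>
      ((tendsto_inner_centredGen hν hN k l).norm.pow 2)).const_mul 2
    simpa using this
  have hlo := hup.sub hcorr
  rw [sub_zero] at hlo
  have hgram : ∀ᶠ a : Σ b, (Fin (N b) → ℂ) in
      inProbability G fun b => Measure.pi fun _ : Fin (N b) => ν, ∀ k k' : Fin L,
      ‖(inner ℂ (col L a.2 k) (col L a.2 k') : ℂ) / (N a.1 : ℂ) - if k = k' then 1 else 0‖ ≤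
        1 / (2 * L) := by
    refine eventually_all.2 fun k => eventually_all.2 fun k' => ?_
    have hL : (0 : ℝ) < L := by exact_mod_cast Fin.pos k
    have := (tendsto_gram hν hN k k').eventually (Metric.closedBall_mem_nhds _
      (by positivity : (0 : ℝ) < 1 / (2 * L)))
    filter_upwards [this] with a ha
    rwa [dist_eq_norm] at ha
  refine tendsto_of_tendsto_of_tendsto_of_le_of_le' hlo hup ?_ (Eventually.of_forall fun a => ?_)
  · filter_upwards [hgram, (hN.comp tendsto_fst_inProbability).eventually_gt_atTop 0] with a ha hpos
    have hpos' : (0 : ℝ) < N a.1 := by exact_mod_cast hpos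
    have h1 := norm_sq_sub_le_norm_perp_sq a.2 hpos ha (centredGen (col L a.2 l))
    rw [perp_gen_col]
    refine le_trans (le_of_eq ?_) (div_le_div_of_nonneg_right h1 hpos'.le)
    simp_rw [norm_div, div_pow, Complex.norm_natCast]
    rw [← Finset.sum_div]
    field_simp
  · rw [perp_gen_col]
    exact div_le_div_of_nonneg_right (pow_le_pow_left₀ (norm_nonneg _) (norm_perp_le _ _) 2)
      (Nat.cast_nonneg _)

lemma tendsto_power_div (l : Fin L) :
    Tendsto (fun a : Σ b, (Fin (N b) → ℂ) => power a.2 / N a.1)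
      (inProbability G fun b => Measure.pi fun _ : Fin (N b) => ν) (𝓝 1) := by
  have h := (Complex.continuous_re.tendsto _).comp (tendsto_gram hν hN l l)
  rw [if_pos rfl, Complex.one_re] at h
  refine h.congr fun a => ?_
  simp only [Function.comp]
  rw [show (inner ℂ (col L a.2 l) (col L a.2 l) : ℂ) = ((‖col L a.2 l‖ : ℝ) : ℂ) ^ 2 from
      inner_self_eq_norm_sq_to_K (𝕜 := ℂ) _, ← norm_col_sq a.2 l, ← Complex.ofReal_pow,
    ← Complex.ofReal_natCast, ← Complex.ofReal_div, Complex.ofReal_re]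

lemma tendsto_information_div {pdp : Fin L → ℝ≥0} (hpdp : ∑ l, pdp l = 1) :
    Tendsto (fun a : Σ b, (Fin (N b) → ℂ) => information pdp a.2 / N a.1)
      (inProbability G fun b => Measure.pi fun _ : Fin (N b) => ν) (𝓝 (Real.pi ^ 2 / 3)) := by
  have h := tendsto_finsetSum Finset.univ fun l (_ : l ∈ (Finset.univ : Finset (Fin L))) =>
    (tendsto_norm_perp_gen_sq hν hN l).const_mul (pdp l : ℝ)
  have h1 : ∑ l, (pdp l : ℝ) = 1 := by exact_mod_cast congrArg ((↑) : ℝ≥0 → ℝ) hpdp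
  rw [← Finset.sum_mul, h1, one_mul] at h
  refine h.congr fun a => ?_
  rw [information, tapMean, Finset.sum_div]
  exact Finset.sum_congr rfl fun l _ => (mul_div_assoc _ _ _).symm

end RandomPilot

lemma regime_random {ν : Measure ℂ} [IsProbabilityMeasure ν] (hν : IsSymbolLaw ν)
    {pdp : Fin L → ℝ≥0} (hpdp : ∑ l, pdp l = 1) :
    Regime (inProbability (atTop : Filter (ℕ × ℕ × ℕ))
      fun v => Measure.pi fun _ : Fin v.2.1 => ν) pdp (fun a => a.1.1) (fun a => a.1.2.2)
      (fun a => a.1.2.1) (fun a => a.2) (fun a => (a.1.2.1 : ℝ)) (Real.pi ^ 2 / 3) := by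
  have h1 : Tendsto (fun v : ℕ × ℕ × ℕ => v.1) atTop atTop := by
    rw [← prod_atTop_atTop_eq]; exact tendsto_fst
  have h2 : Tendsto (fun v : ℕ × ℕ × ℕ => v.2) atTop atTop := by
    rw [← prod_atTop_atTop_eq]; exact tendsto_snd
  have h3 : Tendsto (fun v : ℕ × ℕ => v.1) atTop atTop := by
    rw [← prod_atTop_atTop_eq]; exact tendsto_fst
  have h4 : Tendsto (fun v : ℕ × ℕ => v.2) atTop atTop := by
    rw [← prod_atTop_atTop_eq]; exact tendsto_snd
  have hN : Tendsto (fun v : ℕ × ℕ × ℕ => v.2.1) atTop atTop := h3.comp h2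
  -- A power profile of total mass 1 has a tap; any column then measures the pilot power.
  obtain ⟨l⟩ : Nonempty (Fin L) := by
    by_contra hL
    rw [not_nonempty_iff] at hL
    simp at hpdp
  have hpos : ∀ᶠ a in inProbability (atTop : Filter (ℕ × ℕ × ℕ))
      (fun v => Measure.pi fun _ : Fin v.2.1 => ν), (0 : ℝ) < a.1.2.1 := by
    filter_upwards [(hN.comp tendsto_fst_inProbability).eventually_gt_atTop 0] with a ha
    exact_mod_cast ha
  refine ⟨h1.comp tendsto_fst_inProbability, h4.comp (h2.comp tendsto_fst_inProbability), hpos,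
    -- Any constant above the limit 1 of the normalized power would do.
    by positivity, tendsto_information_div hν hN hpdp, 2, ?_⟩
  filter_upwards [hpos, (tendsto_power_div hν hN l).eventually_le_const (by norm_num : (1 : ℝ) < 2)]
    with a ha h
  exact (div_le_iff₀ ha).1 h

lemma regime_fixed {pdp : Fin L → ℝ≥0} {x : Fin N → ℂ} (hx : Informative pdp x) :
    Regime (atTop : Filter (ℕ × ℕ)) pdp (fun v => v.1) (fun v => v.2) (fun _ => N) (fun _ => x)
      (fun _ => 1) (information pdp x) where
  antennas := by rw [← prod_atTop_atTop_eq]; exact tendsto_fst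
  subpaths := by rw [← prod_atTop_atTop_eq]; exact tendsto_snd
  scale_pos := Eventually.of_forall fun _ => one_pos
  pos := information_pos hx
  information := by simp
  power := ⟨power x, Eventually.of_forall fun _ => by rw [mul_one]⟩

end

end JointCFO

/-! ### The main theorem -/

open JointCFO in
theorem proposition1 {L : ℕ} (pdp : Fin L → ℝ≥0) (hpdp : ∑ l, pdp l = 1)
    (dt : ℝ) (hdt : 0 < dt) (hdt' : dt < 1 / 2) (fd xi : ℝ) (s : ℝ≥0) (hs : 0 < s) :
    -- a fixed informative pilot; `M` and `P` grow, `v = (M, P)`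
    (∀ (N : ℕ) (x : Fin N → ℂ), L ≤ N → Informative pdp x →
      Tendsto (fun v : ℕ × ℕ => mseNoiseDFO pdp x dt fd xi s v.1 v.2 /
        mseNoiseOFO pdp x dt fd xi s v.1 v.2) atTop (𝓝 2) ∧
      Tendsto (fun v : ℕ × ℕ => (v.1 : ℝ) * mseFloorDFO pdp x dt fd xi s v.1 v.2) atTop (𝓝 0) ∧
      Tendsto (fun v : ℕ × ℕ => (v.1 : ℝ) * mseFloorOFO pdp x dt fd xi s v.1 v.2) atTop (𝓝 0)) ∧
    -- random pilot symbols; `M`, `N` and `P` grow, `v = (M, N, P)`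
    (∀ (ν : Measure ℂ) [IsProbabilityMeasure ν], MemLp (fun z : ℂ => z) 4 ν →
      ∫ z, z ∂ν = 0 → ∫ z, ‖z‖ ^ 2 ∂ν = 1 → ∀ ε : ℝ, 0 < ε →
      Tendsto (fun v : ℕ × ℕ × ℕ => (Measure.pi fun _ : Fin v.2.1 => ν)
        {x | ε ≤ |mseNoiseDFO pdp x dt fd xi s v.1 v.2.2 /
          (3 * (s : ℝ) / (Real.pi ^ 2 * (v.1 : ℝ) * (v.2.1 : ℝ))) - 1|}) atTop (𝓝 0) ∧
      Tendsto (fun v : ℕ × ℕ × ℕ => (Measure.pi fun _ : Fin v.2.1 => ν)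
        {x | ε ≤ |2 * mseNoiseOFO pdp x dt fd xi s v.1 v.2.2 /
          (3 * (s : ℝ) / (Real.pi ^ 2 * (v.1 : ℝ) * (v.2.1 : ℝ))) - 1|}) atTop (𝓝 0) ∧
      Tendsto (fun v : ℕ × ℕ × ℕ => (Measure.pi fun _ : Fin v.2.1 => ν)
        {x | ε ≤ (v.1 : ℝ) * mseFloorDFO pdp x dt fd xi s v.1 v.2.2}) atTop (𝓝 0) ∧
      Tendsto (fun v : ℕ × ℕ × ℕ => (Measure.pi fun _ : Fin v.2.1 => ν)
        {x | ε ≤ (v.1 : ℝ) * mseFloorOFO pdp x dt fd xi s v.1 v.2.2}) atTop (𝓝 0)) := by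
  have hs' : (s : ℝ) ≠ 0 := by exact_mod_cast hs.ne'
  refine ⟨fun N x _ hx => ?_, fun ν _ hν4 hν1 hν2 ε hε => ?_⟩
  · have h := regime_fixed hx
    refine ⟨?_, h.tendsto_mseFloorDFO hpdp hdt hdt' fd xi s,
      h.tendsto_mseFloorOFO hpdp hdt hdt' fd xi s⟩
    have hγ := h.pos.ne'
    have h1 := (h.tendsto_mseNoiseDFO hpdp hdt hdt' fd xi s).div
      (h.tendsto_mseNoiseOFO hpdp hdt hdt' fd xi s) (by positivity)
    have e : (s : ℝ) / information pdp x / (s / (2 * information pdp x)) = 2 := by field_simp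
    rw [e] at h1
    refine h1.congr' ?_
    filter_upwards [h.antennas.eventually_gt_atTop 0] with v hv
    have hv' : (v.1 : ℝ) * 1 ≠ 0 := by
      rw [mul_one]; exact_mod_cast hv.ne'
    -- The common normalization `M · 1` cancels in the ratio of the two MSEs.
    exact mul_div_mul_right _ _ hv'
  · have h := regime_random ⟨hν4, hν1, hν2⟩ hpdp
    have hπ := Real.pi_ne_zero
    have h1 := (h.tendsto_mseNoiseDFO hpdp hdt hdt' fd xi s).mul_const (Real.pi ^ 2 / (3 * s))
    have h2 := (h.tendsto_mseNoiseOFO hpdp hdt hdt' fd xi s).mul_const (2 * Real.pi ^ 2 / (3 * s))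
    have e1 : (s : ℝ) / (Real.pi ^ 2 / 3) * (Real.pi ^ 2 / (3 * s)) = 1 := by field_simp
    have e2 : (s : ℝ) / (2 * (Real.pi ^ 2 / 3)) * (2 * Real.pi ^ 2 / (3 * s)) = 1 := by field_simp
    rw [e1] at h1
    rw [e2] at h2
    -- The floor events are stated without absolute value; they are contained in the events `ε ≤ |u
    -- - 0|`.
    have floor : ∀ {u : (Σ v : ℕ × ℕ × ℕ, (Fin v.2.1 → ℂ)) → ℝ}, Tendsto u (inProbability atTop
        fun v : ℕ × ℕ × ℕ => Measure.pi fun _ : Fin v.2.1 => ν) (𝓝 0) →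
        Tendsto (fun v : ℕ × ℕ × ℕ => (Measure.pi fun _ : Fin v.2.1 => ν) {x | ε ≤ u ⟨v, x⟩})
          atTop (𝓝 0) := fun {u} hu =>
      tendsto_of_tendsto_of_tendsto_of_le_of_le tendsto_const_nhds
        (tendsto_measure_of_tendsto_inProbability hu hε) (fun _ => zero_le) fun v =>
          measure_mono fun x (hx : ε ≤ u ⟨v, x⟩) => by
            show ε ≤ |u ⟨v, x⟩ - 0|
            rw [sub_zero]
            exact hx.trans (le_abs_self _)
    refine ⟨?_, ?_, floor (h.tendsto_mseFloorDFO hpdp hdt hdt' fd xi s),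
      floor (h.tendsto_mseFloorOFO hpdp hdt hdt' fd xi s)⟩
    · refine (tendsto_measure_of_tendsto_inProbability h1 hε).congr fun v => ?_
      congr 1
      ext x
      have : mseNoiseDFO pdp x dt fd xi s v.1 v.2.2 * ((v.1 : ℝ) * v.2.1) *
          (Real.pi ^ 2 / (3 * s)) = mseNoiseDFO pdp x dt fd xi s v.1 v.2.2 /
          (3 * (s : ℝ) / (Real.pi ^ 2 * (v.1 : ℝ) * (v.2.1 : ℝ))) := by
        rw [div_div_eq_mul_div]; ring
      simp only [this, Set.mem_ofPred_eq]
    · refine (tendsto_measure_of_tendsto_inProbability h2 hε).congr fun v => ?_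
      congr 1
      ext x
      have : mseNoiseOFO pdp x dt fd xi s v.1 v.2.2 * ((v.1 : ℝ) * v.2.1) *
          (2 * Real.pi ^ 2 / (3 * s)) = 2 * mseNoiseOFO pdp x dt fd xi s v.1 v.2.2 /
          (3 * (s : ℝ) / (Real.pi ^ 2 * (v.1 : ℝ) * (v.2.1 : ℝ))) := by
        rw [div_div_eq_mul_div]; ring
      simp only [this, Set.mem_ofPred_eq]
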